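/- Let $\varphi=\frac{1+\sqrt5}{2}$, $A=\begin{pmatrix}5&2\\2&3\end{pmatrix}$, $B=\begin{pmatrix}2&1\\1&1\end{pmatrix}$ (these commute). Define $(v_n)_{n\ge1}$ by $v_1=1$ and, for $n\ge1$, $v_{n+1}=(5-2\varphi)v_n$ if $nv_n\le1$ and $v_{n+1}=(2-\varphi)v_n$ if $nv_n>1$. Put $M(1)=(1,1)^T$ and, for $n\ge1$, $M(n+1)=A$ if $nv_n\le1$ and $M(n+1)=B$ if $nv_n>1$. Let $\theta^1(A)=2211111$, $\theta^2(A)=22211$, $\theta^1(B)=211$, $\theta^2(B)=21$. A clopen Kakutani–Rokhlin (CKR) partition of a minimal Cantor system $(X,T)$ is a partition of $X$ into nonempty clopen sets $T^{-j}B_k$, $1\le k\le C$, $0\le j<h_k$; its roof is $\bigcup_kB_k$. A sequence of CKR partitions $\mathcal P(n)=\{T^{-j}B_k(n):1\le k\le C(n),\,0\le j<h_k(n)\}$, $n\ge0$, with roofs $B(n)$, is called nested here if $\mathcal P(0)=\{X\}$ (one tower, of height $1$), $B(n+1)\subseteq B_1(n)$, $\mathcal P(n+1)$ refines $\mathcal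 P(n)$, $\bigcap_nB(n)$ is a single point, the atoms of all $\mathcal P(n)$ generate the topology of $X$, and for all $n,k,l$ there is $0\le j<h_l(n+1)$ with $T^{-j}B_l(n+1)\subseteq B_k(n)$. Its matrices are $M(n)=(m_{l,k}(n))$ with $m_{l,k}(n)=\#\{0\le j<h_l(n):T^{-j}B_l(n)\subseteq B_k(n-1)\}$, and $\theta^t(n)$ is the word of the indices $k$ of the sets $B_k(n)$ that contain some $T^{-j}B_t(n+1)$, $0\le j<h_t(n+1)$, listed in decreasing order of $j$. A minimal Cantor system is linearly recurrent if it has such a sequence and a constant $L$ with $h_l(n+1)\le L\,h_k(n)$ for all $n,k,l$. Let $\mathcal S$ be the class of minimal Cantor systems $(X,T)$ that have a nested sequence of CKR partitions with $C(n)=2$ for $n\ge1$, with matrices the $M(n)$ prescribed above, and with $\theta^t(n)=\theta^t(M(n+1))$ for all $n\ge1$, $t\in\{1,2\}$. **Proposition.** (i) $\mathcal S$ is nonempty. In fact, let $\sigma_A,\sigma_B$ be the substitutions $t\mapsto\theta^t(A)$, $t\mapsto\theta^t(B)$ on $\{1,2\}$, let $\sigma_1=\mathrm{Id}$ and $\sigma_{n+1}=\sigma_n\circ\sigma_{M(n+1)}$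 for $n\ge1$. Then $\dots111\,\sigma_n(1).\sigma_n(2)\,222\dots$ converges to some $\omega\in\{1,2\}^{\mathbb Z}$, and the shift on the orbit closure of $\omega$ belongs to $\mathcal S$. (ii) Let $(X,T)$ be any system in $\mathcal S$. Then $(X,T)$ is linearly recurrent and has a unique $T$-invariant Borel probability measure $\mu$, which is ergodic. The set of eigenvalues of $(X,T)$ with respect to $\mu$ (those $\lambda\in\mathbb C$ for which $f\circ T=\lambda f$ for some nonzero $f\in L^2(\mu)$) is $$E_\mu=\{\exp(2i\pi\alpha):\ \alpha=(\varphi-1,\,2-\varphi)\,A^{-l}w,\ l\ge0,\ w\in\mathbb Z^2\}.$$ The only continuous eigenvalue (one with a nonzero continuous eigenfunction) is $1$. Consequently $(X,T,\mu)$ has a nontrivial Kronecker factor: there is a $T$-invariant sub-$\sigma$-algebra $\mathcal K$ of the Borel sets for which $L^2(X,\mathcal K,\mu)$ is the closed linear span of the eigenfunctions, and $\mathcal K$ contains a set of measure different from $0$ and $1$. The maximal equicontinuous factor of $(X,T)$ is the one-point system. -/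

import Mathlib

open Set Filter Topology MeasureTheory

universe u

namespace KRSystem


/-! ## Minimal Cantor systems and their eigenvalues -/

section Dynamics

variable {X : Type u} [TopologicalSpace X]

/-- `(X, T)` is a minimal Cantor system: `X` is a nonempty compact metrizable space with a countable
basis of clopen sets and without isolated points, and all orbits of `T` are dense. -/
structure IsMinimalCantorSystem (T : X ≃ₜ X) : Prop where
  nonempty : Nonempty X
  compact : CompactSpace X
  metrizable : TopologicalSpace.MetrizableSpace X
  clopen_basis : ∃ b : Set (Set X), b.Countable ∧ TopologicalSpace.IsTopologicalBasis b ∧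
    ∀ s ∈ b, IsClopen s
  no_isolated : ∀ x : X, ¬ IsOpen ({x} : Set X)
  minimal : ∀ x : X, Dense (Set.range fun n : ℤ => (T ^ n) x)

/-- `lam` is a continuous eigenvalue of `(X, T)`. -/
def IsContinuousEigenvalue (T : X ≃ₜ X) (lam : ℂ) : Prop :=
  ∃ f : X → ℂ, Continuous f ∧ f ≠ 0 ∧ ∀ x, f (T x) = lam * f x

/-- `lam` is an eigenvalue of `(X, T)` with respect to `μ`: there is a nonzero `f` in `L²(μ)` with
`f ∘ T = lam f` in `L²(μ)`. -/
def IsEigenvalue [MeasurableSpace X] (T : X ≃ₜ X) (μ : Measure X) (lam : ℂ) : Prop :=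
  ∃ f : X → ℂ, MemLp f 2 μ ∧ ¬ (f =ᵐ[μ] 0) ∧ (fun x => f (T x)) =ᵐ[μ] fun x => lam * f x

/-! ## Kronecker factor and maximal equicontinuous factor -/

/-- The set of all eigenfunctions of `(X, T, μ)` in `L²(μ)`. -/
def eigenfunctions {m0 : MeasurableSpace X} (T : X ≃ₜ X) (μ : Measure X) : Set (Lp ℂ 2 μ) :=
  {f | f ≠ 0 ∧ ∃ lam : ℂ, (fun x => f (T x)) =ᵐ[μ] fun x => lam * f x}

/-- The sub-σ-algebra `K` determines the Kronecker factor of `(X, T, μ)`: it is `T`-invariant, and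
`L²(X, K, μ)` is the closed linear span of the eigenfunctions. -/
structure IsKroneckerAlgebra (K : MeasurableSpace X) {m0 : MeasurableSpace X} (T : X ≃ₜ X)
    (μ : Measure X) : Prop where
  le : K ≤ m0
  invariant : MeasurableSpace.comap T K = K
  span_eq : lpMeas ℂ ℂ K 2 μ = (Submodule.span ℂ (eigenfunctions T μ)).topologicalClosure

/-- `π` is a factor map from `(X, T)` onto `(Y, S)`. -/
structure IsFactorMap {Y : Type u} [TopologicalSpace Y] (T : X ≃ₜ X) (S : Y ≃ₜ Y)
    (π : X → Y) : Prop where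
  continuous : Continuous π
  surjective : Function.Surjective π
  comm : ∀ x, π (T x) = S (π x)

/-- `(Y, S)` is equicontinuous: the family of all powers of `S` is equicontinuous. -/
def IsEquicontinuousSystem {Y : Type u} [MetricSpace Y] (S : Y ≃ₜ Y) : Prop :=
  Equicontinuous fun (n : ℤ) (y : Y) => (S ^ n) y

/-- `π : (X, T) → (Y, S)` is the maximal equicontinuous factor of `(X, T)`: it is an equicontinuous
factor, and every equicontinuous factor (on a compact metric space) factors through it. -/
structure IsMaximalEquicontinuousFactor {Y : Type u} [MetricSpace Y] (T : X ≃ₜ X) (S : Y ≃ₜ Y)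
    (π : X → Y) : Prop where
  factor : IsFactorMap T S π
  equicontinuous : IsEquicontinuousSystem S
  universal : ∀ (Z : Type u) [MetricSpace Z] [CompactSpace Z] (R : Z ≃ₜ Z) (ρ : X → Z),
    IsFactorMap T R ρ → IsEquicontinuousSystem R → ∃ q : Y → Z, IsFactorMap S R q ∧ ρ = q ∘ π

/-! ## Clopen Kakutani-Rokhlin partitions -/

/-- A clopen Kakutani-Rokhlin partition `{T⁻ʲ B_k : 1 ≤ k ≤ C, 0 ≤ j < h_k}` of `X`.
The towers are numbered `1, …, C`; the values `B k`, `h k` for other `k` play no role. -/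
structure CKRPartition (T : X ≃ₜ X) where
  C : ℕ
  B : ℕ → Set X
  h : ℕ → ℕ
  C_pos : 0 < C
  clopen : ∀ k ∈ Finset.Icc 1 C, IsClopen (B k)
  nonempty : ∀ k ∈ Finset.Icc 1 C, (B k).Nonempty
  h_pos : ∀ k ∈ Finset.Icc 1 C, 0 < h k
  disjoint : ∀ k ∈ Finset.Icc 1 C, ∀ k' ∈ Finset.Icc 1 C, ∀ j < h k, ∀ j' < h k',
    (k, j) ≠ (k', j') → Disjoint (T^[j] ⁻¹' B k) (T^[j'] ⁻¹' B k')
  cover : ∀ x : X, ∃ k ∈ Finset.Icc 1 C, ∃ j < h k, x ∈ T^[j] ⁻¹' B k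

namespace CKRPartition

variable {T : X ≃ₜ X}

/-- The atoms `T⁻ʲ B_k` of the partition. -/
def atoms (P : CKRPartition T) : Set (Set X) :=
  {A | ∃ k ∈ Finset.Icc 1 P.C, ∃ j < P.h k, A = T^[j] ⁻¹' P.B k}

/-- The roof `B = ⋃ B_k`. -/
def roof (P : CKRPartition T) : Set X := ⋃ k ∈ Finset.Icc 1 P.C, P.B k

open Classical in
/-- The number of `0 ≤ j < h_l` with `T⁻ʲ B_l ⊆ B'_k`, where `B_l, h_l` belong to `P` and `B'_k`
belongs to the coarser partition `Q`. -/
noncomputable def incidence (P Q : CKRPartition T) (l k : ℕ) : ℕ :=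
  ((Finset.range (P.h l)).filter fun j => T^[j] ⁻¹' P.B l ⊆ Q.B k).card

open Classical in
/-- The word of indices of the towers of the coarser partition `Q` that tower `t` of `P` crosses,
read from bottom to top: `j` runs downwards through those `0 ≤ j < h_t` for which `T⁻ʲ B_t` lies in
some `B'_k` of `Q`, and the letter recorded is this `k`. -/
noncomputable def towerWord (P Q : CKRPartition T) (t : ℕ) : List ℕ :=
  (List.range (P.h t)).reverse.filterMap fun j =>
    if H : ∃ k ∈ Finset.Icc 1 Q.C, T^[j] ⁻¹' P.B t ⊆ Q.B k then some H.choose else none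

end CKRPartition

/-- `P(0), P(1), …` is a nested sequence of CKR partitions: it starts with the trivial partition,
roofs decrease, partitions get finer, the roofs meet in exactly one point, the atoms span the
topology, every tower of level `n + 1` crosses every tower of level `n`, and the roof of level
`n + 1` lies in the roof of the first tower of level `n`. -/
structure IsNestedSequence {T : X ≃ₜ X} (P : ℕ → CKRPartition T) : Prop where
  zero_C : (P 0).C = 1
  zero_B : (P 0).B 1 = Set.univ
  zero_h : (P 0).h 1 = 1
  roof_anti : ∀ n, (P (n + 1)).roof ⊆ (P n).roof
  refines : ∀ n, ∀ a ∈ (P (n + 1)).atoms, ∃ a' ∈ (P n).atoms, a ⊆ a'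
  roof_inter : ∃ x : X, ⋂ n, (P n).roof = {x}
  spans : ‹TopologicalSpace X› = TopologicalSpace.generateFrom (⋃ n, (P n).atoms)
  crosses : ∀ n, ∀ k ∈ Finset.Icc 1 (P n).C, ∀ l ∈ Finset.Icc 1 (P (n + 1)).C,
    ∃ j < (P (n + 1)).h l, T^[j] ⁻¹' (P (n + 1)).B l ⊆ (P n).B k
  roof_subset_first : ∀ n, (P (n + 1)).roof ⊆ (P n).B 1

/-- The minimal Cantor system `(X, T)` is linearly recurrent. -/
def IsLinearlyRecurrent (T : X ≃ₜ X) : Prop :=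
  IsMinimalCantorSystem T ∧ ∃ P : ℕ → CKRPartition T, IsNestedSequence P ∧
    ∃ L : ℕ, ∀ n, ∀ l ∈ Finset.Icc 1 (P (n + 1)).C, ∀ k ∈ Finset.Icc 1 (P n).C,
      (P (n + 1)).h l ≤ L * (P n).h k

end Dynamics

/-! ## The explicit system -/

/-- The matrix `A`. -/
def matA : Matrix (Fin 2) (Fin 2) ℕ := !![5, 2; 2, 3]

/-- The matrix `B`. -/
def matB : Matrix (Fin 2) (Fin 2) ℕ := !![2, 1; 1, 1]

/-- The sequence `v 1 = 1` and, for `n ≥ 1`, `v (n + 1) = (5 - 2φ) v n` if `n v n ≤ 1` and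
`v (n + 1) = (2 - φ) v n` if `n v n > 1`. The value `v 0` plays no role. -/
noncomputable def v : ℕ → ℝ
  | 0 => 1
  | 1 => 1
  | n + 2 => if ((n + 1 : ℕ) : ℝ) * v (n + 1) ≤ 1 then (5 - 2 * Real.goldenRatio) * v (n + 1)
      else (2 - Real.goldenRatio) * v (n + 1)

/-- `nextMat n` is the matrix `M(n + 1)`, for `n ≥ 1`. -/
noncomputable def nextMat (n : ℕ) : Matrix (Fin 2) (Fin 2) ℕ :=
  if (n : ℝ) * v n ≤ 1 then matA else matB

/-- The words `θᵗ(A)`, for `t = 1, 2`. -/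
def wordA (t : ℕ) : List ℕ := if t = 1 then [2, 2, 1, 1, 1, 1, 1] else [2, 2, 2, 1, 1]

/-- The words `θᵗ(B)`, for `t = 1, 2`. -/
def wordB (t : ℕ) : List ℕ := if t = 1 then [2, 1, 1] else [2, 1]

/-- `nextWord n t` is the word `θᵗ(M(n + 1))`, for `n ≥ 1` and `t = 1, 2`. -/
noncomputable def nextWord (n t : ℕ) : List ℕ :=
  if (n : ℝ) * v n ≤ 1 then wordA t else wordB t

/-- `(X, T)` is (a realization of) the explicit system: a minimal Cantor system with a nested
sequence of CKR partitions whose matrices are `M(1) = (1, 1)ᵀ` and the prescribed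
`M(n + 1)`, `n ≥ 1`, and whose towers are stacked as the prescribed words say. -/
def IsExampleSystem {X : Type u} [TopologicalSpace X] (T : X ≃ₜ X) : Prop :=
  IsMinimalCantorSystem T ∧ ∃ P : ℕ → CKRPartition T, IsNestedSequence P ∧
    (∀ n ≥ 1, (P n).C = 2) ∧
    (∀ l ∈ Finset.Icc 1 2, (P 1).incidence (P 0) l 1 = 1) ∧
    (∀ n ≥ 1, ∀ i j : Fin 2,
      (P (n + 1)).incidence (P n) ((i : ℕ) + 1) ((j : ℕ) + 1) = nextMat n i j) ∧
    (∀ n ≥ 1, ∀ t ∈ Finset.Icc 1 2, (P (n + 1)).towerWord (P n) t = nextWord n t)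

/-- The substitutions `σ 1 = id`, `σ (n + 1) = σ n ∘ σ_{M(n + 1)}` for `n ≥ 1`, on the alphabet
`{1, 2}`, given by their values on letters. The value `σ 0` plays no role. -/
noncomputable def σ : ℕ → ℕ → List ℕ
  | 0, a => [a]
  | 1, a => [a]
  | n + 2, a => (nextWord (n + 1) a).flatMap (σ (n + 1))

/-- The two-sided sequence `… 1 1 1 (σ n 1) . (σ n 2) 2 2 2 …`; the coordinate `0` is the one
immediately to the right of the dot. -/
noncomputable def approx (n : ℕ) : ℤ → ℕ := fun i =>
  if 0 ≤ i then (σ n 2).getD i.toNat 2 else (σ n 1).reverse.getD (-i - 1).toNat 1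

/-- The closure of the shift orbit of `ω`. -/
def orbitClosure (ω : ℤ → ℕ) : Set (ℤ → ℕ) :=
  closure (Set.range fun (n : ℤ) (i : ℤ) => ω (i + n))

/-- The shift `(T x)_i = x_{i+1}` on all two-sided sequences. -/
def fullShift : (ℤ → ℕ) ≃ₜ (ℤ → ℕ) where
  toFun x i := x (i + 1)
  invFun x i := x (i - 1)
  left_inv x := by funext i; simp
  right_inv x := by funext i; simp
  continuous_toFun := by fun_prop
  continuous_invFun := by fun_prop

theorem mem_orbitClosure_iff (ω x : ℤ → ℕ) :
    x ∈ orbitClosure ω ↔ fullShift x ∈ orbitClosure ω := by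
  have hR : fullShift ⁻¹' (Set.range fun (n : ℤ) (i : ℤ) => ω (i + n)) =
      Set.range fun (n : ℤ) (i : ℤ) => ω (i + n) := by
    ext y
    constructor
    · rintro ⟨n, hn⟩
      refine ⟨n - 1, ?_⟩
      funext i
      have := congrFun hn (i - 1)
      change ω (i - 1 + n) = y (i - 1 + 1) at this
      rw [sub_add_cancel] at this
      rw [← this]
      change ω (i + (n - 1)) = _
      congr 1
      ring
    · rintro ⟨n, rfl⟩
      refine ⟨n + 1, ?_⟩
      funext i
      change ω (i + (n + 1)) = ω (i + 1 + n)
      congr 1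
      ring
  have h : fullShift ⁻¹' orbitClosure ω = orbitClosure ω := by
    rw [orbitClosure, fullShift.preimage_closure, hR]
  exact (Set.ext_iff.mp h x).symm

/-- The shift on the orbit closure of `ω`. -/
def subshift (ω : ℤ → ℕ) : orbitClosure ω ≃ₜ orbitClosure ω :=
  fullShift.subtype (mem_orbitClosure_iff ω)

/-- The set of all `exp (2 i π α)` with `α = (φ - 1, 2 - φ) A⁻ˡ w`, `l ≥ 0`, `w ∈ ℤ²`. -/
noncomputable def explicitEigenvalues : Set ℂ :=
  {lam | ∃ (l : ℕ) (w : Fin 2 → ℤ), lam = Complex.exp (2 * Complex.I * Real.pi *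
    ((![Real.goldenRatio - 1, 2 - Real.goldenRatio] ⬝ᵥ
      Matrix.mulVec ((matA.map (fun a : ℕ => (a : ℝ)))⁻¹ ^ l) (fun i => (w i : ℝ)) : ℝ) : ℂ))}

end KRSystem

/-!
The matrices `A` and `B` have the common eigenvectors `(φ, 1)` and `(1, -φ)`, with eigenvalues
`2φ + 3`, `φ + 1` for the first, expanding, one and `5 - 2φ > 1`, `2 - φ < 1` for the second one. The
number `v n` is the product of the second eigenvalues of the first matrices, and the rule that selects
`A` or `B` keeps `n * v n` between positive constants (`mul_v_le`, `le_mul_v`). So the sum of `v n`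
diverges and the sum of `v n ^ 2` converges. The first fact excludes continuous eigenvalues, the second
one produces measurable eigenvalues.

A point is described by its addresses `addr P n x`: the tower of level `n` that contains it and its
depth there. The address of level `n + 1` determines that of level `n` (`addr_desc`). An invariant
measure is determined by the measures of the roofs, which are transported by the matrices; since
`v n → 0` and measures are bounded, they have no component along `(1, -φ)` (`measure_B`), whence
unique ergodicity (`unique_invariant`).

*Eigenvalues.* For an eigenvalue `exp (2πiα)` with height vectors `H n`, the vectors `α * H n` approach
integer vectors (`eventually_norm_pow_height`): the word of tower `1` repeats a letter, and an eigenfunction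
is nearly constant on most atoms of high levels. Bounded orbits of the matrices have no component in the
Perron direction, so `α * H n` is, modulo integer vectors, a multiple of `v n * (1, -φ)`
(`isAngle_of_close`); such `α` form the explicit group (`mem_explicitEigenvalues_iff`). Conversely,
for such `α` the phase of a point is a multiple of its transverse height `theta n`, the sum of `v m` times
the `(1, -φ)`-weights of the towers of level `m < n` above the point. Recentred by constants and
corrected by a term which tends to `0`, it is a martingale with increments of size `v n`, bounded
in `L²` and therefore convergent almost everywhere (`ae_tendsto_theta`); the limit of the phases is an
eigenfunction (`exists_eigenfunction`).

*Continuous eigenvalues and equicontinuous factors.* Because the sum of `v n` diverges, transverse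
heights of factors of the tower words are unbounded, so the numbers of letters in factors of a given
length vary as much as desired. As the two heights of a level are coprime (`H_coprime`), two return times
to its roof differ by `1` (`exists_consecutive_return`). On a small roof a continuous eigenfunction
is nearly constant, and the eigenvalue has to be `1`; in an equicontinuous factor the image of the
common point of the roofs has to be fixed (`map_fixed`).

*Kronecker factor.* The sets whose indicator functions multiply the closed span of the eigenfunctions
into itself form an invariant σ-algebra; eigenfunctions have constant modulus, hence are bounded
multipliers, and by polynomial approximation they are measurable for it (`isKroneckerAlgebra`).

*Existence.* The coordinates of the limit word have addresses, given by the central towers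
(`isAddress_pos`). The words have the form `1 … 1 2 … 2` from top to bottom, so the places where a new
tower of level `n + 1` starts are visible in the addresses of level `n` (`IsAddress.snd_eq_zero_iff`),
and by induction the addresses are sliding block codes (`exists_code`). They extend to the orbit closure and
define the partitions (`IsTopologicalAddress.isExampleSystem`).
-/

namespace KRSystem

/-! ### Words of towers and addresses inside a tower -/

/-- The total height of a stack of towers, one for each letter of `w`. -/
def hsum (h : ℕ → ℕ) (w : List ℕ) : ℕ := (w.map h).sum

/-- The address of depth `j` in a stack of towers with letters `w` (from top to bottom): the letter
of the tower that contains this depth, and the depth inside that tower. The value is junk if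
`j` is at least the total height. -/
def desc (h : ℕ → ℕ) : List ℕ → ℕ → ℕ × ℕ
  | [], j => (0, j)
  | c :: w, j => if j < h c then (c, j) else desc h w (j - h c)

/-- The letters of the stack `w` that lie strictly above the tower containing depth `j`. -/
def upper (h : ℕ → ℕ) : List ℕ → ℕ → List ℕ
  | [], _ => []
  | c :: w, j => if j < h c then [] else c :: upper h w (j - h c)

section Words

variable {h : ℕ → ℕ} {w w' : List ℕ} {c i j : ℕ}

@[simp] theorem hsum_nil : hsum h [] = 0 := rfl

@[simp] theorem hsum_cons : hsum h (c :: w) = h c + hsum h w := by simp [hsum]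

@[simp] theorem hsum_append : hsum h (w ++ w') = hsum h w + hsum h w' := by simp [hsum]

theorem desc_append_right : desc h (w ++ w') (hsum h w + j) = desc h w' j := by
  induction w with
  | nil => simp
  | cons c w ih =>
    have h1 : ¬ h c + hsum h w + j < h c := by omega
    have h2 : h c + hsum h w + j - h c = hsum h w + j := by omega
    simp [desc, h1, h2, ih]

theorem desc_cell (hi : i < h c) : desc h (w ++ c :: w') (hsum h w + i) = (c, i) := by
  rw [desc_append_right]; simp [desc, hi]

theorem upper_cell (hi : i < h c) : upper h (w ++ c :: w') (hsum h w + i) = w := by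
  induction w with
  | nil => simp [upper, hi]
  | cons d w ih =>
    have h1 : ¬ h d + hsum h w + i < h d := by omega
    have h2 : h d + hsum h w + i - h d = hsum h w + i := by omega
    simp [upper, h1, h2, ih]

theorem exists_cell (hj : j < hsum h w) :
    ∃ u c u' i, w = u ++ c :: u' ∧ j = hsum h u + i ∧ i < h c := by
  induction w generalizing j with
  | nil => simp at hj
  | cons c w ih =>
    by_cases h1 : j < h c
    · exact ⟨[], c, w, j, by simp, by simp, h1⟩
    · obtain ⟨u, d, u', i, rfl, h3, h4⟩ := ih (j := j - h c) (by simp at hj; omega)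
      exact ⟨c :: u, d, u', i, by simp, by simp; omega, h4⟩

theorem desc_fst_mem (hj : j < hsum h w) : (desc h w j).1 ∈ w := by
  obtain ⟨u, c, u', i, rfl, rfl, h4⟩ := exists_cell hj
  simp [desc_cell h4]

theorem desc_snd_lt (hj : j < hsum h w) : (desc h w j).2 < h (desc h w j).1 := by
  obtain ⟨u, c, u', i, rfl, rfl, h4⟩ := exists_cell hj
  simp [desc_cell h4, h4]

theorem hsum_upper_add (hj : j < hsum h w) : hsum h (upper h w j) + (desc h w j).2 = j := by
  obtain ⟨u, c, u', i, rfl, rfl, h4⟩ := exists_cell hj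
  simp [desc_cell h4, upper_cell h4]

theorem upper_mem (hj : j < hsum h w) {a : ℕ} (ha : a ∈ upper h w j) : a ∈ w := by
  obtain ⟨u, c, u', i, rfl, rfl, h4⟩ := exists_cell hj
  rw [upper_cell h4] at ha
  simp [ha]

/-- Summation over the levels of a stack of towers, one tower at a time. -/
theorem sum_range_hsum_cons {M : Type*} [AddCommMonoid M] (G : ℕ × ℕ → List ℕ → M) :
    ∑ j ∈ Finset.range (hsum h (c :: w)), G (desc h (c :: w) j) (upper h (c :: w) j) =
      (∑ i ∈ Finset.range (h c), G (c, i) []) +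
      ∑ j ∈ Finset.range (hsum h w), G (desc h w j) (c :: upper h w j) := by
  rw [hsum_cons, Finset.sum_range_add]
  congr 1
  · refine Finset.sum_congr rfl fun i hi => ?_
    simp [desc, upper, Finset.mem_range.1 hi]
  · refine Finset.sum_congr rfl fun i _ => ?_
    simp [desc, upper]

theorem sum_range_hsum {M : Type*} [AddCommMonoid M] (G : ℕ × ℕ → M) :
    ∑ j ∈ Finset.range (hsum h w), G (desc h w j) =
      (w.map fun c => ∑ i ∈ Finset.range (h c), G (c, i)).sum := by
  induction w with
  | nil => simp
  | cons c w ih =>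
    have := sum_range_hsum_cons (h := h) (c := c) (w := w) (fun a _ => G a)
    rw [this, ih]; simp

theorem card_filter_desc (hpos : ∀ c ∈ w, 0 < h c) (k : ℕ) :
    ((Finset.range (hsum h w)).filter fun j => desc h w j = (k, 0)).card = w.count k := by
  rw [Finset.card_filter, sum_range_hsum (fun a => if a = (k, 0) then 1 else 0)]
  induction w with
  | nil => simp
  | cons c w ih =>
    rw [List.map_cons, List.sum_cons, ih fun d hd => hpos d (by simp [hd])]
    have hc := hpos c (by simp)
    by_cases hk : c = k
    · subst hk
      simp [hc, add_comm]
    · simp [hk]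

/-- Reading off the letters at the tops of the towers of a stack gives back its word. -/
theorem filterMap_desc (hpos : ∀ c ∈ w, 0 < h c) :
    ((List.range (hsum h w)).filterMap fun j =>
      if (desc h w j).2 = 0 then some (desc h w j).1 else none) = w := by
  induction w with
  | nil => simp
  | cons c w ih =>
    rw [hsum_cons, List.range_add, List.filterMap_append]
    have hc := hpos c (by simp)
    have h1 : ((List.range (h c)).filterMap fun j =>
        if (desc h (c :: w) j).2 = 0 then some (desc h (c :: w) j).1 else none) = [c] := by
      obtain ⟨n, hn⟩ : ∃ n, h c = n + 1 := ⟨h c - 1, by omega⟩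
      rw [hn, List.range_succ_eq_map, List.filterMap_cons_some (b := c)]
      · congr 1
        rw [List.filterMap_eq_nil_iff]
        intro a ha
        simp only [List.mem_map, List.mem_range] at ha
        obtain ⟨b, hb, rfl⟩ := ha
        simp [desc, hn, hb]
      · simp [desc, hc]
    rw [h1, List.filterMap_map]
    have h2 : ((fun j => if (desc h (c :: w) j).2 = 0 then some (desc h (c :: w) j).1 else none) ∘
        fun x => h c + x) = fun j =>
        if (desc h w j).2 = 0 then some (desc h w j).1 else none := by
      funext j; simp [desc]
    rw [h2, ih fun d hd => hpos d (by simp [hd])]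
    rfl

/-- A sequence of addresses that moves down one level at a time, from the top of one tower to the
bottom of another one, describes the stack of the towers it meets. -/
theorem address_eq_desc {N : ℕ} (hN : 0 < N) (a : ℕ → ℕ × ℕ)
    (hlt : ∀ j < N, (a j).2 < h (a j).1) (h0 : (a 0).2 = 0)
    (hstep : ∀ j, j + 1 < N → (a j).2 + 1 < h (a j).1 → a (j + 1) = ((a j).1, (a j).2 + 1))
    (hjump : ∀ j, j + 1 < N → (a j).2 + 1 = h (a j).1 → (a (j + 1)).2 = 0)
    (hend : (a (N - 1)).2 + 1 = h (a (N - 1)).1)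
    (hw : w = (List.range N).filterMap fun j => if (a j).2 = 0 then some (a j).1 else none) :
    hsum h w = N ∧ ∀ j < N, a j = desc h w j := by
  have key : ∀ j < N, ∃ L, ((List.range (j + 1)).filterMap fun j =>
      if (a j).2 = 0 then some (a j).1 else none) = L ++ [(a j).1] ∧ hsum h L + (a j).2 = j := by
    intro j
    induction j with
    | zero => intro _; exact ⟨[], by simp [h0], by simp [h0]⟩
    | succ j ih =>
      intro hj
      obtain ⟨L, hL, hs⟩ := ih (by omega)
      have := hlt j (by omega)
      rw [List.range_succ, List.filterMap_append, hL]
      by_cases hc : (a j).2 + 1 < h (a j).1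
      · have h1 := hstep j hj hc
        exact ⟨L, by simp [h1], by rw [h1]; simp; omega⟩
      · have hc' : (a j).2 + 1 = h (a j).1 := by omega
        have h1 := hjump j hj hc'
        exact ⟨L ++ [(a j).1], by simp [h1], by simp [h1]; omega⟩
  constructor
  · obtain ⟨L, hL, hs⟩ := key (N - 1) (by omega)
    rw [show N - 1 + 1 = N by omega] at hL
    rw [hw, hL]; simp; omega
  · intro j hj
    obtain ⟨L, hL, hs⟩ := key j hj
    have h1 : List.range N = List.range (j + 1) ++ (List.range (N - (j + 1))).map (j + 1 + ·) := by
      rw [← List.range_add]; congr 1; omega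
    rw [hw, h1, List.filterMap_append, hL, List.append_assoc, List.singleton_append]
    have h3 := fun u => desc_cell (w := L) (w' := u) (hlt j hj)
    rw [hs] at h3
    exact (h3 _).symm

end Words

/-! ### The sequence of small eigenvalues -/

/-- The matrix `M(n + 1)` is `A`. -/
def IsA (n : ℕ) : Prop := (n : ℝ) * v n ≤ 1

local notation "φ" => Real.goldenRatio

theorem phi_sq : φ ^ 2 = φ + 1 := Real.goldenRatio_sq

theorem phi_gt : 1.618 < φ := by
  have h := phi_sq
  have h1 := Real.one_lt_goldenRatio
  by_contra hc
  push Not at hc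
  nlinarith

theorem phi_lt : φ < 1.6181 := by
  have h := phi_sq
  have h1 := Real.one_lt_goldenRatio
  by_contra hc
  push Not at hc
  nlinarith

theorem v_succ_A {n : ℕ} (hn : 1 ≤ n) (h : IsA n) : v (n + 1) = (5 - 2 * φ) * v n := by
  obtain ⟨k, rfl⟩ : ∃ k, n = k + 1 := ⟨n - 1, by omega⟩
  rw [v]; exact if_pos h

theorem v_succ_B {n : ℕ} (hn : 1 ≤ n) (h : ¬ IsA n) : v (n + 1) = (2 - φ) * v n := by
  obtain ⟨k, rfl⟩ : ∃ k, n = k + 1 := ⟨n - 1, by omega⟩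
  rw [v]; exact if_neg h

theorem v_one : v 1 = 1 := rfl

theorem v_pos {n : ℕ} (hn : 1 ≤ n) : 0 < v n := by
  induction n, hn using Nat.le_induction with
  | base => simp [v_one]
  | succ n hn ih =>
    have := phi_lt
    by_cases h : IsA n
    · rw [v_succ_A hn h]; exact mul_pos (by linarith) ih
    · rw [v_succ_B hn h]; exact mul_pos (by linarith) ih

/-- The rule for `v` is a feedback that keeps `n * v n` between two positive constants: `v n`
is multiplied by a number in `(1, 2)` when `n * v n` is at most `1`, and by one less than `1/2` otherwise. -/
theorem mul_v_le {n : ℕ} (hn : 1 ≤ n) : n * v n ≤ 4 := by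
  induction n, hn using Nat.le_induction with
  | base => norm_num [v_one]
  | succ n hn ih =>
    have h1 := phi_lt
    have h2 := phi_gt
    have hv := v_pos hn
    have hn' : (1 : ℝ) ≤ n := by exact_mod_cast hn
    have h3 : ((n + 1 : ℕ) : ℝ) * v n ≤ 2 * (n * v n) := by push_cast; nlinarith
    by_cases h : IsA n
    · rw [v_succ_A hn h]
      have h' : n * v n ≤ 1 := h
      calc ((n + 1 : ℕ) : ℝ) * ((5 - 2 * φ) * v n) = (5 - 2 * φ) * (((n + 1 : ℕ) : ℝ) * v n) := by ring
        _ ≤ (5 - 2 * φ) * 2 := mul_le_mul_of_nonneg_left (by linarith) (by linarith)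
        _ ≤ 4 := by linarith
    · rw [v_succ_B hn h]
      calc ((n + 1 : ℕ) : ℝ) * ((2 - φ) * v n) = (2 - φ) * (((n + 1 : ℕ) : ℝ) * v n) := by ring
        _ ≤ (2 - φ) * 8 := mul_le_mul_of_nonneg_left (by linarith) (by linarith)
        _ ≤ 4 := by linarith

theorem le_mul_v {n : ℕ} (hn : 1 ≤ n) : 1 / 3 ≤ n * v n := by
  induction n, hn using Nat.le_induction with
  | base => norm_num [v_one]
  | succ n hn ih =>
    have h1 := phi_lt
    have h2 := phi_gt
    have hv := v_pos hn
    have hn' : (1 : ℝ) ≤ n := by exact_mod_cast hn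
    have h3 : n * v n ≤ ((n + 1 : ℕ) : ℝ) * v n := by push_cast; nlinarith
    by_cases h : IsA n
    · rw [v_succ_A hn h]
      calc (1 : ℝ) / 3 ≤ 1 * (((n + 1 : ℕ) : ℝ) * v n) := by linarith
        _ ≤ (5 - 2 * φ) * (((n + 1 : ℕ) : ℝ) * v n) :=
          mul_le_mul_of_nonneg_right (by linarith) (by linarith)
        _ = _ := by ring
    · rw [v_succ_B hn h]
      have h' : 1 < n * v n := by
        by_contra hc; exact h (not_lt.1 hc)
      calc (1 : ℝ) / 3 ≤ (2 - φ) * 1 := by linarith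
        _ ≤ (2 - φ) * (((n + 1 : ℕ) : ℝ) * v n) :=
          mul_le_mul_of_nonneg_left (by linarith) (by linarith)
        _ = _ := by ring

theorem v_le {n : ℕ} (hn : 1 ≤ n) : v n ≤ 4 / n := by
  have hn' : (0 : ℝ) < n := by exact_mod_cast hn
  rw [le_div_iff₀ hn', mul_comm]; exact mul_v_le hn

theorem le_v {n : ℕ} (hn : 1 ≤ n) : 1 / 3 / n ≤ v n := by
  have hn' : (0 : ℝ) < n := by exact_mod_cast hn
  rw [div_le_iff₀ hn', mul_comm]; exact le_mul_v hn

theorem tendsto_v : Tendsto v atTop (𝓝 0) := by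
  refine squeeze_zero' (g := fun n : ℕ => (4 : ℝ) / n) ?_ ?_ ?_
  · filter_upwards [eventually_ge_atTop 1] with n hn using (v_pos hn).le
  · filter_upwards [eventually_ge_atTop 1] with n hn using v_le hn
  · exact tendsto_const_div_atTop_nhds_zero_nat 4

theorem summable_v_sq : Summable fun n => v (n + 1) ^ 2 := by
  have h : Summable fun n : ℕ => 16 * (1 / ((n + 1 : ℕ) : ℝ) ^ 2) :=
    (((summable_nat_add_iff 1).2 (Real.summable_one_div_nat_pow.2 one_lt_two))).mul_left 16
  refine Summable.of_nonneg_of_le (fun n => sq_nonneg _) (fun n => ?_) h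
  have h1 := v_le (n := n + 1) (by omega)
  have h2 := (v_pos (n := n + 1) (by omega)).le
  calc v (n + 1) ^ 2 ≤ (4 / ((n + 1 : ℕ) : ℝ)) ^ 2 := by gcongr
    _ = _ := by ring

/-- The sums of `v` over long intervals are unbounded. -/
theorem exists_sum_v_gt (m : ℕ) (hm : 1 ≤ m) (C : ℝ) :
    ∃ k, C < ∑ i ∈ Finset.range k, v (m + i) := by
  have h' : ¬ Summable fun i => v (m + i) := by
    intro hs
    have hs2 : Summable fun i : ℕ => (1 : ℝ) / ((i + m : ℕ) : ℝ) := by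
      refine Summable.of_nonneg_of_le (fun i => by positivity) (fun i => ?_) (hs.mul_left 3)
      have := le_v (n := m + i) (by omega)
      rw [add_comm i m]
      calc (1 : ℝ) / ((m + i : ℕ) : ℝ) = 3 * (1 / 3 / ((m + i : ℕ) : ℝ)) := by ring
        _ ≤ _ := by linarith
    rw [summable_nat_add_iff m (f := fun i : ℕ => (1 : ℝ) / (i : ℝ))] at hs2
    exact Real.not_summable_one_div_natCast hs2
  have h2 := (not_summable_iff_tendsto_nat_atTop_of_nonneg
    (fun i => (v_pos (n := m + i) (by omega)).le)).1 h'
  exact (tendsto_atTop.1 h2 (C + 1)).exists.imp fun k hk => by linarith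

/-- The matrix `A` occurs infinitely often. -/
theorem exists_isA (n : ℕ) : ∃ m ≥ n, IsA m := by
  by_contra hc
  push Not at hc
  have h1 := phi_lt
  have h2 := phi_gt
  set N := n + 1
  -- With `B` alone `n * v n` would decay at least by the factor `(2 - φ) * 2 < 0.8` in each step.
  have key : ∀ k, ((N + k : ℕ) : ℝ) * v (N + k) ≤ 4 * (0.8 : ℝ) ^ k := by
    intro k
    induction k with
    | zero => simpa using mul_v_le (n := N) (by omega)
    | succ k ih =>
      have hv := v_pos (n := N + k) (by omega)
      have hn' : (1 : ℝ) ≤ ((N + k : ℕ) : ℝ) := by exact_mod_cast (by omega : 1 ≤ N + k)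
      rw [← add_assoc, v_succ_B (by omega) (hc _ (by omega))]
      have h3 : ((N + k + 1 : ℕ) : ℝ) * v (N + k) ≤ 2 * (((N + k : ℕ) : ℝ) * v (N + k)) := by
        rw [Nat.cast_add_one]; nlinarith
      calc ((N + k + 1 : ℕ) : ℝ) * ((2 - φ) * v (N + k))
          = (2 - φ) * (((N + k + 1 : ℕ) : ℝ) * v (N + k)) := by ring
        _ ≤ 0.4 * (2 * (((N + k : ℕ) : ℝ) * v (N + k))) :=
          mul_le_mul (by linarith) h3 (by positivity) (by norm_num)
        _ ≤ 0.4 * (2 * (4 * 0.8 ^ k)) := by linarith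
        _ = _ := by rw [pow_succ]; ring
  obtain ⟨k, hk⟩ := exists_pow_lt_of_lt_one (show (0 : ℝ) < 1 / 12 by norm_num)
    (show (0.8 : ℝ) < 1 by norm_num)
  have := key k
  have := le_mul_v (n := N + k) (by omega)
  linarith

/-! ### Words and heights of the towers -/

/-- The word of tower `l` of level `n + 1`, read from top to bottom. -/
noncomputable def topword (n l : ℕ) : List ℕ := (nextWord n l).reverse

/-- The heights of the towers: `H n l` is the height of tower `l` of level `n ≥ 1`. The value at level
`0` is a placeholder. -/
noncomputable def H : ℕ → ℕ → ℕ
  | 0, _ => 1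
  | 1, _ => 1
  | n + 2, l => hsum (H (n + 1)) (topword (n + 1) l)

theorem topword_one_A {n : ℕ} (h : IsA n) : topword n 1 = [1, 1, 1, 1, 1, 2, 2] := by
  have h' : (n : ℝ) * v n ≤ 1 := h
  simp [topword, nextWord, h', wordA]

theorem topword_two_A {n : ℕ} (h : IsA n) : topword n 2 = [1, 1, 2, 2, 2] := by
  have h' : (n : ℝ) * v n ≤ 1 := h
  simp [topword, nextWord, h', wordA]

theorem topword_one_B {n : ℕ} (h : ¬ IsA n) : topword n 1 = [1, 1, 2] := by
  have h' : ¬ (n : ℝ) * v n ≤ 1 := h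
  simp [topword, nextWord, h', wordB]

theorem topword_two_B {n : ℕ} (h : ¬ IsA n) : topword n 2 = [1, 2] := by
  have h' : ¬ (n : ℝ) * v n ≤ 1 := h
  simp [topword, nextWord, h', wordB]

theorem mem_topword {n l c : ℕ} (hl : l = 1 ∨ l = 2) (hc : c ∈ topword n l) : c = 1 ∨ c = 2 := by
  by_cases h : IsA n <;> rcases hl with rfl | rfl <;>
    simp [topword_one_A, topword_two_A, topword_one_B, topword_two_B, h] at hc <;> omega

/-- Every tower of level `n + 1` has tower `1` of level `n` on top. -/
theorem topword_eq_cons {n l : ℕ} (hl : l = 1 ∨ l = 2) : ∃ w, topword n l = 1 :: w := by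
  by_cases h : IsA n <;> rcases hl with rfl | rfl <;>
    simp [topword_one_A, topword_two_A, topword_one_B, topword_two_B, h]

/-- Every tower of level `n + 1` has tower `2` of level `n` at its bottom. -/
theorem topword_eq_append {n l : ℕ} (hl : l = 1 ∨ l = 2) : ∃ w, topword n l = w ++ [2] := by
  by_cases h : IsA n
  · rcases hl with rfl | rfl
    · exact ⟨[1, 1, 1, 1, 1, 2], by simp [topword_one_A h]⟩
    · exact ⟨[1, 1, 2, 2], by simp [topword_two_A h]⟩
  · rcases hl with rfl | rfl
    · exact ⟨[1, 1], by simp [topword_one_B h]⟩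
    · exact ⟨[1], by simp [topword_two_B h]⟩

theorem topword_one_eq (n : ℕ) : ∃ w, topword n 1 = 1 :: 1 :: w := by
  by_cases h : IsA n <;> simp [topword_one_A, topword_one_B, h]

theorem H_one (l : ℕ) : H 1 l = 1 := rfl

theorem H_succ {n : ℕ} (hn : 1 ≤ n) (l : ℕ) : H (n + 1) l = hsum (H n) (topword n l) := by
  obtain ⟨k, rfl⟩ : ∃ k, n = k + 1 := ⟨n - 1, by omega⟩
  rfl

theorem H_succ_A {n : ℕ} (hn : 1 ≤ n) (h : IsA n) :
    H (n + 1) 1 = 5 * H n 1 + 2 * H n 2 ∧ H (n + 1) 2 = 2 * H n 1 + 3 * H n 2 := by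
  rw [H_succ hn, H_succ hn, topword_one_A h, topword_two_A h]
  simp; omega

theorem H_succ_B {n : ℕ} (hn : 1 ≤ n) (h : ¬ IsA n) :
    H (n + 1) 1 = 2 * H n 1 + H n 2 ∧ H (n + 1) 2 = H n 1 + H n 2 := by
  rw [H_succ hn, H_succ hn, topword_one_B h, topword_two_B h]
  simp; omega

theorem H_bounds {n : ℕ} (hn : 1 ≤ n) : n ≤ H n 2 ∧ H n 2 ≤ H n 1 ∧ H n 1 ≤ 2 * H n 2 := by
  induction n, hn using Nat.le_induction with
  | base => simp [H_one]
  | succ n hn ih =>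
    by_cases h : IsA n
    · have := H_succ_A hn h; omega
    · have := H_succ_B hn h; omega

theorem H_pos {n : ℕ} (hn : 1 ≤ n) {l : ℕ} (hl : l = 1 ∨ l = 2) : 0 < H n l := by
  have := H_bounds hn
  rcases hl with rfl | rfl <;> omega

theorem le_H {n : ℕ} (hn : 1 ≤ n) {l : ℕ} (hl : l = 1 ∨ l = 2) : n ≤ H n l := by
  have := H_bounds hn
  rcases hl with rfl | rfl <;> omega

theorem H_succ_le {n : ℕ} (hn : 1 ≤ n) {k l : ℕ} (hl : l = 1 ∨ l = 2) (hk : k = 1 ∨ k = 2) :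
    H (n + 1) l ≤ 14 * H n k := by
  have h0 := H_bounds hn
  by_cases h : IsA n
  · have := H_succ_A hn h
    rcases hl with rfl | rfl <;> rcases hk with rfl | rfl <;> omega
  · have := H_succ_B hn h
    rcases hl with rfl | rfl <;> rcases hk with rfl | rfl <;> omega

/-- The two heights of a level are coprime. A common prime factor would have to divide `det A = 11`
at some step, but `(3, -1)` is a common left eigenvector modulo `11` of `A` and `B`, for invertible
eigenvalues, which does not vanish at `(1, 1)`. -/
theorem H_coprime {n : ℕ} (hn : 1 ≤ n) : Nat.Coprime (H n 1) (H n 2) := by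
  have h11 : ∀ n ≥ 1, ¬ (11 : ℤ) ∣ 3 * H n 1 - H n 2 := by
    intro n hn
    induction n, hn using Nat.le_induction with
    | base => norm_num [H_one]
    | succ n hn ih =>
      by_cases h : IsA n
      · have := H_succ_A hn h; omega
      · have := H_succ_B hn h; omega
  induction n, hn using Nat.le_induction with
  | base => simp [H_one]
  | succ n hn ih =>
    refine Nat.Coprime.symm (Nat.coprime_of_dvd fun p hp h2 h1 => ?_)
    have h1' : (p : ℤ) ∣ H (n + 1) 1 := by exact_mod_cast h1
    have h2' : (p : ℤ) ∣ H (n + 1) 2 := by exact_mod_cast h2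
    have hfin : (p : ℤ) ∣ H n 1 → (p : ℤ) ∣ H n 2 → False := fun ha hb =>
      Nat.not_coprime_of_dvd_of_dvd hp.one_lt (by exact_mod_cast ha) (by exact_mod_cast hb) ih
    by_cases h : IsA n
    · have hA := H_succ_A hn h
      have e1 : (p : ℤ) ∣ 11 * H n 1 := by
        have := (h1'.mul_left 3).sub (h2'.mul_left 2)
        rwa [show (3 * (H (n + 1) 1 : ℤ) - 2 * H (n + 1) 2) = 11 * H n 1 by
          rw [hA.1, hA.2]; push_cast; ring] at this
      have e2 : (p : ℤ) ∣ 11 * H n 2 := by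
        have := (h2'.mul_left 5).sub (h1'.mul_left 2)
        rwa [show (5 * (H (n + 1) 2 : ℤ) - 2 * H (n + 1) 1) = 11 * H n 2 by
          rw [hA.1, hA.2]; push_cast; ring] at this
      have hpp := Nat.prime_iff_prime_int.1 hp
      rcases hpp.dvd_or_dvd e1 with h3 | h3
      · have h4 : p ∣ 11 := by exact_mod_cast h3
        have h5 : p = 11 := (Nat.prime_dvd_prime_iff_eq hp (by norm_num)).1 h4
        subst h5
        exact h11 (n + 1) (by omega) ((h1'.mul_left 3).sub h2')
      · rcases hpp.dvd_or_dvd e2 with h4 | h4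
        · have h4 : p ∣ 11 := by exact_mod_cast h4
          have h5 : p = 11 := (Nat.prime_dvd_prime_iff_eq hp (by norm_num)).1 h4
          subst h5
          exact h11 (n + 1) (by omega) ((h1'.mul_left 3).sub h2')
        · exact hfin h3 h4
    · have hB := H_succ_B hn h
      refine hfin ?_ ?_
      · have := h1'.sub h2'
        rwa [hB.1, hB.2, show ((2 * H n 1 + H n 2 : ℕ) : ℤ) - (H n 1 + H n 2 : ℕ) = H n 1 by
          push_cast; ring] at this
      · have := (h2'.mul_left 2).sub h1'
        rwa [hB.1, hB.2, show 2 * ((H n 1 + H n 2 : ℕ) : ℤ) - (2 * H n 1 + H n 2 : ℕ) = H n 2 by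
          push_cast; ring] at this

/-- The product of the Perron eigenvalues `2φ + 3` and `φ + 1` of the matrices `M(2), …, M(n)`. The
value at `0` is a placeholder. -/
noncomputable def Lam : ℕ → ℝ
  | 0 => 1
  | 1 => 1
  | n + 2 => open Classical in if IsA (n + 1) then (2 * φ + 3) * Lam (n + 1) else (φ + 1) * Lam (n + 1)

theorem Lam_one : Lam 1 = 1 := rfl

theorem Lam_succ_A {n : ℕ} (hn : 1 ≤ n) (h : IsA n) : Lam (n + 1) = (2 * φ + 3) * Lam n := by
  obtain ⟨k, rfl⟩ : ∃ k, n = k + 1 := ⟨n - 1, by omega⟩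
  rw [Lam, if_pos h]

theorem Lam_succ_B {n : ℕ} (hn : 1 ≤ n) (h : ¬ IsA n) : Lam (n + 1) = (φ + 1) * Lam n := by
  obtain ⟨k, rfl⟩ : ∃ k, n = k + 1 := ⟨n - 1, by omega⟩
  rw [Lam, if_neg h]

theorem one_le_Lam {n : ℕ} (hn : 1 ≤ n) : 1 ≤ Lam n := by
  have := phi_gt
  induction n, hn using Nat.le_induction with
  | base => simp [Lam_one]
  | succ n hn ih =>
    by_cases h : IsA n
    · rw [Lam_succ_A hn h]; nlinarith
    · rw [Lam_succ_B hn h]; nlinarith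

theorem Lam_pos {n : ℕ} (hn : 1 ≤ n) : 0 < Lam n := zero_lt_one.trans_le (one_le_Lam hn)

/-- `(φ, 1)` is a common left eigenvector of `A` and `B` for the Perron eigenvalues. -/
theorem pf_H {n : ℕ} (hn : 1 ≤ n) : φ * H n 1 + H n 2 = (φ + 1) * Lam n := by
  have h0 := phi_sq
  induction n, hn using Nat.le_induction with
  | base => simp [H_one, Lam_one]
  | succ n hn ih =>
    by_cases h : IsA n
    · rw [Lam_succ_A hn h, (H_succ_A hn h).1, (H_succ_A hn h).2]
      push_cast
      linear_combination (2 * φ + 3) * ih - 2 * H n 1 * h0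
    · rw [Lam_succ_B hn h, (H_succ_B hn h).1, (H_succ_B hn h).2]
      push_cast
      linear_combination (φ + 1) * ih - H n 1 * h0

/-! ### Kakutani-Rokhlin partitions and addresses of points -/

theorem hsum_congr {h h' : ℕ → ℕ} {w : List ℕ} (hh : ∀ c ∈ w, h c = h' c) :
    hsum h w = hsum h' w := by
  unfold hsum
  rw [List.map_congr_left hh]

theorem desc_congr {h h' : ℕ → ℕ} {w : List ℕ} (hh : ∀ c ∈ w, h c = h' c) (j : ℕ) :
    desc h w j = desc h' w j := by
  induction w generalizing j with
  | nil => rfl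
  | cons c w ih => simp [desc, hh c (by simp), ih fun d hd => hh d (by simp [hd])]

section CKR

variable {X : Type u} [TopologicalSpace X] {T : X ≃ₜ X}

namespace CKRPartition

variable (Q : CKRPartition T) {x : X} {k k' i i' : ℕ}

theorem eq_of_mem (hk : k ∈ Finset.Icc 1 Q.C) (hk' : k' ∈ Finset.Icc 1 Q.C) (hi : i < Q.h k)
    (hi' : i' < Q.h k') (h : T^[i] x ∈ Q.B k) (h' : T^[i'] x ∈ Q.B k') : (k, i) = (k', i') := by
  by_contra hne
  exact Set.disjoint_left.1 (Q.disjoint k hk k' hk' i hi i' hi' hne) h h'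

theorem mem_roof : x ∈ Q.roof ↔ ∃ k ∈ Finset.Icc 1 Q.C, x ∈ Q.B k := by
  simp [roof]

theorem mem_roof_of_bottom (hk : k ∈ Finset.Icc 1 Q.C) (h : T^[i] (T x) ∈ Q.B k)
    (hi : i + 1 = Q.h k) : x ∈ Q.roof := by
  obtain ⟨k', hk', i', hi', hx⟩ := Q.cover x
  rcases i' with _ | i'
  · exact Q.mem_roof.2 ⟨k', hk', hx⟩
  · have hx' : T^[i'] (T x) ∈ Q.B k' := by simpa [Function.iterate_succ_apply] using hx
    have := Q.eq_of_mem hk hk' (by omega) (by omega) h hx'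
    simp only [Prod.mk.injEq] at this
    obtain ⟨rfl, rfl⟩ := this
    omega

theorem bottom_of_mem_roof (hk : k ∈ Finset.Icc 1 Q.C) (hi : i < Q.h k)
    (h : T^[i] (T x) ∈ Q.B k) (hx : x ∈ Q.roof) : i + 1 = Q.h k := by
  obtain ⟨k', hk', hx⟩ := Q.mem_roof.1 hx
  by_contra hc
  have := Q.eq_of_mem (x := x) (i := i + 1) (i' := 0) hk hk' (by omega) (Q.h_pos _ hk')
    (by simpa [Function.iterate_succ_apply] using h) (by simpa using hx)
  simp at this

/-- If `P` refines `Q` and its roof is smaller, then every tower of `P` is a stack of towers of `Q`,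
and the tower word describes this stack. -/
theorem tower_eq_stack (P : CKRPartition T) (href : ∀ a ∈ P.atoms, ∃ a' ∈ Q.atoms, a ⊆ a')
    (hroof : P.roof ⊆ Q.roof) {l : ℕ} (hl : l ∈ Finset.Icc 1 P.C) :
    hsum Q.h (P.towerWord Q l).reverse = P.h l ∧ ∀ j < P.h l,
      (desc Q.h (P.towerWord Q l).reverse j).1 ∈ Finset.Icc 1 Q.C ∧
      ∀ x, T^[j] x ∈ P.B l → T^[(desc Q.h (P.towerWord Q l).reverse j).2] x ∈
        Q.B (desc Q.h (P.towerWord Q l).reverse j).1 := by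
  have hex : ∀ j, ∃ a : ℕ × ℕ, j < P.h l → a.1 ∈ Finset.Icc 1 Q.C ∧ a.2 < Q.h a.1 ∧
      ∀ x, T^[j] x ∈ P.B l → T^[a.2] x ∈ Q.B a.1 := by
    intro j
    by_cases hj : j < P.h l
    · obtain ⟨_, ⟨k, hk, i, hi, rfl⟩, hs⟩ := href _ ⟨l, hl, j, hj, rfl⟩
      exact ⟨(k, i), fun _ => ⟨hk, hi, fun x hx => hs hx⟩⟩
    · exact ⟨(0, 0), fun h => absurd h hj⟩
  choose a ha using hex
  have hpt : ∀ j, ∃ x, T^[j] x ∈ P.B l := by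
    intro j
    obtain ⟨y, hy⟩ := P.nonempty l hl
    obtain ⟨x, rfl⟩ := (T.surjective.iterate j) y
    exact ⟨x, hy⟩
  have hN := P.h_pos l hl
  have hzero : ∀ x ∈ P.B l, x ∈ Q.roof := fun x hx => hroof (P.mem_roof.2 ⟨l, hl, hx⟩)
  have key := address_eq_desc (h := Q.h) (w := (P.towerWord Q l).reverse) hN a
    (fun j hj => (ha j hj).2.1) ?_ ?_ ?_ ?_ ?_
  · refine ⟨key.1, fun j hj => ?_⟩
    rw [← key.2 j hj]
    exact ⟨(ha j hj).1, (ha j hj).2.2⟩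
  · obtain ⟨x, hx⟩ := P.nonempty l hl
    obtain ⟨h1, h2, h3⟩ := ha 0 hN
    obtain ⟨k, hk, hxk⟩ := Q.mem_roof.1 (hzero x hx)
    have := Q.eq_of_mem (x := x) (i' := 0) h1 hk h2 (Q.h_pos k hk) (h3 x hx) hxk
    simp only [Prod.mk.injEq] at this
    exact this.2
  · intro j hj hlt
    obtain ⟨x, hx⟩ := hpt (j + 1)
    obtain ⟨h1, h2, h3⟩ := ha j (by omega)
    obtain ⟨g1, g2, g3⟩ := ha (j + 1) hj
    have e1 := h3 (T x) (by simpa [Function.iterate_succ_apply] using hx)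
    have e2 : T^[(a j).2 + 1] x ∈ Q.B (a j).1 := by simpa [Function.iterate_succ_apply] using e1
    have := Q.eq_of_mem g1 h1 g2 hlt (g3 x hx) e2
    exact this
  · intro j hj heq
    obtain ⟨x, hx⟩ := hpt (j + 1)
    obtain ⟨h1, h2, h3⟩ := ha j (by omega)
    obtain ⟨g1, g2, g3⟩ := ha (j + 1) hj
    have e1 := h3 (T x) (by simpa [Function.iterate_succ_apply] using hx)
    obtain ⟨k, hk, hxk⟩ := Q.mem_roof.1 (Q.mem_roof_of_bottom h1 e1 heq)
    have := Q.eq_of_mem (x := x) (i' := 0) g1 hk g2 (Q.h_pos k hk) (g3 x hx) hxk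
    simp only [Prod.mk.injEq] at this
    exact this.2
  · obtain ⟨x, hx⟩ := hpt (P.h l - 1 + 1)
    obtain ⟨h1, h2, h3⟩ := ha (P.h l - 1) (by omega)
    have e0 : T^[P.h l - 1] (T x) ∈ P.B l := by simpa [Function.iterate_succ_apply] using hx
    exact Q.bottom_of_mem_roof h1 h2 (h3 (T x) e0)
      (hroof (P.mem_roof_of_bottom hl e0 (by omega)))
  · rw [towerWord, ← List.filterMap_reverse, List.reverse_reverse]
    refine List.filterMap_congr fun j hj => ?_
    obtain ⟨h1, h2, h3⟩ := ha j (List.mem_range.1 hj)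
    obtain ⟨x, hx⟩ := hpt j
    split_ifs with hH h0 h0
    · have hs := hH.choose_spec
      have := Q.eq_of_mem (x := x) (i := 0) hs.1 h1 (Q.h_pos _ hs.1) h2 (hs.2 hx) (h3 x hx)
      simp only [Prod.mk.injEq] at this
      rw [this.1]
    · have hs := hH.choose_spec
      have := Q.eq_of_mem (x := x) (i := 0) hs.1 h1 (Q.h_pos _ hs.1) h2 (hs.2 hx) (h3 x hx)
      simp only [Prod.mk.injEq] at this
      exact absurd this.2.symm h0
    · exact absurd ⟨(a j).1, h1, fun y hy => by have := h3 y hy; rw [h0] at this; exact this⟩ hH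
    · rfl

end CKRPartition

/-- `P` is a sequence of partitions as in the definition of an explicit system. -/
structure IsExampleSequence (P : ℕ → CKRPartition T) : Prop where
  nested : IsNestedSequence P
  C_eq : ∀ n ≥ 1, (P n).C = 2
  h_one : ∀ l, l = 1 ∨ l = 2 → (P 1).h l = 1
  word : ∀ n ≥ 1, ∀ l, l = 1 ∨ l = 2 → ((P (n + 1)).towerWord (P n) l).reverse = topword n l

theorem IsExampleSystem.exists_sequence (h : IsExampleSystem T) :
    ∃ P : ℕ → CKRPartition T, IsExampleSequence P := by
  obtain ⟨-, P, hP, hC, h1, -, hw⟩ := h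
  refine ⟨P, hP, hC, fun l hl => ?_, fun n hn l hl => ?_⟩
  · have := h1 l (by rcases hl with rfl | rfl <;> simp)
    simpa [CKRPartition.incidence, hP.zero_B] using this
  · rw [hw n hn l (by rcases hl with rfl | rfl <;> simp), topword]

namespace IsExampleSequence

variable {P : ℕ → CKRPartition T} (hP : IsExampleSequence P) {n : ℕ}
include hP

theorem mem_Icc (hn : 1 ≤ n) {l : ℕ} : l ∈ Finset.Icc 1 (P n).C ↔ l = 1 ∨ l = 2 := by
  rw [hP.C_eq n hn, Finset.mem_Icc]; omega

theorem h_eq (hn : 1 ≤ n) {l : ℕ} (hl : l = 1 ∨ l = 2) : (P n).h l = H n l := by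
  induction n, hn using Nat.le_induction generalizing l with
  | base => rw [hP.h_one l hl, H_one]
  | succ n hn ih =>
    have := ((P n).tower_eq_stack (P (n + 1)) (hP.nested.refines n) (hP.nested.roof_anti n)
      ((hP.mem_Icc (by omega)).2 hl)).1
    rw [hP.word n hn l hl] at this
    rw [← this, H_succ hn]
    exact hsum_congr fun c hc => ih (mem_topword hl hc)

theorem mem_desc (hn : 1 ≤ n) {l : ℕ} (hl : l = 1 ∨ l = 2) {j : ℕ} (hj : j < H (n + 1) l) {x : X}
    (hx : T^[j] x ∈ (P (n + 1)).B l) :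
    T^[(desc (H n) (topword n l) j).2] x ∈ (P n).B (desc (H n) (topword n l) j).1 := by
  have h1 := ((P n).tower_eq_stack (P (n + 1)) (hP.nested.refines n) (hP.nested.roof_anti n)
      ((hP.mem_Icc (by omega)).2 hl)).2 j (by rwa [hP.h_eq (by omega) hl])
  rw [hP.word n hn l hl, desc_congr fun c hc => hP.h_eq hn (mem_topword hl hc)] at h1
  exact h1.2 x hx

end IsExampleSequence

/-- The address of `x` at level `n`: the tower of `P n` that contains `x`, and the depth of `x`
below the roof of this tower. -/
noncomputable def addr (P : ℕ → CKRPartition T) (n : ℕ) (x : X) : ℕ × ℕ :=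
  (((P n).cover x).choose, ((P n).cover x).choose_spec.2.choose)

namespace IsExampleSequence

variable {P : ℕ → CKRPartition T} (hP : IsExampleSequence P) {n : ℕ}
include hP

theorem addr_fst (hn : 1 ≤ n) (x : X) : (addr P n x).1 = 1 ∨ (addr P n x).1 = 2 :=
  (hP.mem_Icc hn).1 ((P n).cover x).choose_spec.1

theorem addr_lt (hn : 1 ≤ n) (x : X) : (addr P n x).2 < H n (addr P n x).1 := by
  rw [← hP.h_eq hn (hP.addr_fst hn x)]
  exact ((P n).cover x).choose_spec.2.choose_spec.1

omit hP in
theorem addr_mem (x : X) : T^[(addr P n x).2] x ∈ (P n).B (addr P n x).1 :=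
  ((P n).cover x).choose_spec.2.choose_spec.2

theorem addr_eq_iff (hn : 1 ≤ n) {k j : ℕ} (hk : k = 1 ∨ k = 2) (hj : j < H n k) (x : X) :
    addr P n x = (k, j) ↔ T^[j] x ∈ (P n).B k := by
  constructor
  · intro h
    have := addr_mem (P := P) (n := n) x
    rwa [h] at this
  · intro h
    have h1 := hP.addr_lt hn x
    rw [← hP.h_eq hn (hP.addr_fst hn x)] at h1
    rw [← hP.h_eq hn hk] at hj
    exact (P n).eq_of_mem ((hP.mem_Icc hn).2 (hP.addr_fst hn x)) ((hP.mem_Icc hn).2 hk) h1 hj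
      (addr_mem x) h

theorem addr_desc (hn : 1 ≤ n) (x : X) : addr P n x =
    desc (H n) (topword n (addr P (n + 1) x).1) (addr P (n + 1) x).2 := by
  have hl := hP.addr_fst (n := n + 1) (by omega) x
  have hj := hP.addr_lt (n := n + 1) (by omega) x
  have hj' := hj
  rw [H_succ hn] at hj'
  exact (hP.addr_eq_iff hn (mem_topword hl (desc_fst_mem hj')) (desc_snd_lt hj') x).2
    (hP.mem_desc hn hl hj (addr_mem x))

theorem isClopen_B (hn : 1 ≤ n) {k : ℕ} (hk : k = 1 ∨ k = 2) : IsClopen ((P n).B k) :=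
  (P n).clopen k ((hP.mem_Icc hn).2 hk)

/-- The map `x ↦ addr P n x` is locally constant. -/
theorem isOpen_addr (hn : 1 ≤ n) (s : Set (ℕ × ℕ)) : IsOpen (addr P n ⁻¹' s) := by
  rw [isOpen_iff_forall_mem_open]
  intro x hx
  have hk := hP.addr_fst hn x
  have hj := hP.addr_lt hn x
  refine ⟨T^[(addr P n x).2] ⁻¹' (P n).B (addr P n x).1, fun y hy => ?_,
    (hP.isClopen_B hn hk).isOpen.preimage (T.continuous.iterate _), addr_mem x⟩
  have : addr P n y = addr P n x := (hP.addr_eq_iff hn hk hj y).2 hy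
  rw [mem_preimage, this]
  exact hx

theorem mem_atoms_iff (hn : 1 ≤ n) (a : Set X) : a ∈ (P n).atoms ↔
    ∃ k j, (k = 1 ∨ k = 2) ∧ j < H n k ∧ a = addr P n ⁻¹' {(k, j)} := by
  constructor
  · rintro ⟨k, hk, j, hj, rfl⟩
    rw [hP.mem_Icc hn] at hk
    rw [hP.h_eq hn hk] at hj
    exact ⟨k, j, hk, hj, by ext x; simp [hP.addr_eq_iff hn hk hj]⟩
  · rintro ⟨k, j, hk, hj, rfl⟩
    exact ⟨k, (hP.mem_Icc hn).2 hk, j, by rwa [hP.h_eq hn hk],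
      by ext x; simp [hP.addr_eq_iff hn hk hj]⟩

theorem nonempty_B (hn : 1 ≤ n) {k : ℕ} (hk : k = 1 ∨ k = 2) : ((P n).B k).Nonempty :=
  (P n).nonempty k ((hP.mem_Icc hn).2 hk)

theorem isLinearlyRecurrent (hT : IsMinimalCantorSystem T) : IsLinearlyRecurrent T := by
  refine ⟨hT, P, hP.nested, 14, fun n l hl k hk => ?_⟩
  rw [hP.mem_Icc (by omega)] at hl
  rw [hP.h_eq (by omega) hl]
  rcases Nat.eq_zero_or_pos n with rfl | hn
  · rw [hP.nested.zero_C] at hk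
    have : k = 1 := by simpa using hk
    rw [this, hP.nested.zero_h, H_one]
    norm_num
  · rw [hP.mem_Icc hn] at hk
    rw [hP.h_eq hn hk]
    exact H_succ_le hn hl hk

theorem addr_mono {m : ℕ} (hm : 1 ≤ m) (hmn : m ≤ n) : ∃ g : ℕ × ℕ → ℕ × ℕ,
    ∀ x, addr P m x = g (addr P n x) := by
  induction n, hmn using Nat.le_induction with
  | base => exact ⟨id, fun x => rfl⟩
  | succ n hmn ih =>
    obtain ⟨g, hg⟩ := ih
    exact ⟨fun a => g (desc (H n) (topword n a.1) a.2), fun x => by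
      rw [hg, hP.addr_desc (by omega)]⟩

/-- The fibres of the address maps form a basis of the topology. -/
theorem isTopologicalBasis : TopologicalSpace.IsTopologicalBasis
    {s | ∃ n ≥ 1, ∃ x, s = addr P n ⁻¹' {addr P n x}} := by
  refine TopologicalSpace.isTopologicalBasis_of_isOpen_of_nhds ?_ ?_
  · rintro _ ⟨n, hn, x, rfl⟩
    exact hP.isOpen_addr hn _
  · intro x U hx hU
    have hb := TopologicalSpace.isTopologicalBasis_of_subbasis hP.nested.spans
    obtain ⟨_, ⟨f, ⟨hfin, hf⟩, rfl⟩, hxf, hfU⟩ := hb.exists_subset_of_mem_open hx hU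
    have hex : ∀ a ∈ f, ∃ n ≥ 1, ∀ m ≥ n, addr P m ⁻¹' {addr P m x} ⊆ a := by
      intro a ha
      obtain ⟨n, hn⟩ := mem_iUnion.1 (hf ha)
      have hxa : x ∈ a := hxf a ha
      rcases Nat.eq_zero_or_pos n with rfl | hn1
      · obtain ⟨k, hk, j, hj, rfl⟩ := hn
        rw [hP.nested.zero_C] at hk
        have : k = 1 := by simpa using hk
        subst this
        exact ⟨1, le_rfl, fun m _ y _ => by simp [hP.nested.zero_B]⟩
      · obtain ⟨k, j, hk, hj, rfl⟩ := (hP.mem_atoms_iff hn1 a).1 hn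
        refine ⟨n, hn1, fun m hm y hy => ?_⟩
        obtain ⟨g, hg⟩ := hP.addr_mono hn1 hm
        have hy' : addr P m y = addr P m x := hy
        have hx' : addr P n x = (k, j) := hxa
        change addr P n y = (k, j)
        rw [hg, hy', ← hg, hx']
    choose! N hN1 hN using hex
    obtain ⟨M, hM⟩ := (hfin.image N).bddAbove
    refine ⟨_, ⟨max M 1, le_max_right _ _, x, rfl⟩, rfl, subset_trans ?_ hfU⟩
    refine subset_sInter fun a ha => hN a ha _ (le_max_of_le_left (hM (mem_image_of_mem N ha)))

/-- The level sets of the address maps generate arbitrarily fine partitions: a continuous function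
on the compact space `X` oscillates little on all atoms of some level. -/
theorem exists_addr_dist_lt [CompactSpace X] {E : Type*} [PseudoMetricSpace E] {f : X → E}
    (hf : Continuous f) {ε : ℝ} (hε : 0 < ε) :
    ∃ n ≥ 1, ∀ m ≥ n, ∀ x y, addr P m x = addr P m y → dist (f x) (f y) < ε := by
  have hex : ∀ x : X, ∃ n ≥ 1, ∀ y, addr P n y = addr P n x → dist (f y) (f x) < ε / 2 := by
    intro x
    have hU : IsOpen {y | dist (f y) (f x) < ε / 2} := isOpen_lt (by fun_prop) (by fun_prop)
    obtain ⟨_, ⟨n, hn, z, rfl⟩, hx, hs⟩ := hP.isTopologicalBasis.exists_subset_of_mem_open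
      (show x ∈ {y | dist (f y) (f x) < ε / 2} by simp [hε]) hU
    have hx' : addr P n x = addr P n z := hx
    exact ⟨n, hn, fun y hy => hs (by simp [hy, hx'])⟩
  choose N hN1 hN using hex
  obtain ⟨t, ht⟩ := isCompact_univ.elim_finite_subcover
    (fun x => addr P (N x) ⁻¹' {addr P (N x) x}) (fun x => hP.isOpen_addr (hN1 x) _)
    (fun x _ => mem_iUnion.2 ⟨x, rfl⟩)
  refine ⟨max 1 (t.sup N), le_max_left _ _, fun m hm x y hxy => ?_⟩
  obtain ⟨z, hz, hxz⟩ := by simpa using ht (mem_univ x)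
  have hzm : N z ≤ m := (Finset.le_sup hz).trans ((le_max_right _ _).trans hm)
  obtain ⟨g, hg⟩ := hP.addr_mono (hN1 z) hzm
  have hyz : addr P (N z) y = addr P (N z) z := by rw [hg, ← hxy, ← hg, hxz]
  calc dist (f x) (f y) ≤ dist (f x) (f z) + dist (f y) (f z) := dist_triangle_right _ _ _
    _ < ε / 2 + ε / 2 := add_lt_add (hN z x hxz) (hN z y hyz)
    _ = ε := by ring

end IsExampleSequence

end CKR

/-! ### The invariant measure -/

open scoped BoundedContinuousFunction in
/-- Krylov-Bogoliubov: a limit point of the uniform measures on long orbit segments is invariant. -/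
theorem exists_invariant_measure {X : Type*} [TopologicalSpace X] [MeasurableSpace X] [BorelSpace X]
    [CompactSpace X] [TopologicalSpace.MetrizableSpace X] [Nonempty X] {T : X → X}
    (hT : Continuous T) : ∃ μ : Measure X, IsProbabilityMeasure μ ∧ MeasurePreserving T μ μ := by
  obtain ⟨x₀⟩ := ‹Nonempty X›
  let ν : ℕ → Measure X := fun N =>
    ((N + 1 : ℕ) : ENNReal)⁻¹ • ∑ i ∈ Finset.range (N + 1), Measure.dirac (T^[i] x₀)
  have hν : ∀ N, IsProbabilityMeasure (ν N) := fun N => ⟨by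
    simp only [ν, Measure.smul_apply, Measure.finsetSum_apply, measure_univ, Finset.sum_const,
      Finset.card_range, smul_eq_mul, nsmul_eq_mul, mul_one]
    exact ENNReal.inv_mul_cancel (by simp) (by simp)⟩
  have hint : ∀ N (g : X →ᵇ ℝ), ∫ x, g x ∂(ν N) =
      ((N + 1 : ℕ) : ℝ)⁻¹ * ∑ i ∈ Finset.range (N + 1), g (T^[i] x₀) := by
    intro N g
    rw [integral_smul_measure, integral_finsetSum_measure fun i _ => g.integrable _]
    simp [integral_dirac, ENNReal.toReal_add]
  let p : ℕ → ProbabilityMeasure X := fun N => ⟨ν N, hν N⟩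
  obtain ⟨μ, -, hμ⟩ := isCompact_univ.ultrafilter_le_nhds ((hyperfilter ℕ).map p) (by simp)
  have hlim : Tendsto p (hyperfilter ℕ : Filter ℕ) (𝓝 μ) := hμ
  rw [ProbabilityMeasure.tendsto_iff_forall_integral_tendsto] at hlim
  refine ⟨μ, inferInstance, hT.measurable, ?_⟩
  have := Measure.isProbabilityMeasure_map (μ := (μ : Measure X)) hT.measurable.aemeasurable
  refine ext_of_forall_integral_eq_of_IsFiniteMeasure fun g => ?_
  rw [integral_map hT.measurable.aemeasurable g.continuous.aestronglyMeasurable]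
  let g' : X →ᵇ ℝ := g.compContinuous ⟨T, hT⟩
  have h1 := hlim g
  have h2 := hlim g'
  refine tendsto_nhds_unique h2 ?_
  have h3 : Tendsto (fun N : ℕ => 2 * ‖g‖ / ((N + 1 : ℕ) : ℝ)) (hyperfilter ℕ : Filter ℕ) (𝓝 0) :=
    ((tendsto_const_div_atTop_nhds_zero_nat (2 * ‖g‖)).comp (tendsto_add_atTop_nat 1)).mono_left
      Nat.hyperfilter_le_atTop
  have h4 : Tendsto (fun N => ∫ x, g' x ∂(ν N) - ∫ x, g x ∂(ν N)) (hyperfilter ℕ : Filter ℕ)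
      (𝓝 0) := by
    refine squeeze_zero_norm (fun N => ?_) h3
    rw [hint, hint, ← mul_sub, ← Finset.sum_sub_distrib]
    have e : ∑ i ∈ Finset.range (N + 1), (g' (T^[i] x₀) - g (T^[i] x₀)) =
        g (T^[N + 1] x₀) - g x₀ := by
      have := Finset.sum_range_sub (fun i => g (T^[i] x₀)) (N + 1)
      simpa [g', Function.iterate_succ_apply'] using this
    rw [e, norm_mul, norm_inv, Real.norm_natCast, div_eq_inv_mul]
    gcongr
    calc ‖g (T^[N + 1] x₀) - g x₀‖ ≤ ‖g (T^[N + 1] x₀)‖ + ‖g x₀‖ := norm_sub_le _ _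
      _ ≤ ‖g‖ + ‖g‖ := add_le_add (g.norm_coe_le_norm _) (g.norm_coe_le_norm _)
      _ = 2 * ‖g‖ := by ring
  have h5 := h4.add h1
  rw [zero_add] at h5
  exact h5.congr fun N => sub_add_cancel _ _

/-- If only one probability measure is invariant, then it is ergodic. -/
theorem ergodic_of_unique {X : Type*} [MeasurableSpace X] {T : X → X} {μ : Measure X}
    [IsProbabilityMeasure μ] (hT : MeasurePreserving T μ μ)
    (huniq : ∀ ν : Measure X, IsProbabilityMeasure ν → MeasurePreserving T ν ν → ν = μ) :
    Ergodic T μ := by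
  refine Ergodic.of_mem_extremePoints ⟨⟨hT, inferInstance⟩, ?_⟩
  rintro ν₁ ⟨h1, h1'⟩ ν₂ ⟨h2, h2'⟩ -
  exact huniq _ h1' h1

/-- The weights `φ⁻¹, φ⁻²` of the two towers: up to a factor, the Perron eigenvector. -/
noncomputable def wt (k : ℕ) : ℝ := if k = 1 then φ - 1 else 2 - φ

section

variable {X : Type u} [TopologicalSpace X] {T : X ≃ₜ X}
  {P : ℕ → CKRPartition T} {n : ℕ} [MeasurableSpace X] [BorelSpace X] {μ : Measure X}

namespace IsExampleSequence

variable (hP : IsExampleSequence P)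
include hP

theorem measurable_addr (hn : 1 ≤ n) : Measurable (addr P n) :=
  fun _ _ => (hP.isOpen_addr hn _).measurableSet

/-- The total mass of a function of the address is a sum over all levels of all towers. -/
theorem integral_addr_aux [IsFiniteMeasure μ] (hT : MeasurePreserving T μ μ) (hn : 1 ≤ n)
    {E : Type*} [NormedAddCommGroup E] [NormedSpace ℝ E] [CompleteSpace E] (F : ℕ × ℕ → E) :
    Integrable (fun x => F (addr P n x)) μ ∧ ∫ x, F (addr P n x) ∂μ =
      μ.real ((P n).B 1) • (∑ j ∈ Finset.range (H n 1), F (1, j)) +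
      μ.real ((P n).B 2) • (∑ j ∈ Finset.range (H n 2), F (2, j)) := by
  let s : Finset (ℕ × ℕ) := (Finset.range (H n 1)).image (fun j => (1, j)) ∪
    (Finset.range (H n 2)).image (fun j => (2, j))
  have hmem : ∀ x, addr P n x ∈ s := by
    intro x
    have h1 := hP.addr_fst hn x
    have h2 := hP.addr_lt hn x
    generalize addr P n x = a at *
    obtain ⟨k, j⟩ := a
    rcases h1 with h1 | h1 <;> simp only at h1 <;> subst h1 <;> simp_all [s]
  have hdis : Disjoint ((Finset.range (H n 1)).image (fun j => (1, j)))
      ((Finset.range (H n 2)).image (fun j => (2, j))) := by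
    rw [Finset.disjoint_left]
    intro a ha hb
    simp only [Finset.mem_image] at ha hb
    obtain ⟨i, -, rfl⟩ := ha
    obtain ⟨j, -, h⟩ := hb
    simp at h
  have heq : (fun x => F (addr P n x)) = fun x => ∑ a ∈ s,
      (addr P n ⁻¹' {a}).indicator (fun _ => F a) x := by
    funext x
    rw [Finset.sum_eq_single (addr P n x)]
    · simp
    · intro b _ hb
      rw [Set.indicator_of_notMem]
      exact fun h => hb h.symm
    · exact fun h => absurd (hmem x) h
  have hmeas : ∀ a, MeasurableSet (addr P n ⁻¹' {a}) := fun a => (hP.isOpen_addr hn _).measurableSet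
  have hi : ∀ a ∈ s, Integrable ((addr P n ⁻¹' {a}).indicator (fun _ => F a)) μ :=
    fun a _ => (integrable_const _).indicator (hmeas a)
  have hB : ∀ k, k = 1 ∨ k = 2 → ∀ j ∈ Finset.range (H n k),
      μ.real (addr P n ⁻¹' {(k, j)}) = μ.real ((P n).B k) := by
    intro k hk j hj
    have : addr P n ⁻¹' {(k, j)} = T^[j] ⁻¹' (P n).B k := by
      ext x
      exact hP.addr_eq_iff hn hk (Finset.mem_range.1 hj) x
    rw [this, measureReal_def, measureReal_def, (hT.iterate j).measure_preimage
      (hP.isClopen_B hn hk).isOpen.measurableSet.nullMeasurableSet]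
  rw [heq]
  refine ⟨integrable_finsetSum _ hi, ?_⟩
  rw [integral_finsetSum _ hi, Finset.sum_union hdis, Finset.sum_image (by simp),
    Finset.sum_image (by simp), Finset.smul_sum, Finset.smul_sum]
  congr 1
  · refine Finset.sum_congr rfl fun j hj => ?_
    rw [integral_indicator_const _ (hmeas _), hB 1 (by simp) j hj]
  · refine Finset.sum_congr rfl fun j hj => ?_
    rw [integral_indicator_const _ (hmeas _), hB 2 (by simp) j hj]

/-- Counting the occurrences of tower `k` of level `n` in the towers of level `n + 1`: the measures of
the roofs are transported by the matrix `M(n + 1)`. -/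
theorem measure_B_step [IsFiniteMeasure μ] (hT : MeasurePreserving T μ μ) (hn : 1 ≤ n) {k : ℕ}
    (hk : k = 1 ∨ k = 2) : μ.real ((P n).B k) =
      μ.real ((P (n + 1)).B 1) * (topword n 1).count k +
      μ.real ((P (n + 1)).B 2) * (topword n 2).count k := by
  have h1 := (hP.integral_addr_aux hT hn (fun a => if a = (k, 0) then (1 : ℝ) else 0)).2
  have h2 := (hP.integral_addr_aux hT (n := n + 1) (by omega)
    (fun a => if desc (H n) (topword n a.1) a.2 = (k, 0) then (1 : ℝ) else 0)).2
  simp only [← hP.addr_desc hn] at h2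
  rw [h1] at h2
  simp only [H_succ hn, Finset.sum_boole, smul_eq_mul] at h2
  rw [card_filter_desc fun c hc => H_pos hn (mem_topword (by simp) hc),
    card_filter_desc fun c hc => H_pos hn (mem_topword (by simp) hc)] at h2
  rw [← h2]
  have h0 := H_pos hn hk
  have hsub : (Finset.range (H n k)).filter (fun i => i = 0) = {0} := by
    ext i; simp only [Finset.mem_filter, Finset.mem_range, Finset.mem_singleton]; omega
  rcases hk with rfl | rfl <;> simp [hsub]

/-- The measures of the towers are determined by invariance: the component of the vector of
measures in the direction of the small eigenvector has to vanish at level `1`, because it is `v n`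
times the component at level `n`, which is bounded. -/
theorem measure_B [IsProbabilityMeasure μ] (hT : MeasurePreserving T μ μ) (hn : 1 ≤ n) {k : ℕ}
    (hk : k = 1 ∨ k = 2) : μ.real ((P n).B k) = wt k / Lam n := by
  have hφ := phi_sq
  have hg := phi_gt
  have hl := phi_lt
  -- The components of the vector of measures along the two common eigenvectors `(φ, 1)` and `(1, -φ)`.
  have hstep : ∀ n ≥ 1,
      (φ * μ.real ((P 1).B 1) + μ.real ((P 1).B 2) =
        Lam n * (φ * μ.real ((P n).B 1) + μ.real ((P n).B 2))) ∧
      (μ.real ((P 1).B 1) - φ * μ.real ((P 1).B 2) =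
        v n * (μ.real ((P n).B 1) - φ * μ.real ((P n).B 2))) := by
    intro n hn
    induction n, hn using Nat.le_induction with
    | base => simp [Lam_one, v_one]
    | succ n hn ih =>
      have e1 := hP.measure_B_step (μ := μ) hT hn (k := 1) (by simp)
      have e2 := hP.measure_B_step (μ := μ) hT hn (k := 2) (by simp)
      rw [ih.1, ih.2, e1, e2]
      by_cases h : IsA n
      · rw [topword_one_A h, topword_two_A h, Lam_succ_A hn h, v_succ_A hn h]
        simp only [List.count_cons, List.count_nil]
        norm_num
        constructor
        · linear_combination (-2 * Lam n * μ.real ((P (n + 1)).B 1)) * hφ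
        · linear_combination (-2 * v n * μ.real ((P (n + 1)).B 2)) * hφ
      · rw [topword_one_B h, topword_two_B h, Lam_succ_B hn h, v_succ_B hn h]
        simp only [List.count_cons, List.count_nil]
        norm_num
        constructor
        · linear_combination (-1 * Lam n * μ.real ((P (n + 1)).B 1)) * hφ
        · linear_combination (-1 * v n * μ.real ((P (n + 1)).B 2)) * hφ
  have htot : μ.real ((P 1).B 1) + μ.real ((P 1).B 2) = 1 := by
    have := (hP.integral_addr_aux (μ := μ) hT (n := 1) le_rfl (fun _ => (1 : ℝ))).2
    simp [H_one] at this
    linarith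
  have hzero : μ.real ((P 1).B 1) - φ * μ.real ((P 1).B 2) = 0 := by
    have hb : ∀ n ≥ 1, |μ.real ((P 1).B 1) - φ * μ.real ((P 1).B 2)| ≤ v n * 3 := by
      intro n hn
      rw [(hstep n hn).2, abs_mul, abs_of_pos (v_pos hn)]
      refine mul_le_mul_of_nonneg_left ?_ (v_pos hn).le
      have p1 : μ.real ((P n).B 1) ≤ 1 := measureReal_le_one
      have p2 : μ.real ((P n).B 2) ≤ 1 := measureReal_le_one
      have q1 : 0 ≤ μ.real ((P n).B 1) := measureReal_nonneg
      have q2 : 0 ≤ μ.real ((P n).B 2) := measureReal_nonneg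
      rw [abs_le]
      constructor <;> nlinarith
    have hlim : Tendsto (fun n => v n * 3) atTop (𝓝 0) := by
      simpa using tendsto_v.mul_const 3
    have := ge_of_tendsto hlim (eventually_atTop.2 ⟨1, hb⟩)
    exact abs_eq_zero.1 (le_antisymm this (abs_nonneg _))
  have h2 : μ.real ((P 1).B 2) = 2 - φ := by
    linear_combination (2 - φ) * htot - (2 - φ) * hzero + μ.real ((P 1).B 2) * hφ
  have h1 : μ.real ((P 1).B 1) = φ - 1 := by linarith
  have hn1 := (hstep n hn).1
  have hn2 := (hstep n hn).2
  rw [h1, h2] at hn1 hn2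
  have hv := v_pos hn
  have hz : μ.real ((P n).B 1) - φ * μ.real ((P n).B 2) = 0 := by
    have : v n * (μ.real ((P n).B 1) - φ * μ.real ((P n).B 2)) = 0 := by
      rw [← hn2]; linear_combination hφ
    exact (mul_eq_zero.1 this).resolve_left hv.ne'
  have hL := Lam_pos hn
  rw [eq_div_iff hL.ne']
  have e2 : μ.real ((P n).B 2) * Lam n * (φ + 2) = (2 - φ) * (φ + 2) := by
    linear_combination (-1) * hn1 - Lam n * φ * hz + (2 - Lam n * μ.real ((P n).B 2)) * hφ
  have e3 : μ.real ((P n).B 2) * Lam n = 2 - φ := mul_right_cancel₀ (by linarith) e2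
  rcases hk with rfl | rfl
  · simp only [wt, if_true]
    linear_combination Lam n * hz + φ * e3 - hφ
  · simpa [wt] using e3

theorem integral_addr [IsProbabilityMeasure μ] (hT : MeasurePreserving T μ μ) (hn : 1 ≤ n)
    {E : Type*} [NormedAddCommGroup E] [NormedSpace ℝ E] [CompleteSpace E] (F : ℕ × ℕ → E) :
    Integrable (fun x => F (addr P n x)) μ ∧ ∫ x, F (addr P n x) ∂μ =
      (wt 1 / Lam n) • (∑ j ∈ Finset.range (H n 1), F (1, j)) +
      (wt 2 / Lam n) • (∑ j ∈ Finset.range (H n 2), F (2, j)) := by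
  have := hP.integral_addr_aux hT hn F
  rwa [hP.measure_B hT hn (by simp), hP.measure_B hT hn (by simp)] at this

theorem measure_addr [IsProbabilityMeasure μ] (hT : MeasurePreserving T μ μ) (hn : 1 ≤ n)
    {k j : ℕ} (hk : k = 1 ∨ k = 2) (hj : j < H n k) :
    μ.real (addr P n ⁻¹' {(k, j)}) = wt k / Lam n := by
  have : addr P n ⁻¹' {(k, j)} = T^[j] ⁻¹' (P n).B k := by
    ext x
    exact hP.addr_eq_iff hn hk hj x
  rw [this, ← hP.measure_B hT hn hk, measureReal_def, measureReal_def,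
    (hT.iterate j).measure_preimage (hP.isClopen_B hn hk).isOpen.measurableSet.nullMeasurableSet]

theorem borel_eq_generateFrom : ‹MeasurableSpace X› = MeasurableSpace.generateFrom
    {s | ∃ n ≥ 1, ∃ x, s = addr P n ⁻¹' {addr P n x}} := by
  have hb := hP.isTopologicalBasis
  have hc : {s | ∃ n ≥ 1, ∃ x, s = addr P n ⁻¹' {addr P n x}}.Countable := by
    refine ((countable_univ (α := ℕ × ℕ × ℕ)).image
      (fun p => addr P p.1 ⁻¹' {p.2})).mono ?_
    rintro _ ⟨n, hn, x, rfl⟩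
    exact ⟨(n, addr P n x), mem_univ _, rfl⟩
  have : SecondCountableTopology X := hb.secondCountableTopology hc
  rw [BorelSpace.measurable_eq (α := X), hb.borel_eq_generateFrom]

/-- The atoms of the partitions form a π-system that generates the Borel sets, and invariance determines
their measures. -/
theorem unique_invariant {ν : Measure X} [IsProbabilityMeasure μ] [IsProbabilityMeasure ν]
    (hT : MeasurePreserving T μ μ) (hT' : MeasurePreserving T ν ν) : ν = μ := by
  refine ext_of_generate_finite _ hP.borel_eq_generateFrom ?_ ?_ (by simp)
  · rintro _ ⟨n, hn, x, rfl⟩ _ ⟨m, hm, y, rfl⟩ ⟨z, hz1, hz2⟩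
    have hz1 : addr P n z = addr P n x := hz1
    have hz2 : addr P m z = addr P m y := hz2
    rw [← hz1, ← hz2]
    rcases le_total n m with h | h
    · obtain ⟨f, hf⟩ := hP.addr_mono hn h
      refine ⟨m, hm, z, inter_eq_right.2 fun y (hy : addr P m y = addr P m z) => ?_⟩
      change addr P n y = addr P n z
      rw [hf, hy, ← hf]
    · obtain ⟨f, hf⟩ := hP.addr_mono hm h
      refine ⟨n, hn, z, inter_eq_left.2 fun y (hy : addr P n y = addr P n z) => ?_⟩
      change addr P m y = addr P m z
      rw [hf, hy, ← hf]
  · rintro _ ⟨n, hn, x, rfl⟩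
    have h1 := hP.measure_addr hT hn (hP.addr_fst hn x) (hP.addr_lt hn x)
    have h2 := hP.measure_addr hT' hn (hP.addr_fst hn x) (hP.addr_lt hn x)
    rw [← h2, measureReal_def, measureReal_def,
      ENNReal.toReal_eq_toReal_iff' (measure_ne_top _ _) (measure_ne_top _ _)] at h1
    exact h1.symm

end IsExampleSequence

end

/-! ### The martingale of transverse heights -/

/-- The coordinates of the common small eigenvector `(1, -φ)` of `A` and `B`. -/
noncomputable def ell (c : ℕ) : ℝ := if c = 1 then 1 else -φ

/-- The transverse height of a stack of towers of one level, up to the factor `v n` of the level: each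
letter moves by its coordinate in the contracting direction. -/
noncomputable def lsum (w : List ℕ) : ℝ := (w.map ell).sum

@[simp] theorem lsum_nil : lsum [] = 0 := rfl

@[simp] theorem lsum_cons (c : ℕ) (w : List ℕ) : lsum (c :: w) = ell c + lsum w := by simp [lsum]

@[simp] theorem lsum_append (w w' : List ℕ) : lsum (w ++ w') = lsum w + lsum w' := by simp [lsum]

@[simp] theorem ell_one : ell 1 = 1 := by simp [ell]

@[simp] theorem ell_two : ell 2 = -φ := by simp [ell]

theorem abs_ell_le (c : ℕ) : |ell c| ≤ 2 := by
  have := phi_lt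
  have := phi_gt
  unfold ell
  split_ifs
  · norm_num
  · rw [abs_neg, abs_of_pos] <;> linarith

theorem abs_lsum_le (w : List ℕ) : |lsum w| ≤ 2 * w.length := by
  induction w with
  | nil => simp
  | cons c w ih =>
    rw [lsum_cons, List.length_cons]
    push_cast
    calc |ell c + lsum w| ≤ |ell c| + |lsum w| := abs_add_le _ _
      _ ≤ 2 + 2 * w.length := add_le_add (abs_ell_le c) ih
      _ = _ := by ring

/-- The transverse height of a whole tower of level `n + 1`. -/
theorem lsum_topword {n : ℕ} (hn : 1 ≤ n) {l : ℕ} (hl : l = 1 ∨ l = 2) :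
    v n * lsum (topword n l) = v (n + 1) * ell l := by
  have h := phi_sq
  by_cases hA : IsA n
  · rw [v_succ_A hn hA]
    rcases hl with rfl | rfl
    · simp [topword_one_A hA]; ring
    · simp [topword_two_A hA]; linear_combination (-2 * v n) * h
  · rw [v_succ_B hn hA]
    rcases hl with rfl | rfl
    · simp [topword_one_B hA]; ring
    · simp [topword_two_B hA]; linear_combination (-1 * v n) * h

theorem length_upper_le (h : ℕ → ℕ) (w : List ℕ) (j : ℕ) : (upper h w j).length ≤ w.length := by
  induction w generalizing j with
  | nil => simp [upper]
  | cons c w ih =>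
    unfold upper
    split_ifs
    · simp
    · simpa using ih (j - h c)

theorem length_topword_le (n l : ℕ) : (topword n l).length ≤ 7 := by
  unfold topword nextWord wordA wordB
  split_ifs <;> simp

/-- The word of the towers of level `n` above the point with address `a` of level `n + 1`. -/
noncomputable def above (n : ℕ) (a : ℕ × ℕ) : List ℕ := upper (H n) (topword n a.1) a.2

/-- The address of level `n` of a point with address `a` of level `n + 1`. -/
noncomputable def down (n : ℕ) (a : ℕ × ℕ) : ℕ × ℕ := desc (H n) (topword n a.1) a.2

/-- The transverse height of the part of the tower of level `n` above the address `a`, measured with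
respect to the towers of level `1` and the small eigenvector. The value at level `0` is a placeholder. -/
noncomputable def theta : ℕ → ℕ × ℕ → ℝ
  | 0, _ => 0
  | 1, _ => 0
  | n + 2, a => theta (n + 1) (down (n + 1) a) + v (n + 1) * lsum (above (n + 1) a)

theorem theta_succ {n : ℕ} (hn : 1 ≤ n) (a : ℕ × ℕ) :
    theta (n + 1) a = theta n (down n a) + v n * lsum (above n a) := by
  obtain ⟨k, rfl⟩ : ∃ k, n = k + 1 := ⟨n - 1, by omega⟩
  rfl

open Classical in
/-- The mean increments of the transverse height: with the correction term of `mart`, the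
conditional mean of the increment at level `n` does not depend on the tower. The constants `(102 + φ) / 55`
and `(2 + φ) / 5` are the stationary means of `lsum (above n a)` for the words of `A` and `B`. -/
noncomputable def drift (n : ℕ) : ℝ := (if IsA n then (102 + φ) / 55 else (2 + φ) / 5) * v n

/-- The correction `ψ`, a function of the tower only, is the eigenvector of the transition
probabilities between towers of consecutive levels. -/
noncomputable def psi (k : ℕ) : ℝ := if k = 1 then φ - 1 else -φ

/-- The martingale: the transverse height, recentred, plus a multiple of `v n * psi` which solves
the Poisson equation for both matrices at the same time; this fixes the coefficient `(3φ + 1) / 10`. -/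
noncomputable def mart (n : ℕ) (a : ℕ × ℕ) : ℝ :=
  theta n a - ∑ m ∈ Finset.Ico 1 n, drift m - (3 * φ + 1) / 10 * (v n * psi a.1)

/-- The martingale differences. -/
noncomputable def mdiff (n : ℕ) (a : ℕ × ℕ) : ℝ := mart (n + 1) a - mart n (down n a)

theorem mdiff_eq {n : ℕ} (hn : 1 ≤ n) (a : ℕ × ℕ) : mdiff n a = v n * lsum (above n a) - drift n
    - (3 * φ + 1) / 10 * (v (n + 1) * psi a.1 - v n * psi (down n a).1) := by
  rw [mdiff, mart, mart, theta_succ hn, Finset.sum_Ico_succ_top hn]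
  ring

theorem abs_psi_le (c : ℕ) : |psi c| ≤ 2 := by
  have := phi_lt
  have := phi_gt
  unfold psi
  split_ifs
  · rw [abs_of_pos] <;> linarith
  · rw [abs_neg, abs_of_pos] <;> linarith

theorem v_succ_le {n : ℕ} (hn : 1 ≤ n) : v (n + 1) ≤ 2 * v n := by
  have := phi_lt
  have := phi_gt
  have := v_pos hn
  by_cases hA : IsA n
  · rw [v_succ_A hn hA]; nlinarith
  · rw [v_succ_B hn hA]; nlinarith

theorem abs_drift_le {n : ℕ} (hn : 1 ≤ n) : |drift n| ≤ 2 * v n := by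
  have := phi_lt
  have := phi_gt
  rw [drift, abs_mul, abs_of_pos (v_pos hn)]
  refine mul_le_mul_of_nonneg_right ?_ (v_pos hn).le
  split_ifs <;> rw [abs_of_pos] <;> linarith

theorem abs_mdiff_le {n : ℕ} (hn : 1 ≤ n) (a : ℕ × ℕ) : |mdiff n a| ≤ 24 * v n := by
  have h1 := phi_lt
  have h2 := phi_gt
  have hv := v_pos hn
  have hv' := v_pos (n := n + 1) (by omega)
  have hvs := v_succ_le hn
  rw [mdiff_eq hn]
  have e1 : |v n * lsum (above n a)| ≤ 14 * v n := by
    rw [abs_mul, abs_of_pos hv, mul_comm]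
    refine mul_le_mul_of_nonneg_right ((abs_lsum_le _).trans ?_) hv.le
    have : ((above n a).length : ℝ) ≤ 7 := by
      exact_mod_cast (length_upper_le _ _ _).trans (length_topword_le _ _)
    linarith
  have e2 := abs_drift_le hn
  have e3 : |v (n + 1) * psi a.1 - v n * psi (down n a).1| ≤ 6 * v n := by
    calc _ ≤ |v (n + 1) * psi a.1| + |v n * psi (down n a).1| := abs_sub _ _
      _ ≤ v (n + 1) * 2 + v n * 2 := by
        rw [abs_mul, abs_mul, abs_of_pos hv, abs_of_pos hv']
        have := abs_psi_le a.1
        have := abs_psi_le (down n a).1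
        gcongr
      _ ≤ _ := by linarith
  have e4 : |(3 * φ + 1) / 10 * (v (n + 1) * psi a.1 - v n * psi (down n a).1)| ≤ 1 * (6 * v n) := by
    rw [abs_mul, abs_of_pos (by linarith : 0 < (3 * φ + 1) / 10)]
    exact mul_le_mul (by linarith) e3 (abs_nonneg _) (by norm_num)
  rw [abs_le] at *
  constructor <;> linarith [e1.1, e1.2, e2.1, e2.2, e4.1, e4.2]

/-- The sum over the towers of a stack of a mass `G c`, for a tower with letter `c`, times a factor
`K c w` that depends also on the word `w` of the towers above. -/
noncomputable def cellSum (G : ℕ → ℝ) : (ℕ → List ℕ → ℝ) → List ℕ → ℝ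
  | _, [] => 0
  | K, c :: w => G c * K c [] + cellSum G (fun b u => K b (c :: u)) w

theorem sum_eq_cellSum (h : ℕ → ℕ) (g : ℕ × ℕ → ℝ) (K : ℕ → List ℕ → ℝ) (w : List ℕ) :
    ∑ j ∈ Finset.range (hsum h w), g (desc h w j) * K (desc h w j).1 (upper h w j) =
      cellSum (fun c => ∑ i ∈ Finset.range (h c), g (c, i)) K w := by
  induction w generalizing K with
  | nil => simp [cellSum]
  | cons c w ih =>
    rw [sum_range_hsum_cons (fun b u => g b * K b.1 u), cellSum, ← ih, Finset.sum_mul]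

/-- The martingale differences are orthogonal to all functions of the coarser address. This finite
computation with the words of `A` and `B` is the place where their precise form matters. -/
theorem sum_mdiff {n : ℕ} (hn : 1 ≤ n) (g : ℕ × ℕ → ℝ) :
    wt 1 * (∑ j ∈ Finset.range (H (n + 1) 1), g (down n (1, j)) * mdiff n (1, j)) +
    wt 2 * (∑ j ∈ Finset.range (H (n + 1) 2), g (down n (2, j)) * mdiff n (2, j)) = 0 := by
  have hφ := phi_sq
  set G1 := ∑ i ∈ Finset.range (H n 1), g (1, i) with hG1
  set G2 := ∑ i ∈ Finset.range (H n 2), g (2, i) with hG2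
  have key : ∀ l, ∑ j ∈ Finset.range (H (n + 1) l), g (down n (l, j)) * mdiff n (l, j) =
      cellSum (fun c => ∑ i ∈ Finset.range (H n c), g (c, i)) (fun c w => v n * lsum w - drift n
          - (3 * φ + 1) / 10 * (v (n + 1) * psi l - v n * psi c)) (topword n l) := by
    intro l
    rw [← sum_eq_cellSum, H_succ hn]
    exact Finset.sum_congr rfl fun j _ => by rw [mdiff_eq hn]; rfl
  rw [key, key]
  by_cases hA : IsA n
  · rw [topword_one_A hA, topword_two_A hA]
    simp only [cellSum, ← hG1, ← hG2]
    rw [v_succ_A hn hA, drift, if_pos hA]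
    simp only [lsum_cons, lsum_nil, ell_one, ell_two, wt, psi, if_true]
    norm_num only [if_false]
    linear_combination (v n * G1 * (94 / 11 - 62 / 5 * φ + 21 / 5 * φ ^ 2)
      + v n * G2 * (353 / 55 - 46 / 5 * φ + 3 * φ ^ 2)) * hφ
  · rw [topword_one_B hA, topword_two_B hA]
    simp only [cellSum, ← hG1, ← hG2]
    rw [v_succ_B hn hA, drift, if_neg hA]
    simp only [lsum_cons, lsum_nil, ell_one, wt, psi, if_true]
    norm_num only [if_false]
    linear_combination (v n * G1 * (7 / 5 - 21 / 10 * φ + 9 / 10 * φ ^ 2)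
      + v n * G2 * (3 / 5 - 8 / 5 * φ + 3 / 5 * φ ^ 2)) * hφ

section

variable {X : Type u} [TopologicalSpace X] {T : X ≃ₜ X}
  {P : ℕ → CKRPartition T} {n : ℕ} [MeasurableSpace X] [BorelSpace X] {μ : Measure X}

namespace IsExampleSequence

variable (hP : IsExampleSequence P)
include hP

omit [BorelSpace X] [MeasurableSpace X] in
theorem addr_down (hn : 1 ≤ n) (x : X) : addr P n x = down n (addr P (n + 1) x) :=
  hP.addr_desc hn x

theorem integral_mul_mdiff [IsProbabilityMeasure μ] (hT : MeasurePreserving T μ μ) (hn : 1 ≤ n)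
    (g : ℕ × ℕ → ℝ) : ∫ x, g (addr P n x) * mdiff n (addr P (n + 1) x) ∂μ = 0 := by
  have h := (hP.integral_addr hT (n := n + 1) (by omega) (fun a => g (down n a) * mdiff n a)).2
  simp only [← hP.addr_down hn] at h
  have h2 := sum_mdiff hn g
  rw [h]
  simp only [smul_eq_mul, div_mul_eq_mul_div]
  rw [← add_div, h2, zero_div]

/-- The σ-algebras of the partitions `P (n + 1)`. -/
noncomputable def filtration (hP : IsExampleSequence P) : Filtration ℕ ‹MeasurableSpace X› where
  seq n := MeasurableSpace.comap (addr P (n + 1)) ⊤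
  mono' i j hij := by
    obtain ⟨g, hg⟩ := hP.addr_mono (m := i + 1) (n := j + 1) (by omega) (by omega)
    rintro _ ⟨s, -, rfl⟩
    refine ⟨g ⁻¹' s, trivial, ?_⟩
    ext x
    simp [hg]
  le' i := by
    rintro _ ⟨s, -, rfl⟩
    exact (hP.isOpen_addr (by omega) s).measurableSet

theorem integrable_addr [IsProbabilityMeasure μ] (hT : MeasurePreserving T μ μ) (hn : 1 ≤ n)
    {E : Type*} [NormedAddCommGroup E] [NormedSpace ℝ E] [CompleteSpace E] (F : ℕ × ℕ → E) :
    Integrable (fun x => F (addr P n x)) μ := (hP.integral_addr hT hn F).1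

omit [BorelSpace X] [MeasurableSpace X] in
theorem mart_succ (hn : 1 ≤ n) (x : X) : mart (n + 1) (addr P (n + 1) x) =
    mart n (addr P n x) + mdiff n (addr P (n + 1) x) := by
  rw [mdiff, ← hP.addr_down hn]; ring

theorem martingale_mart [IsProbabilityMeasure μ] (hT : MeasurePreserving T μ μ) :
    Martingale (fun n x => mart (n + 1) (addr P (n + 1) x)) hP.filtration μ := by
  refine martingale_of_setIntegral_eq_succ (fun n => ?_) (fun n => ?_) fun n s hs => ?_
  · have : Measurable[hP.filtration n] (addr P (n + 1)) :=
      fun s _ => ⟨s, trivial, rfl⟩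
    exact ((measurable_of_countable (mart (n + 1))).comp this).stronglyMeasurable
  · exact hP.integrable_addr hT (by omega) (mart (n + 1))
  · obtain ⟨A, -, rfl⟩ := hs
    have hmeas := (hP.isOpen_addr (n := n + 1) (by omega) A).measurableSet
    simp only [fun x => hP.mart_succ (n := n + 1) (by omega) x]
    have h1 := hP.integrable_addr hT (n := n + 1) (by omega) (mart (n + 1))
    have h2 := hP.integrable_addr hT (n := n + 2) (by omega) (mdiff (n + 1))
    rw [integral_add h1.integrableOn h2.integrableOn, left_eq_add, ← integral_indicator hmeas]
    -- Orthogonality to the indicator functions of the coarser addresses is the martingale property.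
    have h3 := hP.integral_mul_mdiff hT (n := n + 1) (by omega) (A.indicator 1)
    rw [← h3]
    congr 1
    funext x
    by_cases hx : addr P (n + 1) x ∈ A <;> simp [Set.indicator, hx]

/-- The martingale is bounded in `L²` because its increments are orthogonal and bounded by multiples of
`v n`, and `v` is square summable. -/
theorem integral_mart_sq_le [IsProbabilityMeasure μ] (hT : MeasurePreserving T μ μ) : ∃ R : ℝ,
    ∀ n, ∫ x, mart (n + 1) (addr P (n + 1) x) ^ 2 ∂μ ≤ R := by
  have hstep : ∀ n, ∫ x, mart (n + 2) (addr P (n + 2) x) ^ 2 ∂μ ≤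
      ∫ x, mart (n + 1) (addr P (n + 1) x) ^ 2 ∂μ + 576 * v (n + 1) ^ 2 := by
    intro n
    have h1 := hP.integrable_addr hT (n := n + 1) (by omega) (fun a => mart (n + 1) a ^ 2)
    have h2 := hP.integrable_addr hT (n := n + 2) (by omega)
      (fun a => 2 * mart (n + 1) (down (n + 1) a) * mdiff (n + 1) a)
    simp only [← hP.addr_down (n := n + 1) (by omega)] at h2
    have h3 := hP.integrable_addr hT (n := n + 2) (by omega) (fun a => mdiff (n + 1) a ^ 2)
    have h4 := hP.integral_mul_mdiff hT (n := n + 1) (by omega) (fun a => 2 * mart (n + 1) a)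
    have e : ∀ x, mart (n + 2) (addr P (n + 2) x) ^ 2 = mart (n + 1) (addr P (n + 1) x) ^ 2 +
        2 * mart (n + 1) (addr P (n + 1) x) * mdiff (n + 1) (addr P (n + 2) x) +
        mdiff (n + 1) (addr P (n + 2) x) ^ 2 := by
      intro x
      rw [hP.mart_succ (n := n + 1) (by omega)]; ring
    simp only [e]
    have h12 : Integrable (fun x => mart (n + 1) (addr P (n + 1) x) ^ 2 +
        2 * mart (n + 1) (addr P (n + 1) x) * mdiff (n + 1) (addr P (n + 2) x)) μ := h1.add h2
    rw [integral_add h12 h3, integral_add h1 h2, h4, add_zero]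
    gcongr
    calc ∫ x, mdiff (n + 1) (addr P (n + 2) x) ^ 2 ∂μ ≤ ∫ x, 576 * v (n + 1) ^ 2 ∂μ := by
          refine integral_mono h3 (integrable_const _) fun x => ?_
          have := abs_mdiff_le (n := n + 1) (by omega) (addr P (n + 2) x)
          calc mdiff (n + 1) (addr P (n + 2) x) ^ 2 = |mdiff (n + 1) (addr P (n + 2) x)| ^ 2 :=
                (sq_abs _).symm
            _ ≤ (24 * v (n + 1)) ^ 2 := by gcongr
            _ = _ := by ring
      _ = _ := by simp
  refine ⟨∫ x, mart 1 (addr P 1 x) ^ 2 ∂μ + 576 * ∑' n, v (n + 1) ^ 2, fun n => ?_⟩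
  have : ∀ n, ∫ x, mart (n + 1) (addr P (n + 1) x) ^ 2 ∂μ ≤
      ∫ x, mart 1 (addr P 1 x) ^ 2 ∂μ + 576 * ∑ i ∈ Finset.range n, v (i + 1) ^ 2 := by
    intro n
    induction n with
    | zero => simp
    | succ n ih =>
      rw [Finset.sum_range_succ]
      linarith [hstep n]
  refine (this n).trans ?_
  gcongr
  exact summable_v_sq.sum_le_tsum _ fun i _ => sq_nonneg _

/-- The recentred transverse heights converge almost everywhere, by the martingale convergence theorem;
the correction term tends to `0` with `v n`. -/
theorem ae_tendsto_theta [IsProbabilityMeasure μ] (hT : MeasurePreserving T μ μ) : ∀ᵐ x ∂μ, ∃ c,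
    Tendsto (fun n => theta n (addr P n x) - ∑ m ∈ Finset.Ico 1 n, drift m) atTop (𝓝 c) := by
  obtain ⟨R, hR⟩ := hP.integral_mart_sq_le hT
  have hbdd : ∀ n, eLpNorm (fun x => mart (n + 1) (addr P (n + 1) x)) 1 μ ≤ (1 + R).toNNReal := by
    intro n
    rw [eLpNorm_one_eq_lintegral_enorm, ← ofReal_integral_norm_eq_lintegral_enorm
      (hP.integrable_addr hT (by omega) (mart (n + 1)))]
    refine ENNReal.ofReal_le_ofReal ?_
    have h2 := hP.integrable_addr hT (n := n + 1) (by omega) (fun a => mart (n + 1) a ^ 2)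
    calc ∫ x, ‖mart (n + 1) (addr P (n + 1) x)‖ ∂μ
        ≤ ∫ x, (1 + mart (n + 1) (addr P (n + 1) x) ^ 2) ∂μ := by
          refine integral_mono (hP.integrable_addr hT (by omega) (mart (n + 1))).norm
            ((integrable_const 1).add h2) fun x => ?_
          simp only [Real.norm_eq_abs]
          rw [← sq_abs]
          nlinarith [sq_nonneg (|mart (n + 1) (addr P (n + 1) x)| - 1)]
      _ ≤ 1 + R := by
          rw [integral_add (integrable_const 1) h2]
          simpa using hR n
  filter_upwards [(hP.martingale_mart hT).submartingale.exists_ae_tendsto_of_bdd hbdd]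
    with x ⟨c, hc⟩
  refine ⟨c, ?_⟩
  rw [tendsto_add_atTop_iff_nat (f := fun n => mart n (addr P n x)) 1] at hc
  have h0 : Tendsto (fun n => (3 * φ + 1) / 10 * (v n * psi (addr P n x).1)) atTop (𝓝 0) := by
    have h1 : Tendsto (fun n => v n * psi (addr P n x).1) atTop (𝓝 0) :=
      tendsto_v.zero_mul_isBoundedUnder_le
        (isBoundedUnder_of ⟨2, fun n => by simpa using abs_psi_le _⟩)
    simpa using h1.const_mul ((3 * φ + 1) / 10)
  have := hc.add h0
  rw [add_zero] at this
  refine this.congr fun n => ?_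
  rw [mart]; ring

end IsExampleSequence

end

/-! ### The explicit group of eigenvalues -/

/-- The row vector `(φ - 1, 2 - φ)` is a left eigenvector of `A` for `2φ + 3`. -/
theorem dotProduct_inv_pow (l : ℕ) (w : Fin 2 → ℤ) :
    ![φ - 1, 2 - φ] ⬝ᵥ Matrix.mulVec ((matA.map (fun a : ℕ => (a : ℝ)))⁻¹ ^ l)
      (fun i => (w i : ℝ)) = (2 - φ) * (φ * w 0 + w 1) / (2 * φ + 3) ^ l := by
  have hφ := phi_sq
  have hg := phi_gt
  set A : Matrix (Fin 2) (Fin 2) ℝ := matA.map (fun a : ℕ => (a : ℝ)) with hA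
  have hA' : A = !![5, 2; 2, 3] := by
    rw [hA, matA]
    ext i j
    fin_cases i <;> fin_cases j <;> simp
  have hdet : IsUnit A.det := by
    rw [hA', Matrix.det_fin_two_of]; norm_num
  have hΛ : 2 * φ + 3 ≠ 0 := by linarith
  have h1 : Matrix.vecMul ![φ - 1, 2 - φ] A = (2 * φ + 3) • ![φ - 1, 2 - φ] := by
    rw [hA']
    ext i
    fin_cases i
    · simp [Matrix.vecMul, dotProduct, Fin.sum_univ_two]
      linear_combination (-2) * hφ
    · simp [Matrix.vecMul, dotProduct, Fin.sum_univ_two]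
      linear_combination 2 * hφ
  have h2 : Matrix.vecMul ![φ - 1, 2 - φ] A⁻¹ = (2 * φ + 3)⁻¹ • ![φ - 1, 2 - φ] := by
    have h3 : Matrix.vecMul (Matrix.vecMul ![φ - 1, 2 - φ] A) A⁻¹ = ![φ - 1, 2 - φ] := by
      rw [Matrix.vecMul_vecMul, Matrix.mul_nonsing_inv _ hdet, Matrix.vecMul_one]
    rw [h1, Matrix.smul_vecMul] at h3
    rw [eq_inv_smul_iff₀ hΛ, h3]
  have h3 : Matrix.vecMul ![φ - 1, 2 - φ] (A⁻¹ ^ l) = ((2 * φ + 3) ^ l)⁻¹ • ![φ - 1, 2 - φ] := by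
    induction l with
    | zero => simp
    | succ l ih =>
      rw [pow_succ, ← Matrix.vecMul_vecMul, ih, Matrix.smul_vecMul, h2, smul_smul, pow_succ,
        mul_inv]
  rw [Matrix.dotProduct_mulVec, h3]
  simp [dotProduct, Fin.sum_univ_two]
  field_simp
  linear_combination (4 * (w 0 : ℝ)) * hφ

/-- `α` is an angle for which the vector `α * H n` lies, modulo integer vectors, in the direction
of the small eigenvector. -/
def IsAngle (α : ℝ) : Prop :=
  ∃ n ≥ 1, ∃ a b : ℤ, φ * (α * H n 1 - a) + (α * H n 2 - b) = 0

/-- Since `A` occurs infinitely often, every power of `2φ + 3` divides some `Lam n` in `ℤ[φ]`. -/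
theorem exists_Lam_div (l : ℕ) : ∃ n ≥ 1, ∀ a b : ℤ, ∃ a' b' : ℤ,
    Lam n * (φ * a + b) / (2 * φ + 3) ^ l = φ * a' + b' := by
  have hφ := phi_sq
  have hg := phi_gt
  have hstep : ∀ l, ∀ n ≥ 1, (∀ a b : ℤ, ∃ a' b' : ℤ, Lam n * (φ * a + b) / (2 * φ + 3) ^ l =
      φ * a' + b') → ∀ m ≥ n, ∀ a b : ℤ, ∃ a' b' : ℤ, Lam m * (φ * a + b) / (2 * φ + 3) ^ l =
      φ * a' + b' := by
    intro l n hn h m hm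
    induction m, hm using Nat.le_induction with
    | base => exact h
    | succ m hm ih =>
      intro a b
      obtain ⟨a', b', h'⟩ := ih a b
      by_cases hA : IsA m
      · refine ⟨5 * a' + 2 * b', 2 * a' + 3 * b', ?_⟩
        rw [Lam_succ_A (by omega) hA, mul_assoc, mul_div_assoc, h']
        push_cast
        linear_combination 2 * (a' : ℝ) * hφ
      · refine ⟨2 * a' + b', a' + b', ?_⟩
        rw [Lam_succ_B (by omega) hA, mul_assoc, mul_div_assoc, h']
        push_cast
        linear_combination (a' : ℝ) * hφ
  induction l with
  | zero => exact ⟨1, le_rfl, fun a b => ⟨a, b, by simp [Lam_one]⟩⟩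
  | succ l ih =>
    obtain ⟨n, hn, h⟩ := ih
    obtain ⟨m, hm, hA⟩ := exists_isA n
    refine ⟨m + 1, by omega, fun a b => ?_⟩
    obtain ⟨a', b', h'⟩ := hstep l n hn h m hm a b
    refine ⟨a', b', ?_⟩
    rw [← h', Lam_succ_A (by omega) hA, pow_succ]
    have : 2 * φ + 3 ≠ 0 := by linarith
    field_simp

/-- Conversely `Lam n` divides a power of `2φ + 3` in `ℤ[φ]`, because `φ + 1` is a unit. -/
theorem exists_div_Lam {n : ℕ} (hn : 1 ≤ n) (a b : ℤ) : ∃ (l : ℕ) (a' b' : ℤ),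
    (φ * a + b) / Lam n = (φ * a' + b') / (2 * φ + 3) ^ l := by
  have hφ := phi_sq
  have hg := phi_gt
  induction n, hn using Nat.le_induction with
  | base => exact ⟨0, a, b, by simp [Lam_one]⟩
  | succ n hn ih =>
    obtain ⟨l, a', b', h⟩ := ih
    by_cases hA : IsA n
    · refine ⟨l + 1, a', b', ?_⟩
      rw [Lam_succ_A hn hA, mul_comm (2 * φ + 3) (Lam n), ← div_div, h, pow_succ, div_div]
    · refine ⟨l, a' - b', 2 * b' - a', ?_⟩
      rw [Lam_succ_B hn hA, mul_comm (φ + 1) (Lam n), ← div_div, h]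
      have : 2 * φ + 3 ≠ 0 := by linarith
      have : φ + 1 ≠ 0 := by linarith
      field_simp
      push_cast
      linear_combination 4 * (-(a' : ℝ) + b') * hφ

/-- In the angle condition `φ * a + b = α * (φ + 1) * Lam n`, so angles are the elements of `ℤ[φ] / Lam n`,
up to a unit; these are the numbers with denominators a power of `2φ + 3`. -/
theorem mem_explicitEigenvalues_iff (lam : ℂ) : lam ∈ explicitEigenvalues ↔
    ∃ α : ℝ, lam = Complex.exp (2 * Complex.I * Real.pi * α) ∧ IsAngle α := by
  have hφ := phi_sq
  have hg := phi_gt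
  constructor
  · rintro ⟨l, w, rfl⟩
    refine ⟨_, rfl, ?_⟩
    rw [dotProduct_inv_pow]
    obtain ⟨n, hn, h⟩ := exists_Lam_div l
    obtain ⟨a, b, h'⟩ := h (w 0) (w 1)
    refine ⟨n, hn, a, b, ?_⟩
    have hp := pf_H hn
    rw [mul_div_assoc] at h'
    linear_combination ((2 - φ) * (φ * w 0 + w 1) / (2 * φ + 3) ^ l) * hp + h' -
      (φ * w 0 + w 1) / (2 * φ + 3) ^ l * Lam n * hφ
  · rintro ⟨α, rfl, n, hn, a, b, h⟩
    obtain ⟨l, a', b', h'⟩ := exists_div_Lam hn a b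
    refine ⟨l, ![a', b'], ?_⟩
    rw [dotProduct_inv_pow]
    congr 3
    have hp := pf_H hn
    have hL := Lam_pos hn
    have e : α * ((φ + 1) * Lam n) = φ * a + b := by rw [← hp]; linear_combination h
    have e2 : α = (2 - φ) * ((φ * a + b) / Lam n) := by
      rw [← e]
      field_simp
      linear_combination 4 * α * hφ
    rw [e2, h']
    simp
    ring

/-! ### Construction of the eigenfunctions -/

/-- For an angle, the vectors `α * H n` are, modulo integer vectors, the multiples `c * v n * (1, -φ)` of
the small eigenvector. Phases of stacks of towers are therefore transverse heights. -/
theorem IsAngle.exists_phase {α : ℝ} (h : IsAngle α) : ∃ n₀ ≥ 1, ∃ c : ℝ, ∀ n ≥ n₀, ∀ k,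
    k = 1 ∨ k = 2 → ∃ w : ℤ, α * H n k = c * (v n * ell k) + w := by
  have hφ := phi_sq
  obtain ⟨n₀, hn₀, a, b, h⟩ := h
  have hv := v_pos hn₀
  refine ⟨n₀, hn₀, (α * H n₀ 1 - a) / v n₀, fun n hn => ?_⟩
  set c := (α * H n₀ 1 - a) / v n₀ with hc
  induction n, hn using Nat.le_induction with
  | base =>
    have hcv : c * v n₀ = α * H n₀ 1 - a := by rw [hc, div_mul_cancel₀ _ hv.ne']
    rintro k (rfl | rfl)
    · exact ⟨a, by rw [ell_one]; linear_combination -hcv⟩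
    · exact ⟨b, by rw [ell_two]; linear_combination h + φ * hcv⟩
  | succ n hn ih =>
    obtain ⟨w1, h1⟩ := ih 1 (by simp)
    obtain ⟨w2, h2⟩ := ih 2 (by simp)
    rw [ell_one] at h1
    rw [ell_two] at h2
    by_cases hA : IsA n
    · have hH := H_succ_A (hn₀.trans hn) hA
      rw [v_succ_A (hn₀.trans hn) hA]
      rintro k (rfl | rfl)
      · refine ⟨5 * w1 + 2 * w2, ?_⟩
        rw [hH.1, ell_one]; push_cast
        linear_combination 5 * h1 + 2 * h2
      · refine ⟨2 * w1 + 3 * w2, ?_⟩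
        rw [hH.2, ell_two]; push_cast
        linear_combination 2 * h1 + 3 * h2 - 2 * c * v n * hφ
    · have hH := H_succ_B (hn₀.trans hn) hA
      rw [v_succ_B (hn₀.trans hn) hA]
      rintro k (rfl | rfl)
      · refine ⟨2 * w1 + w2, ?_⟩
        rw [hH.1, ell_one]; push_cast
        linear_combination 2 * h1 + h2
      · refine ⟨w1 + w2, ?_⟩
        rw [hH.2, ell_two]; push_cast
        linear_combination h1 + h2 - c * v n * hφ

theorem exists_phase_hsum {α c : ℝ} {n : ℕ} (h : ∀ k, k = 1 ∨ k = 2 → ∃ w : ℤ,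
    α * H n k = c * (v n * ell k) + w) {u : List ℕ} (hu : ∀ k ∈ u, k = 1 ∨ k = 2) :
    ∃ w : ℤ, α * hsum (H n) u = c * (v n * lsum u) + w := by
  induction u with
  | nil => exact ⟨0, by simp⟩
  | cons k u ih =>
    obtain ⟨w1, h1⟩ := h k (hu k (by simp))
    obtain ⟨w2, h2⟩ := ih fun j hj => hu j (by simp [hj])
    refine ⟨w1 + w2, ?_⟩
    rw [hsum_cons, lsum_cons]; push_cast
    linear_combination h1 + h2

theorem exp_two_pi_mul_eq {a b : ℝ} {w : ℤ} (h : a = b + w) :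
    Complex.exp (2 * Complex.I * Real.pi * a) = Complex.exp (2 * Complex.I * Real.pi * b) := by
  rw [Complex.exp_eq_exp_iff_exists_int]
  exact ⟨w, by rw [h]; push_cast; ring⟩

theorem norm_exp_two_pi_mul (a : ℝ) : ‖Complex.exp (2 * Complex.I * Real.pi * a)‖ = 1 := by
  rw [show (2 * Complex.I * Real.pi * a : ℂ) = ((2 * Real.pi * a : ℝ) : ℂ) * Complex.I by
    push_cast; ring]
  exact Complex.norm_exp_ofReal_mul_I _

theorem le_Lam {n : ℕ} (hn : 1 ≤ n) : (n : ℝ) ≤ Lam n := by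
  have h := pf_H hn
  have hg := phi_gt
  have h1 : (n : ℝ) ≤ H n 1 := by exact_mod_cast le_H hn (by simp)
  have h2 : (n : ℝ) ≤ H n 2 := by exact_mod_cast le_H hn (by simp)
  nlinarith

section

variable {X : Type u} [TopologicalSpace X] {T : X ≃ₜ X}
  {P : ℕ → CKRPartition T} {n : ℕ} [MeasurableSpace X] [BorelSpace X] {μ : Measure X}

namespace IsExampleSequence

variable (hP : IsExampleSequence P)
include hP

omit [BorelSpace X] [MeasurableSpace X] in
theorem depth_succ (hn : 1 ≤ n) (x : X) : (addr P (n + 1) x).2 =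
    hsum (H n) (above n (addr P (n + 1) x)) + (addr P n x).2 := by
  have hj := hP.addr_lt (n := n + 1) (by omega) x
  rw [H_succ hn] at hj
  rw [hP.addr_desc hn x, above, hsum_upper_add hj]

omit [BorelSpace X] [MeasurableSpace X] in
theorem above_mem (hn : 1 ≤ n) (x : X) : ∀ k ∈ above n (addr P (n + 1) x), k = 1 ∨ k = 2 := by
  intro k hk
  have hj := hP.addr_lt (n := n + 1) (by omega) x
  rw [H_succ hn] at hj
  exact mem_topword (hP.addr_fst (by omega) x) (upper_mem hj hk)

omit [BorelSpace X] [MeasurableSpace X] in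
theorem addr_apply (hn : 1 ≤ n) {x : X} (hx : (addr P n x).2 ≠ 0) :
    addr P n (T x) = ((addr P n x).1, (addr P n x).2 - 1) := by
  have h1 := hP.addr_fst hn x
  have h2 := hP.addr_lt hn x
  have h3 := addr_mem (P := P) (n := n) x
  rw [hP.addr_eq_iff hn h1 (by omega)]
  obtain ⟨j, hj⟩ : ∃ j, (addr P n x).2 = j + 1 := ⟨_, (Nat.succ_pred hx).symm⟩
  rw [hj] at h3 ⊢
  exact h3

omit [BorelSpace X] [MeasurableSpace X] in
theorem mem_roof_iff (hn : 1 ≤ n) (x : X) : x ∈ (P n).roof ↔ (addr P n x).2 = 0 := by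
  rw [CKRPartition.mem_roof]
  constructor
  · rintro ⟨k, hk, hx⟩
    rw [hP.mem_Icc hn] at hk
    rw [(hP.addr_eq_iff hn hk (H_pos hn hk) x).2 hx]
  · intro h
    have h3 := addr_mem (P := P) (n := n) x
    rw [h] at h3
    exact ⟨_, (hP.mem_Icc hn).2 (hP.addr_fst hn x), h3⟩

/-- Apart from the common point of all roofs, a point leaves the roofs. -/
theorem ae_eventually_depth_ne_zero [IsProbabilityMeasure μ] (hT : MeasurePreserving T μ μ) :
    ∀ᵐ x ∂μ, ∀ᶠ n in atTop, (addr P n x).2 ≠ 0 := by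
  have hanti : ∀ n m, n ≤ m → (P m).roof ⊆ (P n).roof := by
    intro n m h
    induction m, h using Nat.le_induction with
    | base => exact subset_rfl
    | succ m _ ih => exact (hP.nested.roof_anti m).trans ih
  have hsub : {x | ¬ ∀ᶠ n in atTop, (addr P n x).2 ≠ 0} ⊆ ⋂ n, (P n).roof := by
    intro x hx
    rw [mem_ofPred_eq, not_eventually] at hx
    refine mem_iInter.2 fun n => ?_
    obtain ⟨m, hm, h⟩ := (hx.and_eventually (eventually_ge_atTop (max n 1))).exists.imp
      fun m h => And.intro h.2 (not_not.1 h.1)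
    exact hanti n m (by omega) ((hP.mem_roof_iff (by omega) x).2 h)
  obtain ⟨x₀, hx₀⟩ := hP.nested.roof_inter
  refine measure_mono_null (hsub.trans hx₀.subset) ?_
  have hle : ∀ n : ℕ, 1 ≤ n → μ.real {x₀} ≤ 1 / (n : ℝ) := by
    intro n hn
    have h1 := hP.measure_addr hT hn (hP.addr_fst hn x₀) (hP.addr_lt hn x₀)
    have h2 : μ.real {x₀} ≤ μ.real (addr P n ⁻¹' {((addr P n x₀).1, (addr P n x₀).2)}) :=
      measureReal_mono (by rintro _ rfl; rfl)
    rw [h1] at h2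
    refine h2.trans ?_
    have hw : wt (addr P n x₀).1 ≤ 1 := by
      have := phi_gt
      have := phi_lt
      unfold wt
      split_ifs <;> linarith
    have : (0 : ℝ) < n := by exact_mod_cast hn
    exact div_le_div₀ zero_le_one hw this (le_Lam hn)
  have h0 : μ.real {x₀} ≤ 0 :=
    ge_of_tendsto tendsto_one_div_atTop_nhds_zero_nat (eventually_atTop.2 ⟨1, hle⟩)
  have := le_antisymm h0 measureReal_nonneg
  rwa [measureReal_def, ENNReal.toReal_eq_zero_iff, or_iff_left (measure_ne_top _ _)] at this

/-- For an angle `α`, the functions `exp (- 2 π i α r)`, where `r` is the depth of a point in its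
tower of level `n`, converge almost everywhere after multiplication with constants. -/
theorem exists_eigenfunction [IsProbabilityMeasure μ] (hT : MeasurePreserving T μ μ) {α : ℝ}
    (hα : IsAngle α) : ∃ f : X → ℂ, StronglyMeasurable f ∧ (∀ᵐ x ∂μ, ‖f x‖ = 1) ∧
      (fun x => f (T x)) =ᵐ[μ] fun x => Complex.exp (2 * Complex.I * Real.pi * α) * f x := by
  obtain ⟨n₀, hn₀, c, hc⟩ := hα.exists_phase
  let E : ℝ → ℂ := fun a => Complex.exp (2 * Complex.I * Real.pi * a)
  have hEadd : ∀ a b, E (a + b) = E a * E b := fun a b => by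
    simp only [E]; rw [← Complex.exp_add]; push_cast; ring_nf
  have hEint : ∀ {a b : ℝ} {w : ℤ}, a = b + w → E a = E b := fun h => exp_two_pi_mul_eq h
  have hEnorm : ∀ a, ‖E a‖ = 1 := norm_exp_two_pi_mul
  have hEcont : Continuous E := by fun_prop
  let F : ℕ → X → ℂ := fun n x =>
    E (-(α * (addr P n x).2) + c * ∑ m ∈ Finset.Ico 1 n, drift m)
  -- The phases of `F n` and of the recentred transverse height differ by a fixed function.
  have hfix : ∀ x, ∀ n ≥ n₀, ∃ w : ℤ, α * (addr P n x).2 - c * theta n (addr P n x) =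
      α * (addr P n₀ x).2 - c * theta n₀ (addr P n₀ x) + w := by
    intro x n hn
    induction n, hn using Nat.le_induction with
    | base => exact ⟨0, by simp⟩
    | succ n hn ih =>
      obtain ⟨w, hw⟩ := ih
      obtain ⟨w', hw'⟩ := exists_phase_hsum (hc n hn) (hP.above_mem (hn₀.trans hn) x)
      refine ⟨w + w', ?_⟩
      rw [theta_succ (hn₀.trans hn), ← hP.addr_down (hn₀.trans hn), hP.depth_succ (hn₀.trans hn)]
      push_cast
      linear_combination hw + hw'
  have hF : ∀ x, ∀ n ≥ n₀, F n x = E (-(α * (addr P n₀ x).2 - c * theta n₀ (addr P n₀ x))) *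
      E (-c * (theta n (addr P n x) - ∑ m ∈ Finset.Ico 1 n, drift m)) := by
    intro x n hn
    obtain ⟨w, hw⟩ := hfix x n hn
    rw [← hEadd]
    refine hEint (w := -w) ?_
    push_cast
    linear_combination -hw
  have hconv : ∀ᵐ x ∂μ, ∃ z, Tendsto (fun n => F n x) atTop (𝓝 z) := by
    filter_upwards [hP.ae_tendsto_theta hT] with x ⟨t, ht⟩
    refine ⟨_, ((hEcont.tendsto _).comp (ht.const_mul (-c))).const_mul
      (E (-(α * (addr P n₀ x).2 - c * theta n₀ (addr P n₀ x)))) |>.congr' ?_⟩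
    filter_upwards [eventually_ge_atTop n₀] with n hn
    exact (hF x n hn).symm
  obtain ⟨f, hf, hlim⟩ := exists_stronglyMeasurable_limit_of_tendsto_ae
    (f := fun n => F (n + 1)) (μ := μ) (fun n => by
      have h1 : Measurable fun a : ℕ × ℕ =>
        E (-(α * a.2) + c * ∑ m ∈ Finset.Ico 1 (n + 1), drift m) := measurable_of_countable _
      exact (h1.comp (hP.measurable_addr (by omega))).aestronglyMeasurable)
    (by
      filter_upwards [hconv] with x ⟨z, hz⟩
      exact ⟨z, (tendsto_add_atTop_iff_nat 1).2 hz⟩)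
  refine ⟨f, hf, ?_, ?_⟩
  · filter_upwards [hlim] with x hx
    refine tendsto_nhds_unique hx.norm ?_
    simp only [F, hEnorm]
    exact tendsto_const_nhds
  · filter_upwards [hlim, hT.quasiMeasurePreserving.ae hlim, hP.ae_eventually_depth_ne_zero hT]
      with x hx hTx hd
    refine tendsto_nhds_unique hTx ((hx.const_mul (E α)).congr' ?_)
    filter_upwards [(tendsto_add_atTop_nat 1).eventually hd] with n hn
    simp only [F]
    rw [hP.addr_apply (by omega) hn, ← hEadd]
    congr 1
    obtain ⟨j, hj⟩ : ∃ j, (addr P (n + 1) x).2 = j + 1 := ⟨_, (Nat.succ_pred hn).symm⟩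
    rw [hj]
    push_cast
    ring

end IsExampleSequence

end

/-! ### Eigenvalues are explicit -/

/-- An eigenfunction of an ergodic system has constant modulus, and its eigenvalue has modulus `1`. -/
theorem eigenfunction_norm {X : Type*} [MeasurableSpace X] {T : X → X} {μ : Measure X}
    [IsProbabilityMeasure μ] (hT : Ergodic T μ) {f : X → ℂ} {lam : ℂ} (hf : MemLp f 2 μ)
    (hne : ¬ f =ᵐ[μ] 0) (heq : (fun x => f (T x)) =ᵐ[μ] fun x => lam * f x) :
    ‖lam‖ = 1 ∧ ∃ r : ℝ, 0 < r ∧ ∀ᵐ x ∂μ, ‖f x‖ = r := by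
  have h1 : eLpNorm (f ∘ T) 2 μ = eLpNorm f 2 μ :=
    eLpNorm_comp_measurePreserving hf.1 hT.toMeasurePreserving
  have h2 : eLpNorm (f ∘ T) 2 μ = ‖lam‖ₑ * eLpNorm f 2 μ := by
    rw [← eLpNorm_const_smul]
    exact eLpNorm_congr_ae heq
  have h0 : eLpNorm f 2 μ ≠ 0 := fun h => hne ((eLpNorm_eq_zero_iff hf.1 (by norm_num)).1 h)
  have hlam : ‖lam‖ = 1 := by
    rw [h1] at h2
    have h3 : (1 : ENNReal) = ‖lam‖ₑ := by
      have : 1 * eLpNorm f 2 μ = ‖lam‖ₑ * eLpNorm f 2 μ := by rw [one_mul]; exact h2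
      exact (ENNReal.mul_left_inj h0 hf.2.ne).1 this
    have := congrArg ENNReal.toReal h3
    simpa using this.symm
  refine ⟨hlam, ?_⟩
  obtain ⟨c, hc⟩ := hT.quasiErgodic.ae_eq_const_of_ae_eq_comp_ae (g := fun x => ‖f x‖) hf.1.norm (by
    filter_upwards [heq] with x hx
    simp only [Function.comp_apply]
    rw [hx, norm_mul, hlam, one_mul])
  have hc' : ∀ᵐ x ∂μ, ‖f x‖ = c := hc
  refine ⟨c, ?_, hc'⟩
  obtain ⟨x, hx⟩ := hc'.exists
  refine lt_of_le_of_ne (hx ▸ norm_nonneg _) fun h => hne ?_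
  filter_upwards [hc'] with x hx
  rw [← h] at hx
  simpa using hx

/-- The distance of a real number to the integers is bounded by a chord of the unit circle. -/
theorem exists_int_abs_sub_le (t : ℝ) :
    ∃ w : ℤ, |t - w| ≤ ‖Complex.exp (2 * Complex.I * Real.pi * t) - 1‖ := by
  refine ⟨round t, ?_⟩
  have h1 : Complex.exp (2 * Complex.I * Real.pi * t) =
      Complex.exp (2 * Complex.I * Real.pi * (t - round t : ℝ)) :=
    exp_two_pi_mul_eq (w := round t) (by ring)
  have h2 := abs_sub_round t
  set s := t - round t
  rw [h1, show (2 * Complex.I * Real.pi * (s : ℂ)) = Complex.I * ((2 * Real.pi * s : ℝ) : ℂ) by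
    push_cast; ring, Complex.norm_exp_I_mul_ofReal_sub_one]
  have hpi := Real.pi_pos
  have h3 : |2 * Real.pi * s / 2| ≤ Real.pi / 2 := by
    rw [show 2 * Real.pi * s / 2 = Real.pi * s by ring, abs_mul, abs_of_pos hpi]
    nlinarith
  have h4 := Real.mul_abs_le_abs_sin h3
  rw [show 2 * Real.pi * s / 2 = Real.pi * s by ring, abs_mul, abs_of_pos hpi] at h4
  have h5 : 2 / Real.pi * (Real.pi * |s|) = 2 * |s| := by field_simp
  rw [h5] at h4
  rw [norm_mul, Real.norm_eq_abs, Real.norm_eq_abs, abs_of_pos (by norm_num : (0 : ℝ) < 2),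
    show 2 * Real.pi * s / 2 = Real.pi * s by ring]
  have := abs_nonneg s
  linarith

/-- If `α * H n` is close to integer vectors for all large `n`, then `α` is an angle: the errors form
an orbit of the matrices, and bounded orbits have no component in the Perron direction. -/
theorem isAngle_of_close {α : ℝ} {n₀ : ℕ} (hn₀ : 1 ≤ n₀)
    (h : ∀ n ≥ n₀, ∀ k, k = 1 ∨ k = 2 → ∃ w : ℤ, |α * H n k - w| ≤ 1 / 10) : IsAngle α := by
  have hφ := phi_sq
  have hg := phi_gt
  have hl := phi_lt
  choose! w hw using h
  set e : ℕ → ℝ := fun n => φ * (α * H n 1 - w n 1) + (α * H n 2 - w n 2) with he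
  -- The bound `1 / 10` and the row sums of the matrices, at most `7`, make the nearest integer vectors
  -- of consecutive levels correspond to each other under the matrix.
  have hint : ∀ z : ℤ, |(z : ℝ)| < 1 → z = 0 := fun z hz => by
    rw [← Int.cast_abs] at hz
    exact Int.abs_lt_one_iff.1 (by exact_mod_cast hz)
  have hstep : ∀ n ≥ n₀, 2 * |e n| ≤ |e (n + 1)| := by
    intro n hn
    have a1 := abs_le.1 (hw n hn 1 (by simp))
    have a2 := abs_le.1 (hw n hn 2 (by simp))
    have b1 := abs_le.1 (hw (n + 1) (by omega) 1 (by simp))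
    have b2 := abs_le.1 (hw (n + 1) (by omega) 2 (by simp))
    by_cases hA : IsA n
    · have hH := H_succ_A (hn₀.trans hn) hA
      rw [hH.1] at b1
      rw [hH.2] at b2
      push_cast at b1 b2
      have z1 : 5 * w n 1 + 2 * w n 2 - w (n + 1) 1 = 0 := by
        apply hint; push_cast; rw [abs_lt]; constructor <;> linarith [a1.1, a1.2, a2.1, a2.2, b1.1, b1.2]
      have z2 : 2 * w n 1 + 3 * w n 2 - w (n + 1) 2 = 0 := by
        apply hint; push_cast; rw [abs_lt]; constructor <;> linarith [a1.1, a1.2, a2.1, a2.2, b2.1, b2.2]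
      have z1' : (5 * w n 1 + 2 * w n 2 - w (n + 1) 1 : ℝ) = 0 := by exact_mod_cast z1
      have z2' : (2 * w n 1 + 3 * w n 2 - w (n + 1) 2 : ℝ) = 0 := by exact_mod_cast z2
      have : e (n + 1) = (2 * φ + 3) * e n := by
        simp only [he]; rw [hH.1, hH.2]; push_cast
        linear_combination φ * z1' + z2' - 2 * (α * H n 1 - w n 1) * hφ
      rw [this, abs_mul, abs_of_pos (by linarith : 0 < 2 * φ + 3)]
      exact mul_le_mul_of_nonneg_right (by linarith) (abs_nonneg _)
    · have hH := H_succ_B (hn₀.trans hn) hA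
      rw [hH.1] at b1
      rw [hH.2] at b2
      push_cast at b1 b2
      have z1 : 2 * w n 1 + w n 2 - w (n + 1) 1 = 0 := by
        apply hint; push_cast; rw [abs_lt]; constructor <;> linarith [a1.1, a1.2, a2.1, a2.2, b1.1, b1.2]
      have z2 : w n 1 + w n 2 - w (n + 1) 2 = 0 := by
        apply hint; push_cast; rw [abs_lt]; constructor <;> linarith [a1.1, a1.2, a2.1, a2.2, b2.1, b2.2]
      have z1' : (2 * w n 1 + w n 2 - w (n + 1) 1 : ℝ) = 0 := by exact_mod_cast z1
      have z2' : (w n 1 + w n 2 - w (n + 1) 2 : ℝ) = 0 := by exact_mod_cast z2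
      have : e (n + 1) = (φ + 1) * e n := by
        simp only [he]; rw [hH.1, hH.2]; push_cast
        linear_combination φ * z1' + z2' - (α * H n 1 - w n 1) * hφ
      rw [this, abs_mul, abs_of_pos (by linarith : 0 < φ + 1)]
      exact mul_le_mul_of_nonneg_right (by linarith) (abs_nonneg _)
  have hgrow : ∀ k, 2 ^ k * |e n₀| ≤ |e (n₀ + k)| := by
    intro k
    induction k with
    | zero => simp
    | succ k ih =>
      have := hstep (n₀ + k) (by omega)
      rw [← add_assoc, pow_succ]
      linarith
  have hbd : ∀ k, |e (n₀ + k)| ≤ 1 := by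
    intro k
    have a1 := abs_le.1 (hw (n₀ + k) (by omega) 1 (by simp))
    have a2 := abs_le.1 (hw (n₀ + k) (by omega) 2 (by simp))
    rw [abs_le]
    simp only [he]
    constructor <;> nlinarith [a1.1, a1.2, a2.1, a2.2]
  have h0 : |e n₀| = 0 := by
    by_contra hne
    have hpos : 0 < |e n₀| := lt_of_le_of_ne (abs_nonneg _) (Ne.symm hne)
    obtain ⟨k, hk⟩ := pow_unbounded_of_one_lt (1 / |e n₀|) (by norm_num : (1 : ℝ) < 2)
    rw [div_lt_iff₀ hpos] at hk
    linarith [hgrow k, hbd k]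
  exact ⟨n₀, hn₀, w n₀ 1, w n₀ 2, abs_eq_zero.1 h0⟩

section

variable {X : Type u} [TopologicalSpace X] {T : X ≃ₜ X}
  {P : ℕ → CKRPartition T} {n : ℕ} [MeasurableSpace X] [BorelSpace X] {μ : Measure X}

/-- The integrals of an eigenfunction over the levels of a tower differ by powers of the eigenvalue. -/
theorem setIntegral_preimage_iterate (hT : MeasurePreserving T μ μ) {f : X → ℂ} {lam : ℂ}
    (heq : (fun x => f (T x)) =ᵐ[μ] fun x => lam * f x) {s : Set X} (hs : MeasurableSet s) (j : ℕ) :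
    lam ^ j * ∫ x in T^[j] ⁻¹' s, f x ∂μ = ∫ x in s, f x ∂μ := by
  have h1 : ∀ s : Set X, MeasurableSet s → lam * ∫ x in T ⁻¹' s, f x ∂μ = ∫ x in s, f x ∂μ := by
    intro s hs
    rw [← hT.setIntegral_preimage_emb T.measurableEmbedding f s, ← integral_const_mul]
    exact integral_congr_ae (ae_restrict_of_ae heq.symm)
  induction j with
  | zero => simp
  | succ j ih =>
    rw [← ih, Function.iterate_succ, preimage_comp, pow_succ, mul_assoc,
      h1 _ ((T.measurable.iterate j) hs)]

theorem exists_continuous_approx [CompactSpace X] [TopologicalSpace.MetrizableSpace X]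
    [IsProbabilityMeasure μ] {f : X → ℂ} (hf : Integrable f μ) {ε : ℝ} (hε : 0 < ε) :
    ∃ g : X → ℂ, Continuous g ∧ Integrable g μ ∧ ∫ x, ‖f x - g x‖ ∂μ ≤ ε := by
  obtain ⟨g, h1, h2⟩ := hf.exists_boundedContinuous_integral_sub_le hε
  exact ⟨g, g.continuous, h2, h1⟩

/-- If the midpoint of `1` and `z` is near the unit circle, then `z` is near `1`. -/
theorem norm_one_add_bound {z : ℂ} (hz : ‖z‖ = 1) {δ : ℝ} (h : 2 - ‖1 + z‖ ≤ δ) :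
    ‖z - 1‖ ^ 2 ≤ 4 * δ := by
  have h1 := parallelogram_law_with_norm ℝ (1 : ℂ) z
  rw [norm_sub_rev, hz, norm_one] at h1
  have h2 : ‖1 + z‖ ≤ 2 := by
    calc ‖1 + z‖ ≤ ‖(1 : ℂ)‖ + ‖z‖ := norm_add_le _ _
      _ = 2 := by rw [hz, norm_one]; norm_num
  nlinarith [norm_nonneg (1 + z)]

/-- If a unimodular eigenfunction has a mean of modulus nearly `1` on `s`, and `s` contains two
disjoint copies of the same set, at time distance `D`, then `lam ^ D` is near `1`. -/
theorem norm_pow_sub_one_le [IsProbabilityMeasure μ] (hT : MeasurePreserving T μ μ) {f : X → ℂ}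
    {lam : ℂ} (hlam : ‖lam‖ = 1) (hf : Integrable f μ) (hf1 : ∀ᵐ x ∂μ, ‖f x‖ = 1)
    (heq : (fun x => f (T x)) =ᵐ[μ] fun x => lam * f x) {s E : Set X}
    (hE : MeasurableSet E) {D : ℕ} (h1 : E ⊆ s) (h2 : T^[D] ⁻¹' E ⊆ s)
    (hdis : Disjoint E (T^[D] ⁻¹' E)) {ε C : ℝ} (hε : (1 - ε) * μ.real s ≤ ‖∫ x in s, f x ∂μ‖)
    (hC : μ.real s ≤ C * μ.real E) (hpos : 0 < μ.real E) (hε0 : 0 ≤ ε) :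
    ‖lam ^ D - 1‖ ^ 2 ≤ 4 * (ε * C) := by
  have hE' : MeasurableSet (T^[D] ⁻¹' E) := (T.measurable.iterate D) hE
  have hle : ∀ t : Set X, ‖∫ x in t, f x ∂μ‖ ≤ μ.real t := by
    intro t
    have := norm_setIntegral_le_of_norm_le_const_ae (μ := μ) (s := t) (f := f) (C := 1)
      (measure_lt_top _ _) (ae_restrict_of_ae (hf1.mono fun x hx => hx.le))
    simpa using this
  have hμ : μ.real (T^[D] ⁻¹' E) = μ.real E := by
    rw [measureReal_def, measureReal_def, (hT.iterate D).measure_preimage hE.nullMeasurableSet]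
  have hU : E ∪ T^[D] ⁻¹' E ⊆ s := union_subset h1 h2
  have hmU := hE.union hE'
  have e1 : ∫ x in s, f x ∂μ = ∫ x in s \ (E ∪ T^[D] ⁻¹' E), f x ∂μ +
      (∫ x in E, f x ∂μ + ∫ x in T^[D] ⁻¹' E, f x ∂μ) := by
    rw [← setIntegral_union hdis hE' hf.integrableOn hf.integrableOn,
      ← setIntegral_union disjoint_sdiff_left hmU hf.integrableOn hf.integrableOn,
      sdiff_union_of_subset hU]
  have e2 : ∫ x in E, f x ∂μ = lam ^ D * ∫ x in T^[D] ⁻¹' E, f x ∂μ :=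
    (setIntegral_preimage_iterate hT heq hE D).symm
  have e3 : μ.real (s \ (E ∪ T^[D] ⁻¹' E)) = μ.real s - 2 * μ.real E := by
    rw [measureReal_sdiff hU hmU, measureReal_union hdis hE', hμ]; ring
  have hz : ‖lam ^ D‖ = 1 := by rw [norm_pow, hlam, one_pow]
  refine norm_one_add_bound hz ?_
  have e4 : ‖∫ x in s, f x ∂μ‖ ≤ (μ.real s - 2 * μ.real E) + ‖1 + lam ^ D‖ * μ.real E := by
    rw [e1, e2, ← e3, show lam ^ D * ∫ x in T^[D] ⁻¹' E, f x ∂μ + ∫ x in T^[D] ⁻¹' E, f x ∂μ =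
      (1 + lam ^ D) * ∫ x in T^[D] ⁻¹' E, f x ∂μ by ring]
    refine (norm_add_le _ _).trans (add_le_add (hle _) ?_)
    rw [norm_mul, ← hμ]
    exact mul_le_mul_of_nonneg_left (hle _) (norm_nonneg _)
  have e5 : (2 - ‖1 + lam ^ D‖) * μ.real E ≤ (ε * C) * μ.real E := by nlinarith
  exact le_of_mul_le_mul_right e5 hpos

theorem Lam_le_H {n : ℕ} (hn : 1 ≤ n) {k : ℕ} (hk : k = 1 ∨ k = 2) : Lam n ≤ 2 * H n k := by
  have hp := pf_H hn
  have hg := phi_gt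
  have hl := phi_lt
  have hL := Lam_pos hn
  obtain ⟨-, h2, h1⟩ := H_bounds hn
  have h1' : (H n 1 : ℝ) ≤ 2 * H n 2 := by exact_mod_cast h1
  have h2' : (H n 2 : ℝ) ≤ H n 1 := by exact_mod_cast h2
  rcases hk with rfl | rfl <;> nlinarith

theorem Lam_succ_le {n : ℕ} (hn : 1 ≤ n) : Lam (n + 1) ≤ 7 * Lam n := by
  have hl := phi_lt
  have hL := Lam_pos hn
  by_cases hA : IsA n
  · rw [Lam_succ_A hn hA]; nlinarith
  · rw [Lam_succ_B hn hA]; nlinarith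

theorem wt_bounds (k : ℕ) : 1 / 3 ≤ wt k ∧ wt k ≤ 2 / 3 := by
  have := phi_gt
  have := phi_lt
  unfold wt
  split_ifs <;> constructor <;> linarith

namespace IsExampleSequence

variable (hP : IsExampleSequence P)
include hP

/-- The means of a unimodular eigenfunction over the towers of high levels have modulus close
to `1`. -/
theorem exists_norm_mean_ge [CompactSpace X] [TopologicalSpace.MetrizableSpace X]
    [IsProbabilityMeasure μ] (hT : MeasurePreserving T μ μ) {f : X → ℂ}
    {lam : ℂ} (hlam : ‖lam‖ = 1) (hf : Integrable f μ) (hf1 : ∀ᵐ x ∂μ, ‖f x‖ = 1)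
    (heq : (fun x => f (T x)) =ᵐ[μ] fun x => lam * f x) {ε : ℝ} (hε : 0 < ε) :
    ∃ n₀ ≥ 1, ∀ n ≥ n₀, ∀ k, k = 1 ∨ k = 2 →
      (1 - ε) * μ.real ((P n).B k) ≤ ‖∫ x in (P n).B k, f x ∂μ‖ := by
  obtain ⟨g, hg, hgi, hfg⟩ := exists_continuous_approx hf (show 0 < ε / 24 by positivity)
  obtain ⟨n₀, hn₀, hosc⟩ := hP.exists_addr_dist_lt hg (show 0 < ε / 4 by positivity)
  refine ⟨n₀, hn₀, fun n hn k hk => ?_⟩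
  have hn1 : 1 ≤ n := hn₀.trans hn
  set m := μ.real ((P n).B k) with hm
  let a : ℕ → Set X := fun j => T^[j] ⁻¹' (P n).B k
  have hBm := (hP.isClopen_B hn1 hk).isOpen.measurableSet
  have ham : ∀ j, MeasurableSet (a j) := fun j => (T.measurable.iterate j) hBm
  have hμa : ∀ j, μ.real (a j) = m := fun j => by
    rw [hm, measureReal_def, measureReal_def, (hT.iterate j).measure_preimage hBm.nullMeasurableSet]
  have hint : ∀ j, ‖∫ x in a j, f x ∂μ‖ = ‖∫ x in (P n).B k, f x ∂μ‖ := fun j => by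
    rw [← setIntegral_preimage_iterate hT heq hBm j, norm_mul, norm_pow, hlam, one_pow, one_mul]
  have hfgi : Integrable (fun x => ‖f x - g x‖) μ := (hf.sub hgi).norm
  have hatom : ∀ j < H n k, m - 2 * (∫ x in a j, ‖f x - g x‖ ∂μ) - ε / 2 * m ≤
      ‖∫ x in (P n).B k, f x ∂μ‖ := by
    intro j hj
    obtain ⟨y, hy⟩ := hP.nonempty_B hn1 hk
    obtain ⟨x₀, rfl⟩ := T.surjective.iterate j y
    have hx₀ : addr P n x₀ = (k, j) := (hP.addr_eq_iff hn1 hk hj x₀).2 hy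
    have hpt : ∀ x ∈ a j, ‖g x - g x₀‖ ≤ ε / 4 := by
      intro x hx
      have : addr P n x = (k, j) := (hP.addr_eq_iff hn1 hk hj x).2 hx
      rw [← dist_eq_norm]
      exact (hosc n hn x x₀ (this.trans hx₀.symm)).le
    have hdiff : ∀ x ∈ a j, ‖f x - g x₀‖ ≤ ‖f x - g x‖ + ε / 4 := by
      intro x hx
      calc ‖f x - g x₀‖ ≤ ‖f x - g x‖ + ‖g x - g x₀‖ := norm_sub_le_norm_sub_add_norm_sub _ _ _
        _ ≤ _ := by gcongr; exact hpt x hx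
    have hD : Integrable (fun x => ‖f x - g x‖ + ε / 4) (μ.restrict (a j)) :=
      hfgi.integrableOn.add (integrable_const _)
    have hDint : ∫ x in a j, (‖f x - g x‖ + ε / 4) ∂μ = ∫ x in a j, ‖f x - g x‖ ∂μ + ε / 4 * m := by
      rw [integral_add hfgi.integrableOn (integrable_const _)]
      simp [hμa, mul_comm]
    have c1 : ‖∫ x in a j, f x ∂μ - m * g x₀‖ ≤ ∫ x in a j, ‖f x - g x‖ ∂μ + ε / 4 * m := by
      have : ∫ x in a j, f x ∂μ - m * g x₀ = ∫ x in a j, (f x - g x₀) ∂μ := by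
        rw [integral_sub hf.integrableOn (integrable_const _)]
        simp [hμa]
      rw [this, ← hDint]
      refine norm_integral_le_of_norm_le hD ?_
      filter_upwards [ae_restrict_mem (ham j)] with x hx using hdiff x hx
    have c2 : m ≤ ∫ x in a j, ‖f x - g x‖ ∂μ + ε / 4 * m + ‖g x₀‖ * m := by
      have h1 : ∫ x in a j, (1 : ℝ) ∂μ ≤ ∫ x in a j, (‖f x - g x‖ + ε / 4 + ‖g x₀‖) ∂μ := by
        refine integral_mono_ae (integrable_const _) (hD.add (integrable_const _)) ?_
        filter_upwards [ae_restrict_mem (ham j), ae_restrict_of_ae hf1] with x hx hx1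
        have := hdiff x hx
        have h3 : ‖f x‖ ≤ ‖f x - g x₀‖ + ‖g x₀‖ := by
          simpa using norm_add_le (f x - g x₀) (g x₀)
        linarith
      rw [integral_add hD (integrable_const _), hDint] at h1
      simp [hμa] at h1
      linarith
    have c3 : ‖g x₀‖ * m ≤ ‖∫ x in a j, f x ∂μ‖ + ‖∫ x in a j, f x ∂μ - m * g x₀‖ := by
      have : ‖(m : ℂ) * g x₀‖ = ‖g x₀‖ * m := by
        rw [norm_mul, Complex.norm_real, Real.norm_eq_abs, abs_of_nonneg measureReal_nonneg, mul_comm]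
      rw [← this]
      simpa using norm_sub_le (∫ x in a j, f x ∂μ) (∫ x in a j, f x ∂μ - m * g x₀)
    rw [← hint j]
    linarith
  have hsum : ∑ j ∈ Finset.range (H n k), ∫ x in a j, ‖f x - g x‖ ∂μ ≤ ε / 24 := by
    rw [← integral_biUnion_finset _ (fun j _ => ham j) ?_ fun j _ => hfgi.integrableOn]
    · exact (setIntegral_le_integral hfgi (ae_of_all _ fun x => norm_nonneg _)).trans hfg
    · intro i hi j hj hij
      have hmem := (hP.mem_Icc hn1).2 hk
      rw [Finset.coe_range, mem_Iio, ← hP.h_eq hn1 hk] at hi hj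
      exact (P n).disjoint k hmem k hmem i hi j hj (by simpa using hij)
  have htot := Finset.sum_le_sum fun j hj => hatom j (Finset.mem_range.1 hj)
  rw [Finset.sum_sub_distrib, Finset.sum_sub_distrib, ← Finset.mul_sum] at htot
  simp only [Finset.sum_const, Finset.card_range, nsmul_eq_mul] at htot
  have hHm : 1 / 6 ≤ H n k * m := by
    rw [hm, hP.measure_B hT hn1 hk, mul_div_assoc', le_div_iff₀ (Lam_pos hn1)]
    have := Lam_le_H hn1 hk
    have := (wt_bounds k).1
    have : (0 : ℝ) < H n k := by exact_mod_cast H_pos hn1 hk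
    nlinarith
  have hH : (0 : ℝ) < H n k := by exact_mod_cast H_pos hn1 hk
  refine le_of_mul_le_mul_left ?_ hH
  nlinarith

/-- For an eigenvalue `lam` the powers with exponents the heights of the towers tend to `1`. -/
theorem eventually_norm_pow_height [CompactSpace X] [TopologicalSpace.MetrizableSpace X]
    [IsProbabilityMeasure μ] (hT : Ergodic T μ) {lam : ℂ} (h : IsEigenvalue T μ lam) {ε : ℝ}
    (hε : 0 < ε) : ‖lam‖ = 1 ∧ ∃ n₀ ≥ 1, ∀ n ≥ n₀, ∀ k, k = 1 ∨ k = 2 →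
      ‖lam ^ H n k - 1‖ ≤ ε := by
  obtain ⟨f₀, hf₀, hne, heq₀⟩ := h
  have hmp := hT.toMeasurePreserving
  obtain ⟨hlam, r, hr, hfr⟩ := eigenfunction_norm hT hf₀ hne heq₀
  refine ⟨hlam, ?_⟩
  let f : X → ℂ := fun x => (r : ℂ)⁻¹ * f₀ x
  have hf : Integrable f μ := ((hf₀.mono_exponent (by norm_num)).integrable le_rfl).const_mul _
  have hf1 : ∀ᵐ x ∂μ, ‖f x‖ = 1 := by
    filter_upwards [hfr] with x hx
    simp only [f]
    rw [norm_mul, norm_inv, Complex.norm_real, Real.norm_eq_abs, abs_of_pos hr, hx,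
      inv_mul_cancel₀ hr.ne']
  have heq : (fun x => f (T x)) =ᵐ[μ] fun x => lam * f x := by
    filter_upwards [heq₀] with x hx
    simp only [f]
    rw [hx]; ring
  -- The roof of tower `k` has at most `14` times the measure of the roof of tower `1` one level above,
  -- and `56 = 4 * 14` comes from `norm_pow_sub_one_le`.
  have hε' : 0 < (ε / 3) ^ 2 / 56 := by positivity
  obtain ⟨n₀, hn₀, hmean⟩ := hP.exists_norm_mean_ge hmp hlam hf hf1 heq hε'
  -- Two occurrences of the letter `k` in tower `1`, at a distance of `H n k`.
  have hclose : ∀ n ≥ n₀, ∀ k, k = 1 ∨ k = 2 → ∀ u u', topword n 1 = u ++ k :: k :: u' →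
      ‖lam ^ H n k - 1‖ ≤ ε / 3 := by
    intro n hn k hk u u' hw
    have hn1 : 1 ≤ n := hn₀.trans hn
    have hHk := H_pos hn1 hk
    have hB := (hP.isClopen_B (n := n + 1) (k := 1) (by omega) (by simp)).isOpen.measurableSet
    have hH1 : H (n + 1) 1 = hsum (H n) u + H n k + H n k + hsum (H n) u' := by
      rw [H_succ hn1, hw]; simp; omega
    have hE : ∀ j, MeasurableSet (T^[j] ⁻¹' (P (n + 1)).B 1) := fun j => (T.measurable.iterate j) hB
    have hpre : T^[H n k] ⁻¹' (T^[hsum (H n) u] ⁻¹' (P (n + 1)).B 1) =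
        T^[hsum (H n) u + H n k] ⁻¹' (P (n + 1)).B 1 := by
      rw [← preimage_comp, ← Function.iterate_add]
    have hμE : μ.real (T^[hsum (H n) u] ⁻¹' (P (n + 1)).B 1) = wt 1 / Lam (n + 1) := by
      rw [← hP.measure_B hmp (by omega) (by simp), measureReal_def, measureReal_def,
        (hmp.iterate _).measure_preimage hB.nullMeasurableSet]
    have hL := Lam_pos hn1
    have hL' := Lam_pos (n := n + 1) (by omega)
    have hw1 := wt_bounds 1
    have hwk := wt_bounds k
    have hd1 : desc (H n) (topword n 1) (hsum (H n) u) = (k, 0) := by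
      have := desc_cell (h := H n) (w := u) (c := k) (w' := k :: u') hHk
      rwa [← hw, add_zero] at this
    have hd2 : desc (H n) (topword n 1) (hsum (H n) u + H n k) = (k, 0) := by
      have := desc_cell (h := H n) (w := u ++ [k]) (c := k) (w' := u') hHk
      simpa [hw] using this
    have hsq : ‖lam ^ H n k - 1‖ ^ 2 ≤ 4 * ((ε / 3) ^ 2 / 56 * 14) := by
      refine norm_pow_sub_one_le hmp hlam hf hf1 heq (hE (hsum (H n) u)) ?_ ?_ ?_
        (hmean n hn k hk) ?_ ?_ hε'.le
      · intro x hx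
        have := hP.mem_desc hn1 (l := 1) (by simp) (by omega) hx
        rwa [hd1] at this
      · rw [hpre]
        intro x hx
        have := hP.mem_desc hn1 (l := 1) (by simp) (by omega) hx
        rwa [hd2] at this
      · rw [hpre]
        have h1 := (hP.mem_Icc (n := n + 1) (by omega)).2 (Or.inl rfl : (1 : ℕ) = 1 ∨ (1 : ℕ) = 2)
        refine (P (n + 1)).disjoint 1 h1 1 h1 _ ?_ _ ?_ (by simp; omega) <;>
        · rw [hP.h_eq (by omega) (by simp)]; omega
      · rw [hP.measure_B hmp hn1 hk, hμE, div_le_iff₀ hL]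
        have h7 := Lam_succ_le hn1
        have : 14 * (wt 1 / Lam (n + 1)) * Lam n = 14 * wt 1 * Lam n / Lam (n + 1) := by ring
        rw [this, le_div_iff₀ hL']
        nlinarith
      · rw [hμE]
        exact div_pos (by linarith) hL'
    have : ‖lam ^ H n k - 1‖ ^ 2 ≤ (ε / 3) ^ 2 := hsq.trans (le_of_eq (by ring))
    exact (sq_le_sq₀ (norm_nonneg _) (by positivity)).1 this
  have h1 : ∀ n ≥ n₀, ‖lam ^ H n 1 - 1‖ ≤ ε / 3 := by
    intro n hn
    obtain ⟨u', hu'⟩ := topword_one_eq n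
    exact hclose n hn 1 (by simp) [] u' (by simpa using hu')
  refine ⟨n₀, hn₀, fun n hn k hk => ?_⟩
  rcases hk with rfl | rfl
  · exact (h1 n hn).trans (by linarith)
  · by_cases hA : IsA n
    · exact (hclose n hn 2 (by simp) [1, 1, 1, 1, 1] [] (by simp [topword_one_A hA])).trans
        (by linarith)
    · -- The word of tower `1` for `B` has no factor `22`; the power of `lam` with exponent `H n 2` is
      -- obtained from those with exponents `H (n + 1) 1 = 2 * H n 1 + H n 2` and `H n 1`.
      have hH := (H_succ_B (hn₀.trans hn) hA).1
      have e1 := h1 n hn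
      have e2 := h1 (n + 1) (by omega)
      rw [hH, pow_add, mul_comm 2, pow_mul] at e2
      set z := lam ^ H n 1 with hz
      set y := lam ^ H n 2 with hy
      have hzn : ‖z‖ = 1 := by rw [hz, norm_pow, hlam, one_pow]
      have e3 : ‖z ^ 2 * (y - 1)‖ ≤ ‖z ^ 2 * y - 1‖ + ‖z + 1‖ * ‖z - 1‖ := by
        rw [← norm_mul]
        rw [show z ^ 2 * (y - 1) = z ^ 2 * y - 1 - (z + 1) * (z - 1) by ring]
        exact norm_sub_le _ _
      rw [norm_mul, norm_pow, hzn, one_pow, one_mul] at e3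
      have e4 : ‖z + 1‖ ≤ 2 := by
        calc ‖z + 1‖ ≤ ‖z‖ + ‖(1 : ℂ)‖ := norm_add_le _ _
          _ = 2 := by rw [hzn, norm_one]; norm_num
      nlinarith [norm_nonneg (z - 1)]

/-- The eigenvalues are the exponentials of the angles: for an eigenvalue the vectors `α * H n` are close
to integer vectors, and conversely an angle has an eigenfunction. -/
theorem eigenvalues_eq [CompactSpace X] [TopologicalSpace.MetrizableSpace X]
    [IsProbabilityMeasure μ] (hT : Ergodic T μ) :
    {lam : ℂ | IsEigenvalue T μ lam} = explicitEigenvalues := by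
  ext lam
  rw [mem_explicitEigenvalues_iff]
  constructor
  · intro h
    obtain ⟨hlam, n₀, hn₀, hclose⟩ := hP.eventually_norm_pow_height hT h
      (show (0 : ℝ) < 1 / 10 by norm_num)
    have harg : lam = Complex.exp (2 * Complex.I * Real.pi * (Complex.arg lam / (2 * Real.pi) : ℝ)) := by
      have h1 := Complex.norm_mul_exp_arg_mul_I lam
      rw [hlam] at h1
      simp only [Complex.ofReal_one, one_mul] at h1
      conv_lhs => rw [← h1]
      congr 1
      have : (Real.pi : ℂ) ≠ 0 := by exact_mod_cast Real.pi_ne_zero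
      push_cast
      field_simp
    refine ⟨_, harg, isAngle_of_close hn₀ fun n hn k hk => ?_⟩
    obtain ⟨w, hw⟩ := exists_int_abs_sub_le (Complex.arg lam / (2 * Real.pi) * H n k)
    refine ⟨w, hw.trans ?_⟩
    have e : Complex.exp (2 * Complex.I * Real.pi *
        ((Complex.arg lam / (2 * Real.pi) * H n k : ℝ) : ℂ)) = lam ^ H n k := by
      conv_rhs => rw [harg, ← Complex.exp_nat_mul]
      congr 1
      push_cast
      ring
    rw [e]
    exact hclose n hn k hk
  · rintro ⟨α, rfl, hα⟩
    obtain ⟨f, hf, hf1, heq⟩ := hP.exists_eigenfunction hT.toMeasurePreserving hα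
    refine ⟨f, ?_, ?_, heq⟩
    · exact MemLp.of_bound hf.aestronglyMeasurable 1 (hf1.mono fun x hx => hx.le)
    · intro h0
      obtain ⟨x, hx1, hx0⟩ := (hf1.and h0).exists
      simp [hx0] at hx1

end IsExampleSequence

end

/-! ### Return times to the roofs -/

/-- The word of the towers of level `m` in tower `l` of level `m + k`, read from top to bottom. -/
noncomputable def Wd (m : ℕ) : ℕ → ℕ → List ℕ
  | 0, l => [l]
  | k + 1, l => (topword (m + k) l).flatMap (Wd m k)

theorem mem_Wd {m k l c : ℕ} (hl : l = 1 ∨ l = 2) (hc : c ∈ Wd m k l) : c = 1 ∨ c = 2 := by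
  induction k generalizing l with
  | zero => rw [Wd, List.mem_singleton] at hc; rwa [hc]
  | succ k ih =>
    rw [Wd, List.mem_flatMap] at hc
    obtain ⟨a, ha, hc⟩ := hc
    exact ih (mem_topword hl ha) hc

theorem hsum_flatMap {h h' : ℕ → ℕ} {f : ℕ → List ℕ} {w : List ℕ}
    (hf : ∀ c ∈ w, hsum h (f c) = h' c) : hsum h (w.flatMap f) = hsum h' w := by
  induction w with
  | nil => rfl
  | cons c w ih =>
    rw [List.flatMap_cons, hsum_append, hsum_cons, hf c (by simp), ih fun d hd => hf d (by simp [hd])]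

theorem desc_append_left {h : ℕ → ℕ} {w w' : List ℕ} {j : ℕ} (hj : j < hsum h w) :
    desc h (w ++ w') j = desc h w j := by
  obtain ⟨u, c, u', i, rfl, rfl, hi⟩ := exists_cell hj
  rw [desc_cell hi, List.append_assoc, List.cons_append, desc_cell hi]

theorem desc_flatMap {h h' : ℕ → ℕ} {f : ℕ → List ℕ} {w : List ℕ} {j : ℕ}
    (hf : ∀ c ∈ w, hsum h (f c) = h' c) (hj : j < hsum h' w) :
    desc h (w.flatMap f) j = desc h (f (desc h' w j).1) (desc h' w j).2 := by
  obtain ⟨u, c, u', i, rfl, rfl, hi⟩ := exists_cell hj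
  rw [desc_cell hi, List.flatMap_append, List.flatMap_cons,
    ← hsum_flatMap (h' := h') fun d hd => hf d (by simp [hd]), desc_append_right]
  exact desc_append_left (by rw [hf c (by simp)]; exact hi)

theorem hsum_Wd {m : ℕ} (hm : 1 ≤ m) (k : ℕ) {l : ℕ} (hl : l = 1 ∨ l = 2) :
    hsum (H m) (Wd m k l) = H (m + k) l := by
  induction k generalizing l with
  | zero => simp [Wd]
  | succ k ih =>
    rw [Wd, hsum_flatMap fun c hc => ih (mem_topword hl hc), ← H_succ (by omega), add_assoc]

theorem desc_Wd_succ {m : ℕ} (hm : 1 ≤ m) {k l j : ℕ} (hl : l = 1 ∨ l = 2)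
    (hj : j < H (m + k + 1) l) : desc (H m) (Wd m (k + 1) l) j =
      desc (H m) (Wd m k (desc (H (m + k)) (topword (m + k) l) j).1)
        (desc (H (m + k)) (topword (m + k) l) j).2 := by
  rw [Wd]
  refine desc_flatMap (fun c hc => hsum_Wd hm k (mem_topword hl hc)) ?_
  rwa [← H_succ (by omega)]

/-- The transverse height of a whole tower of level `m + k`, relative to the towers of level `m`. -/
theorem v_mul_lsum_Wd {m : ℕ} (hm : 1 ≤ m) (k : ℕ) {l : ℕ} (hl : l = 1 ∨ l = 2) :
    v m * lsum (Wd m k l) = v (m + k) * ell l := by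
  induction k generalizing l with
  | zero => simp [Wd]
  | succ k ih =>
    have hflat : ∀ w : List ℕ, (∀ c ∈ w, c = 1 ∨ c = 2) →
        v m * lsum (w.flatMap (Wd m k)) = v (m + k) * lsum w := by
      intro w hw
      induction w with
      | nil => simp
      | cons c w ihw =>
        rw [List.flatMap_cons, lsum_append, lsum_cons, mul_add, mul_add,
          ihw (fun d hd => hw d (by simp [hd])), ih (hw c (by simp))]
    rw [Wd, hflat _ fun c hc => mem_topword hl hc, lsum_topword (by omega) hl, add_assoc]

theorem Wd_prefix {m k k' : ℕ} (hk : k ≤ k') : Wd m k 1 <+: Wd m k' 1 := by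
  induction k', hk using Nat.le_induction with
  | base => exact List.prefix_rfl
  | succ k' _ ih =>
    obtain ⟨w, hw⟩ := topword_one_eq (m + k')
    refine ih.trans ?_
    rw [Wd, hw, List.flatMap_cons]
    exact List.prefix_append _ _

theorem lt_length_Wd (m k : ℕ) : k < (Wd m k 1).length := by
  induction k with
  | zero => simp [Wd]
  | succ k ih =>
    obtain ⟨w, hw⟩ := topword_one_eq (m + k)
    rw [Wd, hw, List.flatMap_cons, List.flatMap_cons, List.length_append, List.length_append]
    omega

/-- A prefix of the word of tower `1` that collects the transverse heights of all levels. -/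
theorem exists_prefix_lsum {m : ℕ} (hm : 1 ≤ m) (k : ℕ) : ∃ q, q <+: Wd m k 1 ∧
    v m * lsum q = ∑ i ∈ Finset.range k, v (m + i) := by
  induction k with
  | zero => exact ⟨[], by simp, by simp⟩
  | succ k ih =>
    obtain ⟨q, hq, hs⟩ := ih
    obtain ⟨w, hw⟩ := topword_one_eq (m + k)
    refine ⟨Wd m k 1 ++ q, ?_, ?_⟩
    · rw [Wd, hw, List.flatMap_cons, List.flatMap_cons, List.prefix_append_right_inj]
      exact hq.trans (List.prefix_append _ _)
    · rw [lsum_append, mul_add, v_mul_lsum_Wd hm k (Or.inl rfl), hs, Finset.sum_range_succ]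
      simp; ring

/-- If all factors of length `L` have transverse height at least `1`, the transverse height of the
word grows with its length. -/
theorem le_lsum_of_factors {L : ℕ} (hL : 0 < L) (w : List ℕ)
    (hw : ∀ i, i + L ≤ w.length → 1 ≤ lsum ((w.drop i).take L)) :
    (w.length : ℝ) / L - 1 - 2 * L ≤ lsum w := by
  have hL' : (0 : ℝ) < L := by exact_mod_cast hL
  induction hn : w.length using Nat.strong_induction_on generalizing w with
  | _ n ih =>
    subst hn
    by_cases hlt : w.length < L
    · have h1 := (abs_le.1 (abs_lsum_le w)).1
      have h2 : (w.length : ℝ) < L := by exact_mod_cast hlt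
      have h3 : (w.length : ℝ) / L ≤ 1 := by rw [div_le_one hL']; exact h2.le
      linarith
    · push Not at hlt
      have h1 := ih (w.length - L) (by omega) (w.drop L) (fun i hi => by
        rw [List.drop_drop]
        exact hw (L + i) (by rw [List.length_drop] at hi; omega)) (by simp)
      have h2 := hw 0 (by omega)
      have h3 : lsum w = lsum (w.take L) + lsum (w.drop L) := by
        rw [← lsum_append, List.take_append_drop]
      rw [List.drop_zero] at h2
      rw [Nat.cast_sub hlt, sub_div, div_self hL'.ne'] at h1
      linarith

/-- In a word of given length the transverse height is a measure of the number of letters `2`. -/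
theorem lsum_eq_length_sub {w : List ℕ} (hw : ∀ c ∈ w, c = 1 ∨ c = 2) :
    lsum w = w.length - (φ + 1) * w.count 2 := by
  induction w with
  | nil => simp
  | cons c w ih =>
    rw [lsum_cons, ih fun d hd => hw d (by simp [hd])]
    rcases hw c (by simp) with rfl | rfl
    · simp; ring
    · simp; ring

theorem hsum_eq_count {h : ℕ → ℕ} {w : List ℕ} (hw : ∀ c ∈ w, c = 1 ∨ c = 2) :
    (hsum h w : ℤ) = (w.length - w.count 2) * h 1 + w.count 2 * h 2 := by
  induction w with
  | nil => simp
  | cons c w ih =>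
    rw [hsum_cons, Nat.cast_add, ih fun d hd => hw d (by simp [hd])]
    rcases hw c (by simp) with rfl | rfl
    · simp; ring
    · simp; ring

/-- A discrete intermediate value theorem. -/
theorem exists_eq_of_step_le_one {f : ℕ → ℤ} (hf : ∀ i, |f (i + 1) - f i| ≤ 1) {a b : ℕ} {t : ℤ}
    (ha : f a ≤ t) (hb : t ≤ f b) : ∃ i, i ≤ max a b ∧ f i = t := by
  have key : ∀ g : ℕ → ℤ, (∀ i, |g (i + 1) - g i| ≤ 1) → ∀ d a t, g a ≤ t → t ≤ g (a + d) →
      ∃ i, i ≤ a + d ∧ g i = t := by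
    intro g hg d
    induction d with
    | zero => intro a t h1 h2; exact ⟨a, le_rfl, le_antisymm h1 h2⟩
    | succ d ih =>
      intro a t h1 h2
      rcases h1.eq_or_lt with h | h
      · exact ⟨a, by omega, h⟩
      · have := abs_le.1 (hg a)
        obtain ⟨i, hi, h3⟩ := ih (a + 1) t (by omega) (by rwa [show a + 1 + d = a + (d + 1) by ring])
        exact ⟨i, by omega, h3⟩
  rcases le_total a b with hab | hab
  · obtain ⟨i, hi, h⟩ := key f hf (b - a) a t ha (by rwa [Nat.add_sub_cancel' hab])
    exact ⟨i, by omega, h⟩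
  · obtain ⟨i, hi, h⟩ := key (fun i => - f i) (fun i => by
      have := abs_le.1 (hf i)
      exact abs_le.2 (by constructor <;> omega)) (a - b) b (-t) (by simpa using hb)
      (by rw [Nat.add_sub_cancel' hab]; simpa using ha)
    exact ⟨i, by omega, by simpa using h⟩

/-- If the counts `c (i + L) - c i` of a letter in windows of length `L` vary enough, then all
small corrections of the count occur between windows of lengths `L` and `L + K`. -/
theorem exists_windows {c : ℕ → ℤ} (hc : ∀ i, c i ≤ c (i + 1) ∧ c (i + 1) ≤ c i + 1) {N L K i₀ i₁ : ℕ}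
    {y : ℤ} (h0 : i₀ + L ≤ N) (h1 : i₁ + L ≤ N) (hN : L + K ≤ N)
    (hgap : (c (i₀ + L) - c i₀) + K + 2 * |y| ≤ c (i₁ + L) - c i₁) :
    ∃ i j, i + L ≤ N ∧ j + (L + K) ≤ N ∧ c (j + (L + K)) - c j = c (i + L) - c i + y := by
  have hmono : ∀ i d, c i ≤ c (i + d) ∧ c (i + d) ≤ c i + d := by
    intro i d
    induction d with
    | zero => simp
    | succ d ih =>
      have := hc (i + d)
      rw [← add_assoc]
      push_cast
      omega
  have hstep : ∀ M i, |(c (i + 1 + M) - c (i + 1)) - (c (i + M) - c i)| ≤ 1 := by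
    intro M i
    have e1 := hc i
    have e2 := hc (i + M)
    rw [show i + 1 + M = i + M + 1 by ring, abs_le]
    constructor <;> omega
  have hy := neg_abs_le y
  have hy' := le_abs_self y
  obtain ⟨i, hi, hfi⟩ := exists_eq_of_step_le_one (f := fun i => c (i + L) - c i) (hstep L)
    (a := i₀) (b := i₁) (t := c (i₀ + L) - c i₀ + K + |y|) (by omega) (by omega)
  -- Any window of length `L` lies in a window of length `L + K`.
  have hext : ∀ i, i + L ≤ N → ∃ j, j + (L + K) ≤ N ∧
      c (i + L) - c i ≤ c (j + (L + K)) - c j ∧ c (j + (L + K)) - c j ≤ c (i + L) - c i + K := by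
    intro i hi
    obtain ⟨j, d, e, h2, h3, h4, h5⟩ : ∃ j d e, j + (L + K) ≤ N ∧ i = j + d ∧
        j + (L + K) = i + L + e ∧ d + e = K := by
      rcases le_total i (N - (L + K)) with h | h
      · exact ⟨i, 0, K, by omega, by omega, by omega, by omega⟩
      · exact ⟨N - (L + K), i - (N - (L + K)), N - (i + L), by omega, by omega, by omega, by omega⟩
    refine ⟨j, h2, ?_⟩
    have e1 := hmono j d
    have e2 := hmono (i + L) e
    rw [← h3] at e1
    rw [← h4] at e2
    omega
  obtain ⟨j₀, hj₀, -, h2⟩ := hext i₀ h0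
  obtain ⟨j₁, hj₁, h3, -⟩ := hext i₁ h1
  obtain ⟨j, hj, hfj⟩ := exists_eq_of_step_le_one (f := fun i => c (i + (L + K)) - c i)
    (hstep (L + K)) (a := j₀) (b := j₁) (t := c (i₀ + L) - c i₀ + K + |y| + y)
    (by omega) (by omega)
  exact ⟨i, j, by omega, by omega, by omega⟩

namespace IsExampleSequence

variable {X : Type u} [TopologicalSpace X] {T : X ≃ₜ X}
  {P : ℕ → CKRPartition T} (hP : IsExampleSequence P)
include hP

/-- The address of level `m` read off from the word of a tower of level `m + k`. -/
theorem addr_Wd {m : ℕ} (hm : 1 ≤ m) (k : ℕ) (x : X) : addr P m x =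
    desc (H m) (Wd m k (addr P (m + k) x).1) (addr P (m + k) x).2 := by
  induction k with
  | zero => simp [Wd, desc, hP.addr_lt hm x]
  | succ k ih =>
    rw [ih, hP.addr_desc (by omega) x, ← add_assoc,
      desc_Wd_succ hm (hP.addr_fst (by omega) x) (hP.addr_lt (by omega) x)]

/-- The roofs of all levels have two return times that differ by `1`. The heights `h₁, h₂` of the level
are coprime, so `y₁ h₁ + y₂ h₂ = ±1` with integers of sum `K ≥ 0`. Prefixes of the tower words reach
arbitrarily large transverse heights, since the sum of `v` diverges, while the transverse heights of
whole towers are bounded. Hence the number of letters `2` in windows of a fixed length `L` varies as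
much as desired, and there are windows of lengths `L` and `L + K` whose letter counts differ by exactly
`(y₁, y₂)`. -/
theorem exists_consecutive_return {m : ℕ} (hm : 1 ≤ m) : ∃ q : ℕ, ∃ x ∈ (P m).roof,
    ∃ y ∈ (P m).roof, T^[q + 1] x ∈ (P m).roof ∧ T^[q] y ∈ (P m).roof := by
  obtain ⟨y₁, y₂, K, s, hs, hK, hbez⟩ : ∃ (y₁ y₂ : ℤ) (K : ℕ) (s : ℤ), (s = 1 ∨ s = -1) ∧
      y₁ + y₂ = K ∧ y₁ * H m 1 + y₂ * H m 2 = s := by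
    obtain ⟨a, b, hab⟩ := Nat.isCoprime_iff_coprime.2 (H_coprime hm)
    rcases le_total 0 (a + b) with h | h
    · exact ⟨a, b, (a + b).toNat, 1, by simp, by omega, hab⟩
    · exact ⟨-a, -b, (-(a + b)).toNat, -1, by simp, by omega, by linear_combination -hab⟩
  have hv := v_pos hm
  have hg := phi_gt
  have hl := phi_lt
  obtain ⟨k, hk⟩ := exists_sum_v_gt m hm (v m * (1 + (φ + 1) * (K + 2 * |y₂|)))
  obtain ⟨q, hq, hqs⟩ := exists_prefix_lsum hm k
  rw [← hqs, mul_lt_mul_iff_right₀ hv] at hk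
  set L := q.length with hL
  have hL0 : 0 < L := by
    rw [hL, List.length_pos_iff]
    rintro rfl
    rw [lsum_nil] at hk
    have : (0 : ℝ) ≤ |(y₂ : ℝ)| := abs_nonneg _
    have : (0 : ℝ) ≤ (φ + 1) * (K + 2 * |(y₂ : ℝ)|) := by positivity
    push_cast at hk
    linarith
  have hL' : (0 : ℝ) < L := by exact_mod_cast hL0
  -- Level `m + k₁` is so high that a tower word in which all windows have transverse height at least `1`
  -- would contradict the bound for its total transverse height.
  obtain ⟨k₁, hk₁⟩ := exists_nat_gt (L * (4 / v m + 1 + 2 * L) + (L + K + k : ℕ))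
  have hk₁' : L + K + k < k₁ := by
    have : 0 ≤ L * (4 / v m + 1 + 2 * L) := by positivity
    exact_mod_cast (by linarith : ((L + K + k : ℕ) : ℝ) < k₁)
  set W := Wd m k₁ 1 with hW
  have hN : k₁ < W.length := lt_length_Wd m k₁
  have hmem : ∀ c ∈ W, c = 1 ∨ c = 2 := fun c hc => mem_Wd (Or.inl rfl) hc
  set c : ℕ → ℤ := fun i => ((W.take i).count 2 : ℤ) with hc
  have hcstep : ∀ i, c i ≤ c (i + 1) ∧ c (i + 1) ≤ c i + 1 := by
    intro i
    simp only [hc, List.take_add_one, List.count_append]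
    have : (W[i]?.toList).count 2 ≤ 1 := List.count_le_length.trans (by cases W[i]? <;> simp)
    omega
  have hwin : ∀ i, i + L ≤ W.length →
      lsum ((W.drop i).take L) = L - (φ + 1) * ((c (i + L) - c i : ℤ) : ℝ) := by
    intro i hi
    have h1 : c (i + L) - c i = ((W.drop i).take L).count 2 := by
      simp only [hc, List.take_add, List.count_append]
      omega
    rw [h1, lsum_eq_length_sub fun a ha => hmem a (List.mem_of_mem_drop (List.mem_of_mem_take ha)),
      List.length_take, List.length_drop, min_eq_left (by omega)]
    simp
  have h0 : lsum ((W.drop 0).take L) = lsum q := by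
    have := List.prefix_iff_eq_take.1 (hq.trans (Wd_prefix (by omega : k ≤ k₁)))
    rw [List.drop_zero, this]
  obtain ⟨i₁, hi₁, hlow⟩ : ∃ i, i + L ≤ W.length ∧ lsum ((W.drop i).take L) < 1 := by
    by_contra hcon
    push Not at hcon
    have h1 := le_lsum_of_factors hL0 W hcon
    have h2 := v_mul_lsum_Wd hm k₁ (l := 1) (Or.inl rfl)
    have h3 : v (m + k₁) ≤ 4 := (v_le (by omega)).trans
      (div_le_self (by norm_num) (by exact_mod_cast (by omega : 1 ≤ m + k₁)))
    have h4 : lsum W ≤ 4 / v m := by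
      rw [le_div_iff₀ hv, mul_comm, h2, ell_one]; linarith
    have h5 : (W.length : ℝ) / L ≤ 4 / v m + 1 + 2 * L := by linarith
    rw [div_le_iff₀ hL'] at h5
    have h6 : (k₁ : ℝ) < W.length := by exact_mod_cast hN
    have h7 : (0 : ℝ) ≤ (L + K + k : ℕ) := Nat.cast_nonneg _
    linarith
  have hgap : (c (0 + L) - c 0) + K + 2 * |y₂| ≤ c (i₁ + L) - c i₁ := by
    rw [hwin 0 (by omega)] at h0
    rw [hwin i₁ hi₁] at hlow
    have h1 : (φ + 1) * ((c (0 + L) - c 0 : ℤ) + K + 2 * |(y₂ : ℝ)|) ≤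
        (φ + 1) * ((c (i₁ + L) - c i₁ : ℤ) : ℝ) := by
      push_cast at hk hlow h0 ⊢
      linarith
    exact_mod_cast le_of_mul_le_mul_left h1 (by linarith)
  obtain ⟨i, j, hi, hj, hij⟩ := exists_windows hcstep (by omega) hi₁ (by omega) hgap
  -- The points of the roof at the tops of the towers of level `m` below a given point.
  obtain ⟨Y, hY⟩ := hP.nonempty_B (n := m + (k₁ + 1)) (k := 1) (by omega) (by simp)
  have hpt : ∀ i ≤ W.length, ∃ x ∈ (P m).roof, T^[hsum (H m) (W.take i)] x = Y := by
    intro i hi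
    obtain ⟨x, hx⟩ := T.surjective.iterate (hsum (H m) (W.take i)) Y
    refine ⟨x, ?_, hx⟩
    obtain ⟨w, hw⟩ := topword_one_eq (m + k₁)
    obtain ⟨a, u, hu⟩ : ∃ a u, Wd m (k₁ + 1) 1 = W.take i ++ a :: u := by
      obtain ⟨b, u, hb⟩ := List.exists_cons_of_length_pos (l := W) (by omega)
      rw [Wd, hw, List.flatMap_cons, List.flatMap_cons, ← hW]
      rcases hd : W.drop i with _ | ⟨a, u'⟩
      · refine ⟨b, u ++ w.flatMap (Wd m k₁), ?_⟩
        have := List.take_append_drop i W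
        rw [hd, List.append_nil] at this
        rw [this]
        nth_rewrite 2 [hb]
        rfl
      · refine ⟨a, u' ++ (W ++ w.flatMap (Wd m k₁)), ?_⟩
        nth_rewrite 1 [← List.take_append_drop i W]
        rw [hd, List.append_assoc, List.cons_append]
    have ha : a = 1 ∨ a = 2 := mem_Wd (m := m) (k := k₁ + 1) (l := 1) (Or.inl rfl) (by simp [hu])
    have hHa := H_pos hm ha
    have hlt : hsum (H m) (W.take i) < H (m + (k₁ + 1)) 1 := by
      rw [← hsum_Wd hm (k₁ + 1) (Or.inl rfl), hu, hsum_append, hsum_cons]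
      omega
    have h1 : addr P (m + (k₁ + 1)) x = (1, hsum (H m) (W.take i)) :=
      (hP.addr_eq_iff (by omega) (by simp) hlt x).2 (by rwa [hx])
    have h2 := hP.addr_Wd hm (k₁ + 1) x
    have h3 := desc_cell (w := W.take i) (w' := u) hHa
    rw [h1, hu] at h2
    simp only at h2
    rw [add_zero] at h3
    rw [h3, hP.addr_eq_iff hm ha hHa] at h2
    exact (P m).mem_roof.2 ⟨a, (hP.mem_Icc hm).2 ha, h2⟩
  have hret : ∀ i d, i + d ≤ W.length → ∃ x ∈ (P m).roof, ∃ e : ℕ, T^[e] x ∈ (P m).roof ∧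
      (e : ℤ) = (d - (c (i + d) - c i)) * H m 1 + (c (i + d) - c i) * H m 2 := by
    intro i d hid
    obtain ⟨x, hx, hx'⟩ := hpt (i + d) hid
    obtain ⟨z, hz, hz'⟩ := hpt i (by omega)
    have hmem' : ∀ u : List ℕ, (∀ a ∈ u, a ∈ W) → ∀ a ∈ u, a = 1 ∨ a = 2 :=
      fun u hu a ha => hmem a (hu a ha)
    refine ⟨x, hx, hsum (H m) ((W.drop i).take d), ?_, ?_⟩
    · have : T^[hsum (H m) ((W.drop i).take d)] x = z := by
        apply T.injective.iterate (hsum (H m) (W.take i))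
        rw [← Function.iterate_add_apply, hz', ← hx', List.take_add, hsum_append]
      rwa [this]
    · rw [hsum_eq_count fun a ha => hmem a (List.mem_of_mem_drop (List.mem_of_mem_take ha)),
        List.length_take, List.length_drop, min_eq_left (by omega)]
      have h1 : c (i + d) - c i = ((W.drop i).take d).count 2 := by
        simp only [hc, List.take_add, List.count_append]
        omega
      rw [h1]
  obtain ⟨x, hx, e, hxe, he⟩ := hret i L hi
  obtain ⟨x', hx', e', hxe', he'⟩ := hret j (L + K) hj
  have hee : (e' : ℤ) = e + s := by
    rw [he, he', hij, ← hbez]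
    push_cast
    linear_combination (-(H m 1 : ℤ)) * hK
  rcases hs with rfl | rfl
  · have : e' = e + 1 := by omega
    exact ⟨e, x', hx', x, hx, this ▸ hxe', hxe⟩
  · have : e = e' + 1 := by omega
    exact ⟨e', x, hx, x', hx', this ▸ hxe, hxe'⟩

/-- The roofs of high levels are small with respect to any continuous map. -/
theorem exists_roof_dist_lt [CompactSpace X] {E : Type*} [PseudoMetricSpace E] {f : X → E}
    (hf : Continuous f) {ε : ℝ} (hε : 0 < ε) :
    ∃ m ≥ 1, ∀ x ∈ (P m).roof, ∀ y ∈ (P m).roof, dist (f x) (f y) < ε := by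
  obtain ⟨n, hn, h⟩ := hP.exists_addr_dist_lt hf hε
  have h1 : ∀ x ∈ (P (n + 1)).roof, addr P n x = (1, 0) := fun x hx =>
    (hP.addr_eq_iff hn (by simp) (H_pos hn (by simp)) x).2 (hP.nested.roof_subset_first n hx)
  exact ⟨n + 1, by omega, fun x hx y hy => h n le_rfl x y ((h1 x hx).trans (h1 y hy).symm)⟩

end IsExampleSequence

/-! ### Continuous eigenvalues and equicontinuous factors -/

section

variable {X : Type u} [TopologicalSpace X] {T : X ≃ₜ X} {P : ℕ → CKRPartition T}

/-- A continuous eigenfunction of a minimal system has constant modulus. -/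
theorem norm_continuous_eigenfunction (hT : IsMinimalCantorSystem T) {f : X → ℂ} (hf : Continuous f)
    (hf0 : f ≠ 0) {lam : ℂ} (heq : ∀ x, f (T x) = lam * f x) :
    ‖lam‖ = 1 ∧ ∃ M > 0, ∀ x, ‖f x‖ = M := by
  have := hT.compact
  have := hT.nonempty
  obtain ⟨x₀, -, hmax⟩ := isCompact_univ.exists_isMaxOn univ_nonempty hf.norm.continuousOn
  have hmax' : ∀ x, ‖f x‖ ≤ ‖f x₀‖ := fun x => hmax (mem_univ x)
  obtain ⟨x₁, hx₁⟩ := Function.ne_iff.1 hf0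
  have hM : 0 < ‖f x₀‖ := (norm_pos_iff.2 hx₁).trans_le (hmax' x₁)
  have h1 : ‖lam‖ = 1 := by
    refine le_antisymm ?_ ?_
    · have := hmax' (T x₀)
      rw [heq, norm_mul] at this
      exact le_of_mul_le_mul_right (by linarith) hM
    · obtain ⟨y, hy⟩ := T.surjective x₀
      have h2 := heq y
      have h3 := hmax' y
      rw [hy] at h2
      rw [h2, norm_mul] at h3 hM
      have hy0 : 0 < ‖f y‖ := by
        by_contra hc
        have : ‖f y‖ = 0 := le_antisymm (not_lt.1 hc) (norm_nonneg _)
        rw [this, mul_zero] at hM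
        exact lt_irrefl _ hM
      exact le_of_mul_le_mul_right (by linarith) hy0
  refine ⟨h1, _, hM, fun x => ?_⟩
  have hinv : ∀ x, ‖f (T x)‖ = ‖f x‖ := fun x => by rw [heq, norm_mul, h1, one_mul]
  have hpow : ∀ n : ℤ, ∀ x, ‖f ((T ^ n) x)‖ = ‖f x‖ := by
    intro n
    induction n with
    | zero => simp
    | succ n ih =>
      intro x
      rw [zpow_add_one, Homeomorph.mul_apply, ih, hinv]
    | pred n ih =>
      intro x
      rw [zpow_sub_one, Homeomorph.mul_apply, ih, ← hinv (T⁻¹ x), ← Homeomorph.mul_apply,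
        mul_inv_cancel]
      rfl
  have hcl : IsClosed {x | ‖f x‖ = ‖f x₀‖} := isClosed_eq hf.norm continuous_const
  have hd := hT.minimal x₀
  have : closure (range fun n : ℤ => (T ^ n) x₀) ⊆ {x | ‖f x‖ = ‖f x₀‖} := by
    refine closure_minimal ?_ hcl
    rintro _ ⟨n, rfl⟩
    exact hpow n x₀
  exact this (hd x)

/-- A factor of a minimal system that contains a fixed point is trivial. -/
theorem eq_of_map_fixed (hT : IsMinimalCantorSystem T) {Z : Type*} [MetricSpace Z] {R : Z ≃ₜ Z}
    {ρ : X → Z} (hρ : Continuous ρ) (hcomm : ∀ x, ρ (T x) = R (ρ x)) {x₀ : X}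
    (hfix : R (ρ x₀) = ρ x₀) (x : X) : ρ x = ρ x₀ := by
  have hiff : ∀ x, ρ (T x) = ρ x₀ ↔ ρ x = ρ x₀ := fun x => by
    rw [hcomm]
    conv_lhs => rw [← hfix]
    exact R.injective.eq_iff
  have hpow : ∀ n : ℤ, ∀ x, ρ ((T ^ n) x) = ρ x₀ ↔ ρ x = ρ x₀ := by
    intro n
    induction n with
    | zero => simp
    | succ n ih =>
      intro x
      rw [zpow_add_one, Homeomorph.mul_apply, ih, hiff]
    | pred n ih =>
      intro x
      rw [zpow_sub_one, Homeomorph.mul_apply, ih, ← hiff (T⁻¹ x), ← Homeomorph.mul_apply,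
        mul_inv_cancel]
      rfl
  have hcl : IsClosed {x | ρ x = ρ x₀} := isClosed_eq hρ continuous_const
  have : closure (range fun n : ℤ => (T ^ n) x₀) ⊆ {x | ρ x = ρ x₀} := by
    refine closure_minimal ?_ hcl
    rintro _ ⟨n, rfl⟩
    exact (hpow n x₀).2 rfl
  exact this (hT.minimal x₀ x)

namespace IsExampleSequence

variable (hP : IsExampleSequence P)
include hP

theorem isContinuousEigenvalue_iff (hT : IsMinimalCantorSystem T) (lam : ℂ) :
    IsContinuousEigenvalue T lam ↔ lam = 1 := by
  have := hT.compact
  constructor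
  · rintro ⟨f, hf, hf0, heq⟩
    obtain ⟨hlam, M, hM, hfM⟩ := norm_continuous_eigenfunction hT hf hf0 heq
    have hpow : ∀ n x, f (T^[n] x) = lam ^ n * f x := by
      intro n
      induction n with
      | zero => simp
      | succ n ih =>
        intro x
        rw [Function.iterate_succ_apply, ih, heq]; ring
    have hret : ∀ ε > 0, ‖lam - 1‖ * M ≤ 2 * ε := by
      intro ε hε
      obtain ⟨m, hm, hclose⟩ := hP.exists_roof_dist_lt hf hε
      obtain ⟨q, x, hx, y, hy, hx', hy'⟩ := hP.exists_consecutive_return hm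
      have key : ∀ n x, x ∈ (P m).roof → T^[n] x ∈ (P m).roof → ‖lam ^ n - 1‖ * M ≤ ε := by
        intro n x hx hx'
        have := (hclose _ hx' _ hx).le
        rwa [dist_eq_norm, hpow, ← sub_one_mul, norm_mul, hfM] at this
      have h1 := key _ x hx hx'
      have h2 := key _ y hy hy'
      have h3 : ‖lam - 1‖ ≤ ‖lam ^ (q + 1) - 1‖ + ‖lam ^ q - 1‖ := by
        have : ‖lam ^ q * (lam - 1)‖ = ‖lam - 1‖ := by
          rw [norm_mul, norm_pow, hlam, one_pow, one_mul]
        rw [← this, show lam ^ q * (lam - 1) = (lam ^ (q + 1) - 1) - (lam ^ q - 1) by ring]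
        exact norm_sub_le _ _
      nlinarith
    have h0 : ‖lam - 1‖ * M ≤ 0 := le_of_forall_pos_le_add fun ε hε => by
      linarith [hret (ε / 2) (by positivity)]
    have h1 : ‖lam - 1‖ = 0 := by
      nlinarith [norm_nonneg (lam - 1)]
    exact sub_eq_zero.1 (norm_eq_zero.1 h1)
  · rintro rfl
    obtain ⟨x⟩ := hT.nonempty
    exact ⟨fun _ => 1, continuous_const, fun h => one_ne_zero (congrFun h x), by simp⟩

/-- The image of the common point of all roofs is a fixed point in every equicontinuous factor: return
times `q` and `q + 1` to a small roof move it little, so its image under one step is close to it. -/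
theorem map_fixed [CompactSpace X] {Z : Type*} [MetricSpace Z] {R : Z ≃ₜ Z} {ρ : X → Z}
    (hρ : Continuous ρ) (hcomm : ∀ x, ρ (T x) = R (ρ x)) (hR : IsEquicontinuousSystem R)
    {x₀ : X} (hx₀ : ∀ n, x₀ ∈ (P n).roof) : R (ρ x₀) = ρ x₀ := by
  have hpow : ∀ n x, ρ (T^[n] x) = (R ^ (n : ℤ)) (ρ x) := by
    intro n
    induction n with
    | zero => simp
    | succ n ih =>
      intro x
      rw [Function.iterate_succ_apply, ih, hcomm, Nat.cast_succ, zpow_add_one, Homeomorph.mul_apply]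
  rw [← dist_le_zero]
  refine le_of_forall_pos_le_add fun ε hε => ?_
  obtain ⟨δ, hδ, hRδ⟩ := Metric.equicontinuousAt_iff.1 (hR (ρ x₀)) (ε / 4) (by positivity)
  obtain ⟨δ', hδ', hRδ'⟩ := Metric.equicontinuousAt_iff.1 (hR (ρ x₀)) (δ / 2) (by positivity)
  obtain ⟨m, hm, hclose⟩ := hP.exists_roof_dist_lt hρ
    (show 0 < min (min δ δ') (min (ε / 4) (δ / 2)) by positivity)
  have hclose' : ∀ x ∈ (P m).roof, dist (ρ x) (ρ x₀) < min (min δ δ') (min (ε / 4) (δ / 2)) :=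
    fun x hx => hclose x hx x₀ (hx₀ m)
  simp only [lt_min_iff] at hclose'
  obtain ⟨q, x, hx, y, hy, hx', hy'⟩ := hP.exists_consecutive_return hm
  have h1 := hRδ _ (hclose' x hx).1.1 ((q + 1 : ℕ) : ℤ)
  have h2 := hRδ' _ (hclose' y hy).1.2 (q : ℤ)
  have h3 := (hclose' _ hx').2.1
  have h4 := (hclose' _ hy').2.2
  rw [hpow] at h3 h4
  have h5 : dist ((R ^ (q : ℤ)) (ρ x₀)) (ρ x₀) < δ :=
    (dist_triangle _ _ _).trans_lt (by linarith)
  have h6 := hRδ _ h5 1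
  rw [zpow_one, ← Homeomorph.mul_apply, ← zpow_one_add, add_comm] at h6
  have h7 : ((q + 1 : ℕ) : ℤ) = (q : ℤ) + 1 := by push_cast; ring
  rw [h7] at h1 h3
  have h8 := dist_triangle (R (ρ x₀)) ((R ^ ((q : ℤ) + 1)) (ρ x₀)) (ρ x₀)
  have h9 := dist_triangle ((R ^ ((q : ℤ) + 1)) (ρ x₀)) ((R ^ ((q : ℤ) + 1)) (ρ x)) (ρ x₀)
  linarith

theorem isMaximalEquicontinuousFactor (hT : IsMinimalCantorSystem T) :
    IsMaximalEquicontinuousFactor T (Homeomorph.refl PUnit.{u + 1}) (fun _ => PUnit.unit) := by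
  have := hT.compact
  obtain ⟨x₀, hx₀⟩ := hP.nested.roof_inter
  have hx₀' : ∀ n, x₀ ∈ (P n).roof := mem_iInter.1 (hx₀.symm ▸ mem_singleton x₀)
  refine ⟨⟨continuous_const, fun y => ⟨x₀, rfl⟩, fun _ => rfl⟩, ?_, ?_⟩
  · intro y U hU
    exact Filter.Eventually.of_forall fun y' n => by
      rw [Subsingleton.elim y y']
      exact refl_mem_uniformity hU
  · intro Z _ _ R ρ hρ hR
    have hfix := hP.map_fixed hρ.continuous hρ.comm hR hx₀'
    have hconst := eq_of_map_fixed hT hρ.continuous hρ.comm hfix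
    refine ⟨fun _ => ρ x₀, ⟨continuous_const, fun z => ?_, fun _ => hfix.symm⟩, ?_⟩
    · obtain ⟨x, rfl⟩ := hρ.surjective z
      exact ⟨PUnit.unit, (hconst x).symm⟩
    · funext x
      exact hconst x

end IsExampleSequence

end

/-! ### The Kronecker factor of an ergodic system -/

theorem tendsto_eLpNorm_two_of_dominated {X : Type*} [MeasurableSpace X] {μ : Measure X}
    {f : ℕ → X → ℂ} {G : X → ℝ} (hf : ∀ n, AEStronglyMeasurable (f n) μ) (hG : MemLp G 2 μ)
    (hb : ∀ n, ∀ᵐ x ∂μ, ‖f n x‖ ≤ G x) (hlim : ∀ᵐ x ∂μ, Tendsto (fun n => f n x) atTop (𝓝 0)) :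
    Tendsto (fun n => eLpNorm (f n) 2 μ) atTop (𝓝 0) := by
  have h1 : ∀ n, eLpNorm (f n) 2 μ = (∫⁻ x, ‖f n x‖ₑ ^ (2 : ℝ) ∂μ) ^ (1 / 2 : ℝ) := fun n => by
    rw [eLpNorm_eq_lintegral_rpow_enorm_toReal (by norm_num) (by norm_num)]
    norm_num
  have h2 : Tendsto (fun n => ∫⁻ x, ‖f n x‖ₑ ^ (2 : ℝ) ∂μ) atTop (𝓝 (∫⁻ _, 0 ∂μ)) := by
    refine tendsto_lintegral_of_dominated_convergence' (fun x => ‖G x‖ₑ ^ (2 : ℝ))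
      (fun n => (hf n).enorm.pow_const _) (fun n => ?_) ?_ ?_
    · filter_upwards [hb n] with x hx
      have : ‖f n x‖ₑ ≤ ‖G x‖ₑ :=
        enorm_le_iff_norm_le.2 (hx.trans (le_abs_self _))
      gcongr
    · have := (eLpNorm_lt_top_iff_lintegral_rpow_enorm_lt_top (p := 2) (f := G) (μ := μ)
        (by norm_num) (by norm_num)).1 hG.2
      simpa using this.ne
    · filter_upwards [hlim] with x hx
      have h3 : Tendsto (fun n => ‖f n x‖ₑ) atTop (𝓝 0) := by
        simpa [Function.comp_def] using (continuous_enorm.tendsto (0 : ℂ)).comp hx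
      have h4 := (ENNReal.continuous_rpow_const (y := 2)).tendsto 0
      rw [ENNReal.zero_rpow_of_pos (by norm_num)] at h4
      exact h4.comp h3
  simp_rw [h1]
  rw [lintegral_zero] at h2
  have h4 := (ENNReal.continuous_rpow_const (y := (1 / 2 : ℝ))).tendsto 0
  rw [ENNReal.zero_rpow_of_pos (by norm_num)] at h4
  exact h4.comp h2

section Kronecker

variable {X : Type u} [TopologicalSpace X] [m0 : MeasurableSpace X] [BorelSpace X] {T : X ≃ₜ X}
  {μ : Measure X}

/-- The closed linear span of the eigenfunctions in `L²(μ)`. -/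
noncomputable def eigenspan (T : X ≃ₜ X) (μ : Measure X) : Submodule ℂ (Lp ℂ 2 μ) :=
  (Submodule.span ℂ (eigenfunctions T μ)).topologicalClosure

/-- The class of the function `f` belongs to the closed linear span of the eigenfunctions. -/
def InEigenspan (T : X ≃ₜ X) (μ : Measure X) (f : X → ℂ) : Prop :=
  ∃ hf : MemLp f 2 μ, hf.toLp f ∈ eigenspan T μ

/-- `f` is an eigenfunction of the measure preserving system or zero. -/
def IsEigenfunction (T : X ≃ₜ X) (μ : Measure X) (f : X → ℂ) : Prop :=
  MemLp f 2 μ ∧ ∃ lam : ℂ, (fun x => f (T x)) =ᵐ[μ] fun x => lam * f x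

namespace InEigenspan

variable {f g : X → ℂ}

omit [BorelSpace X]

theorem congr (hf : InEigenspan T μ f) (h : f =ᵐ[μ] g) : InEigenspan T μ g := by
  obtain ⟨h1, h2⟩ := hf
  exact ⟨h1.ae_eq h, by rwa [← MemLp.toLp_congr h1 (h1.ae_eq h) h]⟩

theorem add (hf : InEigenspan T μ f) (hg : InEigenspan T μ g) :
    InEigenspan T μ fun x => f x + g x := by
  obtain ⟨h1, h2⟩ := hf
  obtain ⟨h3, h4⟩ := hg
  exact ⟨h1.add h3, by rw [show (h1.add h3).toLp (fun x => f x + g x) = _ from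
    MemLp.toLp_add h1 h3]; exact add_mem h2 h4⟩

theorem const_mul (hf : InEigenspan T μ f) (c : ℂ) : InEigenspan T μ fun x => c * f x := by
  obtain ⟨h1, h2⟩ := hf
  exact ⟨h1.const_smul c, by rw [show (h1.const_smul c).toLp (fun x => c * f x) = _ from
    MemLp.toLp_const_smul c h1]; exact Submodule.smul_mem _ _ h2⟩

theorem of_tendsto {F : ℕ → X → ℂ} (hF : ∀ n, InEigenspan T μ (F n)) (hf : MemLp f 2 μ)
    (h : Tendsto (fun n => eLpNorm (fun x => F n x - f x) 2 μ) atTop (𝓝 0)) :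
    InEigenspan T μ f := by
  refine ⟨hf, ?_⟩
  have hcl : IsClosed (eigenspan T μ : Set (Lp ℂ 2 μ)) := Submodule.isClosed_topologicalClosure _
  refine hcl.mem_of_tendsto (f := fun n => (hF n).1.toLp (F n)) (b := atTop) ?_
    (Eventually.of_forall fun n => (hF n).2)
  exact (Lp.tendsto_Lp_iff_tendsto_eLpNorm'' F (fun n => (hF n).1) f hf).2 h

theorem of_isEigenfunction (hT : MeasurePreserving T μ μ) (hf : IsEigenfunction T μ f) :
    InEigenspan T μ f := by
  obtain ⟨h1, lam, h2⟩ := hf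
  refine ⟨h1, ?_⟩
  by_cases h0 : h1.toLp f = 0
  · rw [h0]; exact zero_mem _
  · refine Submodule.le_topologicalClosure _ (Submodule.subset_span ⟨h0, lam, ?_⟩)
    filter_upwards [h2, h1.coeFn_toLp, hT.quasiMeasurePreserving.ae_eq_comp h1.coeFn_toLp]
      with x e1 e2 e3
    simp only [Function.comp_apply] at e3
    rw [e3, e1, e2]

/-- To prove a property of all functions in the closed span of the eigenfunctions, it suffices to
prove it for eigenfunctions and to check that it is stable under linear combinations and limits. -/
theorem induction {p : (X → ℂ) → Prop} (eig : ∀ f, IsEigenfunction T μ f → p f)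
    (add : ∀ f g, p f → p g → p fun x => f x + g x) (smul : ∀ (c : ℂ) f, p f → p fun x => c * f x)
    (congr : ∀ f g, f =ᵐ[μ] g → p f → p g)
    (lim : ∀ (F : ℕ → X → ℂ) f, (∀ n, p (F n)) → (∀ n, MemLp (F n) 2 μ) → MemLp f 2 μ →
      Tendsto (fun n => eLpNorm (fun x => F n x - f x) 2 μ) atTop (𝓝 0) → p f)
    (hf : InEigenspan T μ f) : p f := by
  obtain ⟨h1, h2⟩ := hf
  obtain ⟨u, hu, hlim⟩ := mem_closure_iff_seq_limit.1 h2
  have hspan : ∀ g ∈ Submodule.span ℂ (eigenfunctions T μ), p g := by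
    intro g hg
    induction hg using Submodule.span_induction with
    | mem g hg => exact eig g ⟨Lp.memLp g, hg.2⟩
    | zero =>
      refine congr _ _ (Lp.coeFn_zero ℂ 2 μ).symm (eig _ ⟨MemLp.zero, 0, ?_⟩)
      simp
    | add g g' _ _ hg hg' => exact congr _ _ (Lp.coeFn_add g g').symm (add _ _ hg hg')
    | smul c g _ hg => exact congr _ _ (Lp.coeFn_smul c g).symm (smul c _ hg)
  exact lim (fun n => u n) f (fun n => hspan _ (hu n)) (fun n => Lp.memLp _) h1
    ((Lp.tendsto_Lp_iff_tendsto_eLpNorm u f h1).1 hlim)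

omit [TopologicalSpace X] in
theorem memLp_mul_of_bound {r : ℝ} (hm : AEStronglyMeasurable f μ) (hb : ∀ᵐ x ∂μ, ‖f x‖ ≤ r)
    (hg : MemLp g 2 μ) : MemLp (fun x => f x * g x) 2 μ := by
  refine hg.of_le_mul (c := r) (hm.mul hg.1) ?_
  filter_upwards [hb] with x hx
  rw [norm_mul]
  exact mul_le_mul_of_nonneg_right hx (norm_nonneg _)

theorem comp {S : X → X} (hS : MeasurePreserving S μ μ) (hT : MeasurePreserving T μ μ)
    (heig : ∀ f, IsEigenfunction T μ f → IsEigenfunction T μ fun x => f (S x))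
    (hf : InEigenspan T μ f) : InEigenspan T μ fun x => f (S x) := by
  refine hf.induction (p := fun f => InEigenspan T μ fun x => f (S x)) ?_ ?_ ?_ ?_ ?_
  · exact fun f hf => of_isEigenfunction hT (heig f hf)
  · exact fun f g hf hg => InEigenspan.add hf hg
  · exact fun c f hf => InEigenspan.const_mul hf c
  · exact fun f g h hf => InEigenspan.congr hf (hS.quasiMeasurePreserving.ae_eq_comp h)
  · intro F f hF h1 h2 hlim
    refine of_tendsto hF (h2.comp_measurePreserving hS) ?_
    have : ∀ n, eLpNorm ((fun x => F n x - f x) ∘ S) 2 μ = eLpNorm (fun x => F n x - f x) 2 μ :=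
      fun n => eLpNorm_comp_measurePreserving ((h1 n).1.sub h2.1) hS
    exact hlim.congr fun n => (this n).symm

end InEigenspan

/-- Multiplication by `m` maps the closed span of the eigenfunctions to itself. -/
def IsMultiplier (T : X ≃ₜ X) (μ : Measure X) (m : X → ℂ) : Prop :=
  ∀ g, InEigenspan T μ g → InEigenspan T μ fun x => m x * g x

omit [BorelSpace X] in
theorem isEigenfunction_const [IsFiniteMeasure μ] (c : ℂ) : IsEigenfunction T μ fun _ => c :=
  ⟨memLp_const c, 1, by simp⟩

theorem measurePreserving_symm (hT : MeasurePreserving T μ μ) : MeasurePreserving T.symm μ μ :=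
  hT.symm T.toMeasurableEquiv

theorem IsEigenfunction.comp_symm (hT : MeasurePreserving T μ μ) {f : X → ℂ}
    (hf : IsEigenfunction T μ f) : IsEigenfunction T μ fun x => f (T.symm x) := by
  obtain ⟨h1, lam, h2⟩ := hf
  have hS := measurePreserving_symm hT
  refine ⟨h1.comp_measurePreserving hS, lam, ?_⟩
  filter_upwards [hS.quasiMeasurePreserving.ae_eq_comp h2] with x hx
  simp only [Function.comp_apply, T.apply_symm_apply] at hx
  rw [T.symm_apply_apply, hx]

omit [BorelSpace X] in
theorem IsEigenfunction.comp_self (hT : MeasurePreserving T μ μ) {f : X → ℂ}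
    (hf : IsEigenfunction T μ f) : IsEigenfunction T μ fun x => f (T x) := by
  obtain ⟨h1, lam, h2⟩ := hf
  exact ⟨h1.comp_measurePreserving hT, lam, hT.quasiMeasurePreserving.ae_eq_comp h2⟩

namespace IsMultiplier

variable {m m' : X → ℂ}

omit [BorelSpace X]

theorem congr (hm : IsMultiplier T μ m) (h : m =ᵐ[μ] m') : IsMultiplier T μ m' := fun g hg =>
  (hm g hg).congr (h.mono fun x hx => by simp only [hx])

theorem const (c : ℂ) : IsMultiplier T μ fun _ => c := fun _ hg => hg.const_mul c

theorem add (hm : IsMultiplier T μ m) (hm' : IsMultiplier T μ m') :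
    IsMultiplier T μ fun x => m x + m' x := fun g hg => by
  simpa only [add_mul] using (hm g hg).add (hm' g hg)

theorem mul (hm : IsMultiplier T μ m) (hm' : IsMultiplier T μ m') :
    IsMultiplier T μ fun x => m x * m' x := fun g hg => by
  simpa only [mul_assoc] using hm _ (hm' g hg)

theorem inEigenspan [IsFiniteMeasure μ] (hT : MeasurePreserving T μ μ) (hm : IsMultiplier T μ m) :
    InEigenspan T μ m := by
  simpa using hm _ (InEigenspan.of_isEigenfunction hT (isEigenfunction_const 1))

/-- Multipliers are stable under bounded limits. -/
theorem of_tendsto [IsFiniteMeasure μ] (hT : MeasurePreserving T μ μ) {M : ℕ → X → ℂ} {r : ℝ}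
    (hM : ∀ n, IsMultiplier T μ (M n)) (hb : ∀ n, ∀ᵐ x ∂μ, ‖M n x‖ ≤ r)
    (hlim : ∀ᵐ x ∂μ, Tendsto (fun n => M n x) atTop (𝓝 (m x))) : IsMultiplier T μ m := by
  intro g hg
  have hmeas : AEStronglyMeasurable m μ :=
    aestronglyMeasurable_of_tendsto_ae atTop (fun n => ((hM n).inEigenspan hT).1.1) hlim
  have hbm : ∀ᵐ x ∂μ, ‖m x‖ ≤ r := by
    filter_upwards [hlim, ae_all_iff.2 hb] with x hx hx'
    exact le_of_tendsto hx.norm (Eventually.of_forall hx')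
  refine InEigenspan.of_tendsto (fun n => hM n g hg)
    (InEigenspan.memLp_mul_of_bound hmeas hbm hg.1) ?_
  refine tendsto_eLpNorm_two_of_dominated (G := fun x => 2 * r * ‖g x‖)
    (fun n => ((hM n g hg).1.1.sub (hmeas.mul hg.1.1))) (hg.1.norm.const_mul _) ?_ ?_
  · intro n
    filter_upwards [hb n, hbm] with x h1 h2
    rw [← sub_mul, norm_mul]
    refine mul_le_mul_of_nonneg_right ((norm_sub_le _ _).trans ?_) (norm_nonneg _)
    linarith
  · filter_upwards [hlim] with x hx
    have := (hx.sub_const (m x)).mul_const (g x)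
    simpa [sub_mul] using this

theorem of_isEigenfunction [IsProbabilityMeasure μ] (hT : Ergodic T μ)
    (hf : IsEigenfunction T μ m) : IsMultiplier T μ m := by
  have hmp := hT.toMeasurePreserving
  obtain ⟨h1, lam, h2⟩ := hf
  by_cases h0 : m =ᵐ[μ] 0
  · exact (const 0).congr h0.symm
  obtain ⟨-, r, hr, hmr⟩ := eigenfunction_norm hT h1 h0 h2
  have hb : ∀ᵐ x ∂μ, ‖m x‖ ≤ r := hmr.mono fun x hx => hx.le
  intro g hg
  refine hg.induction (p := fun g => InEigenspan T μ fun x => m x * g x) ?_ ?_ ?_ ?_ ?_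
  · rintro f ⟨hf, lam', hf'⟩
    refine InEigenspan.of_isEigenfunction hmp
      ⟨InEigenspan.memLp_mul_of_bound h1.1 hb hf, lam * lam', ?_⟩
    filter_upwards [h2, hf'] with x e1 e2
    rw [e1, e2]; ring
  · intro f g hf hg
    simpa only [mul_add] using hf.add hg
  · intro c f hf
    simpa only [mul_left_comm] using hf.const_mul c
  · intro f g h hf
    exact hf.congr (h.mono fun x hx => by simp only [hx])
  · intro F f hF h3 h4 hlim
    refine InEigenspan.of_tendsto hF (InEigenspan.memLp_mul_of_bound h1.1 hb h4) ?_
    have hle : ∀ n, eLpNorm (fun x => m x * F n x - m x * f x) 2 μ ≤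
        ENNReal.ofReal r * eLpNorm (fun x => F n x - f x) 2 μ := fun n => by
      refine eLpNorm_le_mul_eLpNorm_of_ae_le_mul ?_ 2
      filter_upwards [hb] with x hx
      rw [← mul_sub, norm_mul]
      exact mul_le_mul_of_nonneg_right hx (norm_nonneg _)
    refine tendsto_of_tendsto_of_tendsto_of_le_of_le tendsto_const_nhds ?_ (fun _ => zero_le) hle
    simpa using ENNReal.Tendsto.const_mul hlim (Or.inr ENNReal.ofReal_ne_top)

theorem polynomial {u : X → ℝ} (hu : IsMultiplier T μ fun x => (u x : ℂ)) (p : Polynomial ℝ) :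
    IsMultiplier T μ fun x => ((p.eval (u x) : ℝ) : ℂ) := by
  induction p using Polynomial.induction_on with
  | C a => simpa using const (a : ℂ)
  | add p q hp hq => simpa using hp.add hq
  | monomial n a ih =>
    have := ih.mul hu
    simpa [pow_succ, mul_assoc] using this

/-- Multipliers that are bounded real functions are stable under continuous functions, by the Weierstrass
approximation theorem. -/
theorem continuous_comp [IsFiniteMeasure μ] (hT : MeasurePreserving T μ μ) {u : X → ℝ} {r : ℝ}
    (hu : IsMultiplier T μ fun x => (u x : ℂ)) (hb : ∀ᵐ x ∂μ, |u x| ≤ r) {g : ℝ → ℝ}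
    (hg : Continuous g) : IsMultiplier T μ fun x => ((g (u x) : ℝ) : ℂ) := by
  choose p hp using fun n : ℕ => exists_polynomial_near_of_continuousOn (-r) r g hg.continuousOn
    (1 / ((n : ℝ) + 1)) (by positivity)
  obtain ⟨C, hC⟩ := isCompact_Icc.exists_bound_of_continuousOn (s := Icc (-r) r) hg.continuousOn
  refine of_tendsto hT (fun n => hu.polynomial (p n)) (r := C + 1) ?_ ?_
  · intro n
    filter_upwards [hb] with x hx
    have h1 := (hp n (u x) (abs_le.1 hx)).le
    have h2 := hC (u x) (abs_le.1 hx)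
    rw [Complex.norm_real, Real.norm_eq_abs]
    rw [Real.norm_eq_abs] at h2
    have h3 : 1 / ((n : ℝ) + 1) ≤ 1 := by
      rw [div_le_one (by positivity)]; linarith [(Nat.cast_nonneg n : (0 : ℝ) ≤ n)]
    have := abs_sub_abs_le_abs_sub ((p n).eval (u x)) (g (u x))
    linarith
  · filter_upwards [hb] with x hx
    refine (Complex.continuous_ofReal.tendsto _).comp ?_
    rw [tendsto_iff_dist_tendsto_zero]
    refine squeeze_zero (fun n => dist_nonneg) (fun n => (hp n (u x) (abs_le.1 hx)).le) ?_
    exact tendsto_one_div_add_atTop_nhds_zero_nat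

/-- The indicator function of the ray is a bounded limit of continuous functions. -/
theorem indicator_Ioi [IsFiniteMeasure μ] (hT : MeasurePreserving T μ μ) {u : X → ℝ} {r : ℝ}
    (hu : IsMultiplier T μ fun x => (u x : ℂ)) (hb : ∀ᵐ x ∂μ, |u x| ≤ r) (a : ℝ) :
    IsMultiplier T μ ((u ⁻¹' Ioi a).indicator 1) := by
  refine of_tendsto hT (r := 1)
    (M := fun n x => ((min 1 (max 0 (n * (u x - a))) : ℝ) : ℂ))
    (fun n => hu.continuous_comp hT hb (g := fun t => min 1 (max 0 (n * (t - a)))) (by fun_prop))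
    ?_ ?_
  · intro n
    refine Eventually.of_forall fun x => ?_
    rw [Complex.norm_real, Real.norm_eq_abs, abs_of_nonneg (by positivity)]
    exact min_le_left _ _
  · refine Eventually.of_forall fun x => ?_
    by_cases hx : a < u x
    · rw [indicator_of_mem (show x ∈ u ⁻¹' Ioi a from hx)]
      obtain ⟨N, hN⟩ := exists_nat_gt (1 / (u x - a))
      have hpos : 0 < u x - a := sub_pos.2 hx
      rw [div_lt_iff₀ hpos] at hN
      refine tendsto_const_nhds.congr' ?_
      filter_upwards [eventually_ge_atTop N] with n hn
      have : (N : ℝ) ≤ n := by exact_mod_cast hn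
      have h1 : 1 ≤ (n : ℝ) * (u x - a) := by nlinarith
      rw [max_eq_right (by linarith), min_eq_left h1]
      simp
    · rw [indicator_of_notMem (show x ∉ u ⁻¹' Ioi a from hx)]
      refine tendsto_const_nhds.congr fun n => ?_
      have h1 : (n : ℝ) * (u x - a) ≤ 0 :=
        mul_nonpos_of_nonneg_of_nonpos (Nat.cast_nonneg n) (by linarith [not_lt.1 hx])
      rw [max_eq_left h1]
      simp

theorem comp {S S' : X → X} (hS : MeasurePreserving S μ μ) (hS' : MeasurePreserving S' μ μ)
    (hT : MeasurePreserving T μ μ)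
    (heig : ∀ f, IsEigenfunction T μ f → IsEigenfunction T μ fun x => f (S x))
    (heig' : ∀ f, IsEigenfunction T μ f → IsEigenfunction T μ fun x => f (S' x))
    (hinv : ∀ x, S' (S x) = x) (hm : IsMultiplier T μ m) : IsMultiplier T μ fun x => m (S x) := by
  intro g hg
  simpa only [hinv] using (hm _ (hg.comp hS' hT heig')).comp hS hT heig

end IsMultiplier

omit [BorelSpace X] in
/-- The σ-algebra of the Kronecker factor: the sets whose indicator functions are multipliers of the
closed span of the eigenfunctions. -/
@[reducible]
def kroneckerAlgebra [IsFiniteMeasure μ] (hT : MeasurePreserving T μ μ) : MeasurableSpace X where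
  MeasurableSet' s := MeasurableSet s ∧ IsMultiplier T μ (s.indicator 1)
  measurableSet_empty := ⟨MeasurableSet.empty, by simpa using IsMultiplier.const 0⟩
  measurableSet_compl s hs := by
    refine ⟨hs.1.compl, ?_⟩
    have := (IsMultiplier.const 1).add ((IsMultiplier.const (-1)).mul hs.2)
    refine this.congr (Eventually.of_forall fun x => ?_)
    by_cases hx : x ∈ s <;> simp [hx]
  measurableSet_iUnion f hf := by
    refine ⟨MeasurableSet.iUnion fun n => (hf n).1, ?_⟩
    have hacc : ∀ n, IsMultiplier T μ ((⋃ i < n, f i).indicator 1) := by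
      intro n
      induction n with
      | zero => simpa using IsMultiplier.const 0
      | succ n ih =>
        have := (ih.add (hf n).2).add ((IsMultiplier.const (-1)).mul (ih.mul (hf n).2))
        refine this.congr (Eventually.of_forall fun x => ?_)
        rw [Set.biUnion_lt_succ]
        by_cases hx : x ∈ ⋃ i < n, f i <;> by_cases hx' : x ∈ f n <;>
          simp only [hx, hx', indicator_of_mem, indicator_of_notMem, mem_union, or_true,
            or_false, not_false_eq_true, Pi.one_apply] <;> norm_num
    refine IsMultiplier.of_tendsto hT hacc (r := 1) ?_ ?_
    · refine fun n => Eventually.of_forall fun x => ?_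
      by_cases hx : x ∈ ⋃ i < n, f i <;> simp only [hx, indicator_of_mem, indicator_of_notMem,
        not_false_eq_true, Pi.one_apply] <;> simp
    · refine Eventually.of_forall fun x => ?_
      by_cases hx : x ∈ ⋃ i, f i
      · rw [indicator_of_mem hx]
        obtain ⟨i, hi⟩ := mem_iUnion.1 hx
        refine tendsto_const_nhds.congr' ?_
        filter_upwards [eventually_gt_atTop i] with n hn
        rw [indicator_of_mem (mem_iUnion₂.2 ⟨i, hn, hi⟩)]
      · rw [indicator_of_notMem hx]
        refine tendsto_const_nhds.congr fun n => ?_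
        rw [indicator_of_notMem fun h => ?_]
        obtain ⟨i, -, hi⟩ := mem_iUnion₂.1 h
        exact hx (mem_iUnion.2 ⟨i, hi⟩)

omit [BorelSpace X] in
theorem kroneckerAlgebra_le [IsFiniteMeasure μ] (hT : MeasurePreserving T μ μ) :
    kroneckerAlgebra hT ≤ m0 := fun _ hs => hs.1

omit [BorelSpace X] in
/-- Eigenfunctions are measurable with respect to the Kronecker algebra. -/
theorem exists_stronglyMeasurable_kroneckerAlgebra [IsProbabilityMeasure μ] (hT : Ergodic T μ)
    {f : X → ℂ} (hf : IsEigenfunction T μ f) :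
    ∃ g, StronglyMeasurable[kroneckerAlgebra hT.toMeasurePreserving] g ∧ f =ᵐ[μ] g := by
  have hmp := hT.toMeasurePreserving
  obtain ⟨h1, lam, h2⟩ := hf
  by_cases h0 : f =ᵐ[μ] 0
  · exact ⟨0, stronglyMeasurable_zero, h0⟩
  obtain ⟨-, r, hr, hfr⟩ := eigenfunction_norm hT h1 h0 h2
  set g := h1.1.mk f with hg
  have hgf : f =ᵐ[μ] g := h1.1.ae_eq_mk
  have hgm : Measurable g := h1.1.stronglyMeasurable_mk.measurable
  refine ⟨g, ?_, hgf⟩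
  have hge : IsEigenfunction T μ g := ⟨h1.ae_eq hgf, lam, by
    filter_upwards [h2, hgf, hmp.quasiMeasurePreserving.ae_eq_comp hgf] with x e1 e2 e3
    simp only [Function.comp_apply] at e3
    rw [← e3, ← e2, e1]⟩
  have hgc : IsEigenfunction T μ fun x => (starRingEnd ℂ) (g x) := by
    obtain ⟨g1, lam', g2⟩ := hge
    refine ⟨g1.star, (starRingEnd ℂ) lam', ?_⟩
    filter_upwards [g2] with x hx
    rw [hx, map_mul]
  have hgr : ∀ᵐ x ∂μ, ‖g x‖ = r := by
    filter_upwards [hfr, hgf] with x e1 e2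
    rw [← e2, e1]
  have m1 := IsMultiplier.of_isEigenfunction hT hge
  have m2 := IsMultiplier.of_isEigenfunction hT hgc
  have mre : IsMultiplier T μ fun x => (((g x).re : ℝ) : ℂ) := by
    refine ((IsMultiplier.const (1 / 2)).mul (m1.add m2)).congr (Eventually.of_forall fun x => ?_)
    simp only
    rw [Complex.add_conj]; push_cast; ring
  have mim : IsMultiplier T μ fun x => (((g x).im : ℝ) : ℂ) := by
    refine ((IsMultiplier.const (-Complex.I / 2)).mul (m1.add ((IsMultiplier.const (-1)).mul m2))
      ).congr (Eventually.of_forall fun x => ?_)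
    simp only
    have := Complex.sub_conj (g x)
    rw [show g x + -1 * (starRingEnd ℂ) (g x) = g x - (starRingEnd ℂ) (g x) by ring, this]
    push_cast
    linear_combination (-((g x).im : ℂ)) * Complex.I_sq
  have hre : Measurable[kroneckerAlgebra hmp] fun x => (g x).re := by
    refine measurable_of_Ioi (mδ := kroneckerAlgebra hmp) fun a => ?_
    exact ⟨measurableSet_preimage (Complex.measurable_re.comp hgm) measurableSet_Ioi,
      mre.indicator_Ioi hmp (hgr.mono fun x hx => (Complex.abs_re_le_norm _).trans hx.le) a⟩
  have him : Measurable[kroneckerAlgebra hmp] fun x => (g x).im := by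
    refine measurable_of_Ioi (mδ := kroneckerAlgebra hmp) fun a => ?_
    exact ⟨measurableSet_preimage (Complex.measurable_im.comp hgm) measurableSet_Ioi,
      mim.indicator_Ioi hmp (hgr.mono fun x hx => (Complex.abs_im_le_norm _).trans hx.le) a⟩
  have hgK : Measurable[kroneckerAlgebra hmp] g :=
    @measurable_of_re_im X ℂ _ (kroneckerAlgebra hmp) g hre him
  exact hgK.stronglyMeasurable

/-- The closed span of the eigenfunctions is the `L²` space of the Kronecker algebra: indicator functions
of its sets are multipliers, applied to the constant `1`, and eigenfunctions are measurable for it. -/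
theorem isKroneckerAlgebra [IsProbabilityMeasure μ] (hT : Ergodic T μ) :
    IsKroneckerAlgebra (kroneckerAlgebra hT.toMeasurePreserving) T μ := by
  have hmp := hT.toMeasurePreserving
  have hle := kroneckerAlgebra_le hmp
  refine ⟨hle, le_antisymm ?_ ?_, le_antisymm ?_ ?_⟩
  · rintro _ ⟨s, hs, rfl⟩
    exact ⟨T.measurable hs.1, hs.2.comp (S := T) (S' := T.symm) hmp (measurePreserving_symm hmp) hmp
      (fun f hf => hf.comp_self hmp) (fun f hf => hf.comp_symm hmp) T.symm_apply_apply⟩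
  · intro s hs
    refine ⟨T.symm ⁻¹' s, ⟨T.symm.measurable hs.1, hs.2.comp (S := T.symm) (S' := T)
      (measurePreserving_symm hmp) hmp hmp
      (fun f hf => hf.comp_symm hmp) (fun f hf => hf.comp_self hmp) T.apply_symm_apply⟩, ?_⟩
    ext x
    simp
  · intro f hf
    rw [mem_lpMeas_iff_aestronglyMeasurable] at hf
    change f ∈ eigenspan T μ
    refine Lp.induction_stronglyMeasurable hle (by norm_num) (fun f => f ∈ eigenspan T μ)
      ?_ ?_ ?_ f hf
    · intro c s hs hμs
      obtain ⟨h1, h2⟩ := (hs.2.inEigenspan hmp).const_mul c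
      convert h2 using 1
      refine Lp.ext ?_
      rw [Lp.simpleFunc.coe_indicatorConst]
      refine indicatorConstLp_coeFn.trans (EventuallyEq.trans ?_ h1.coeFn_toLp.symm)
      refine Eventually.of_forall fun x => ?_
      by_cases hx : x ∈ s <;> simp [hx]
    · intro f g hf hg _ _ _ h1 h2
      exact add_mem h1 h2
    · exact (Submodule.isClosed_topologicalClosure _).preimage continuous_subtype_val
  · refine Submodule.topologicalClosure_minimal _ (Submodule.span_le.2 ?_) ?_
    · rintro f ⟨-, hf⟩
      obtain ⟨g, hg, hfg⟩ := exists_stronglyMeasurable_kroneckerAlgebra hT ⟨Lp.memLp f, hf⟩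
      exact mem_lpMeas_iff_aestronglyMeasurable.2 ⟨g, hg, hfg⟩
    · exact isClosed_aestronglyMeasurable hle

omit [BorelSpace X] in
/-- If `T` has an eigenvalue different from `1`, the Kronecker factor is nontrivial. -/
theorem exists_measurableSet_kroneckerAlgebra [IsProbabilityMeasure μ] (hT : Ergodic T μ) {lam : ℂ}
    (hlam : lam ≠ 1) (h : IsEigenvalue T μ lam) :
    ∃ s, MeasurableSet[kroneckerAlgebra hT.toMeasurePreserving] s ∧ μ s ≠ 0 ∧ μ s ≠ 1 := by
  have hmp := hT.toMeasurePreserving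
  have hle := kroneckerAlgebra_le hmp
  obtain ⟨f, hf, hne, heq⟩ := h
  obtain ⟨g, hg, hfg⟩ := exists_stronglyMeasurable_kroneckerAlgebra hT ⟨hf, lam, heq⟩
  by_contra hcon
  push Not at hcon
  -- If all sets of the algebra have measure `0` or `1`, the eigenfunction is constant.
  obtain ⟨c, hc⟩ := exists_eventuallyEq_const_of_forall_separating (l := ae μ) (f := g)
    MeasurableSet fun U hU => by
      have hgU : MeasurableSet[kroneckerAlgebra hmp] (g ⁻¹' U) := hg.measurable hU
      by_cases h0 : μ (g ⁻¹' U) = 0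
      · exact Or.inr (measure_eq_zero_iff_ae_notMem.1 h0)
      · exact Or.inl ((mem_ae_iff_prob_eq_one (hle _ hgU)).2 (hcon _ hgU h0))
  have hfc : f =ᵐ[μ] fun _ => c := hfg.trans hc
  obtain ⟨x, e1, e2, e3⟩ := (heq.and (hfc.and (hmp.quasiMeasurePreserving.ae_eq_comp hfc))).exists
  simp only [Function.comp_apply] at e1 e2 e3
  rw [e3, e2] at e1
  have hc0 : c = 0 := by
    by_contra hc0
    exact hlam (mul_right_cancel₀ hc0 (by rw [← e1, one_mul]))
  exact hne (by rw [hc0] at hfc; exact hfc)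

end Kronecker

/-! ### Properties of all realizations -/

theorem exists_mem_explicitEigenvalues_ne_one : ∃ lam ∈ explicitEigenvalues, lam ≠ 1 := by
  have hg := phi_gt
  have hl := phi_lt
  refine ⟨_, ⟨0, ![1, 0], rfl⟩, ?_⟩
  rw [dotProduct_inv_pow]
  intro h
  obtain ⟨n, hn⟩ := Complex.exp_eq_one_iff.1 h
  have h1 : (2 * Complex.I * Real.pi : ℂ) ≠ 0 := by
    simp [Real.pi_ne_zero]
  have h2 : (((2 - φ) * (φ * (![1, 0] : Fin 2 → ℤ) 0 + (![1, 0] : Fin 2 → ℤ) 1) / (2 * φ + 3) ^ 0 :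
      ℝ) : ℂ) = ((n : ℝ) : ℂ) := by
    apply mul_left_cancel₀ h1
    rw [hn]
    push_cast
    ring
  have h3 : φ - 1 = n := by
    have := Complex.ofReal_injective h2
    simp at this
    linarith [phi_sq]
  have h4 : (0 : ℤ) < n := by exact_mod_cast (by linarith : (0 : ℝ) < n)
  have h5 : n < (1 : ℤ) := by exact_mod_cast (by linarith : (n : ℝ) < 1)
  omega

theorem IsExampleSystem.properties {X : Type u} [TopologicalSpace X] [MeasurableSpace X]
    [BorelSpace X] {T : X ≃ₜ X} (hT : IsExampleSystem T) :
    IsLinearlyRecurrent T ∧ ∃ μ : Measure X, IsProbabilityMeasure μ ∧ Ergodic T μ ∧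
      (∀ ν : Measure X, IsProbabilityMeasure ν → MeasurePreserving T ν ν → ν = μ) ∧
      {lam : ℂ | IsEigenvalue T μ lam} = explicitEigenvalues ∧
      (∀ lam : ℂ, IsContinuousEigenvalue T lam ↔ lam = 1) ∧
      (∃ K : MeasurableSpace X, IsKroneckerAlgebra K T μ ∧
        ∃ s : Set X, MeasurableSet[K] s ∧ μ s ≠ 0 ∧ μ s ≠ 1) ∧
      IsMaximalEquicontinuousFactor T (Homeomorph.refl PUnit.{u + 1}) (fun _ => PUnit.unit) := by
  obtain ⟨P, hP⟩ := hT.exists_sequence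
  have := hT.1.compact
  have := hT.1.metrizable
  have := hT.1.nonempty
  obtain ⟨μ, hμ, hTμ⟩ := exists_invariant_measure T.continuous
  have huniq : ∀ ν : Measure X, IsProbabilityMeasure ν → MeasurePreserving T ν ν → ν = μ :=
    fun ν _ hTν => hP.unique_invariant hTμ hTν
  have herg := ergodic_of_unique hTμ huniq
  have heig := hP.eigenvalues_eq herg
  obtain ⟨lam, hlam, hlam1⟩ := exists_mem_explicitEigenvalues_ne_one
  exact ⟨hP.isLinearlyRecurrent hT.1, μ, hμ, herg, huniq, heig,
    hP.isContinuousEigenvalue_iff hT.1,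
    ⟨_, isKroneckerAlgebra herg, exists_measurableSet_kroneckerAlgebra herg hlam1
      (show lam ∈ {lam : ℂ | IsEigenvalue T μ lam} from heig ▸ hlam)⟩,
    hP.isMaximalEquicontinuousFactor hT.1⟩

/-! ### Systems of addresses -/

theorem desc_step {h : ℕ → ℕ} {w : List ℕ} (hpos : ∀ c ∈ w, 0 < h c) {j : ℕ}
    (hj : j + 1 < hsum h w) : desc h w (j + 1) = ((desc h w j).1, (desc h w j).2 + 1) ∨
      ((desc h w j).2 + 1 = h (desc h w j).1 ∧ (desc h w (j + 1)).2 = 0) := by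
  obtain ⟨u, c, u', i, rfl, rfl, hi⟩ := exists_cell (by omega : j < hsum h w)
  rw [desc_cell hi]
  by_cases hc : i + 1 < h c
  · left
    rw [add_assoc, desc_cell hc]
  · right
    refine ⟨by change i + 1 = h c; omega, ?_⟩
    obtain ⟨d, u'', rfl⟩ : ∃ d u'', u' = d :: u'' := by
      refine List.exists_cons_of_ne_nil ?_
      rintro rfl
      simp at hj
      omega
    have h1 := desc_cell (w := u ++ [c]) (w' := u'') (hpos d (by simp))
    have h2 : hsum h u + i + 1 = hsum h (u ++ [c]) + 0 := by simp; omega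
    rw [h2, show u ++ c :: d :: u'' = (u ++ [c]) ++ d :: u'' by simp, h1]

/-- The words of the towers have the form `1 … 1 2 … 2`. -/
theorem topword_eq_replicate {n l : ℕ} (hl : l = 1 ∨ l = 2) :
    ∃ p q, topword n l = List.replicate p 1 ++ List.replicate q 2 := by
  by_cases h : IsA n
  · rcases hl with rfl | rfl
    · exact ⟨5, 2, topword_one_A h⟩
    · exact ⟨2, 3, topword_two_A h⟩
  · rcases hl with rfl | rfl
    · exact ⟨2, 1, topword_one_B h⟩
    · exact ⟨1, 1, topword_two_B h⟩

theorem exists_topword_eq {n l k : ℕ} (hl : l = 1 ∨ l = 2) (hk : k = 1 ∨ k = 2) :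
    ∃ u u', topword n l = u ++ k :: u' := by
  rcases hk with rfl | rfl
  · obtain ⟨w, hw⟩ := topword_eq_cons (n := n) hl
    exact ⟨[], w, hw⟩
  · obtain ⟨w, hw⟩ := topword_eq_append (n := n) hl
    exact ⟨w, [], hw⟩

/-- Above letters `1` there are only letters `1`. -/
theorem desc_topword_fst_eq_one {n l j : ℕ} (hl : l = 1 ∨ l = 2)
    (hj : j + 1 < hsum (H n) (topword n l))
    (h1 : (desc (H n) (topword n l) (j + 1)).1 = 1) : (desc (H n) (topword n l) j).1 = 1 := by
  obtain ⟨p, q, hw⟩ := topword_eq_replicate (n := n) hl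
  rw [hw] at h1 hj ⊢
  by_cases hp : j + 1 < hsum (H n) (List.replicate p 1)
  · rw [desc_append_left (by omega)]
    exact List.eq_of_mem_replicate (desc_fst_mem (by omega))
  · obtain ⟨e, he⟩ : ∃ e, j + 1 = hsum (H n) (List.replicate p 1) + e :=
      ⟨j + 1 - hsum (H n) (List.replicate p 1), by omega⟩
    rw [he, desc_append_right] at h1
    rw [he, hsum_append] at hj
    have := List.eq_of_mem_replicate (desc_fst_mem (h := H n) (w := List.replicate q 2) (j := e)
      (by omega))
    omega

/-- For each level `n ≥ 1`, `f n x` consists of the number of the tower of level `n` that contains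
`x`, and the depth of `x` below the roof of this tower, as in a sequence of Kakutani-Rokhlin
partitions with the prescribed words. -/
structure IsAddress {X : Type*} (T : X → X) (f : ℕ → X → ℕ × ℕ) : Prop where
  fst : ∀ n ≥ 1, ∀ x, (f n x).1 = 1 ∨ (f n x).1 = 2
  lt : ∀ n ≥ 1, ∀ x, (f n x).2 < H n (f n x).1
  desc : ∀ n ≥ 1, ∀ x, f n x = desc (H n) (topword n (f (n + 1) x).1) (f (n + 1) x).2
  succ : ∀ n ≥ 1, ∀ x k d, f n x = (k, d + 1) → f n (T x) = (k, d)
  top : ∀ n ≥ 1, ∀ x, (f n x).2 = 0 → (f n (T x)).2 + 1 = H n (f n (T x)).1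

namespace IsAddress

variable {X : Type*} {T : X → X} {f : ℕ → X → ℕ × ℕ} (hf : IsAddress T f) {n : ℕ}
include hf

theorem iterate (hn : 1 ≤ n) {x : X} {k j : ℕ} (i : ℕ) (h : f n x = (k, j + i)) :
    f n (T^[i] x) = (k, j) := by
  induction i generalizing x with
  | zero => exact h
  | succ i ih => exact ih (hf.succ n hn x k (j + i) h)

theorem of_iterate (hn : 1 ≤ n) {x : X} {k j : ℕ} (i : ℕ) (h : f n (T^[i] x) = (k, j))
    (hlt : j + i < H n k) : f n x = (k, j + i) := by
  induction i generalizing x with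
  | zero => exact h
  | succ i ih =>
    have h1 : f n (T x) = (k, j + i) := ih h (by omega)
    rcases hd : (f n x).2 with _ | d
    · have h2 := hf.top n hn x hd
      rw [h1] at h2
      simp only at h2
      omega
    · have h2 := hf.succ n hn x (f n x).1 d (by rw [← hd])
      rw [h1, Prod.mk.injEq] at h2
      ext
      · exact h2.1.symm
      · simp only; omega

/-- The `j`-th level of tower `k` consists of the points that reach its roof after `j` steps. -/
theorem iterate_eq_iff (hn : 1 ≤ n) {x : X} {k j : ℕ} (hj : j < H n k) :
    f n (T^[j] x) = (k, 0) ↔ f n x = (k, j) := by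
  constructor
  · intro h
    simpa using hf.of_iterate hn j h (by omega)
  · intro h
    exact hf.iterate hn j (by simpa using h)

theorem eq_of_le {m : ℕ} (hm : 1 ≤ m) (hmn : m ≤ n) {x y : X} (h : f n x = f n y) :
    f m x = f m y := by
  induction n, hmn using Nat.le_induction with
  | base => exact h
  | succ n hmn ih => exact ih (by rw [hf.desc n (by omega) x, hf.desc n (by omega) y, h])

theorem eq_top (hn : 1 ≤ n) {x : X} (h : (f (n + 1) x).2 = 0) : f n x = (1, 0) := by
  obtain ⟨w, hw⟩ := topword_eq_cons (n := n) (hf.fst (n + 1) (by omega) x)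
  have := desc_cell (h := H n) (w := []) (w' := w) (H_pos hn (Or.inl rfl : (1 : ℕ) = 1 ∨ (1 : ℕ) = 2))
  rw [hf.desc n hn x, h, hw]
  simpa using this

theorem map_eq_bottom (hn : 1 ≤ n) {x : X} (h : (f (n + 1) x).2 = 0) :
    f n (T x) = (2, H n 2 - 1) := by
  obtain ⟨w, hw⟩ := topword_eq_append (n := n) (hf.fst (n + 1) (by omega) (T x))
  have h2 := H_pos hn (Or.inr rfl : (2 : ℕ) = 1 ∨ (2 : ℕ) = 2)
  have h1 := hf.top (n + 1) (by omega) x h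
  rw [H_succ hn, hw, hsum_append, hsum_cons, hsum_nil] at h1
  have := desc_cell (h := H n) (w := w) (w' := []) (c := 2) (i := H n 2 - 1) (by omega)
  rw [hf.desc n hn (T x), hw, ← this]
  congr 1
  omega

/-- Recognizability: the tops of the towers of level `n + 1` are the places where a tower `2` of
level `n` lies on top of a tower `1` of level `n`. -/
theorem snd_eq_zero_iff (hn : 1 ≤ n) (x : X) :
    (f (n + 1) x).2 = 0 ↔ f n x = (1, 0) ∧ (f n (T x)).1 = 2 := by
  constructor
  · intro h
    exact ⟨hf.eq_top hn h, by rw [hf.map_eq_bottom hn h]⟩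
  · rintro ⟨h1, h2⟩
    by_contra h0
    obtain ⟨d, hd⟩ := Nat.exists_eq_add_one_of_ne_zero h0
    have h3 := hf.succ (n + 1) (by omega) x (f (n + 1) x).1 d (Prod.ext rfl hd)
    have h4 := hf.lt (n + 1) (by omega) x
    have h5 := hf.desc n hn x
    have h6 := hf.desc n hn (T x)
    rw [h3] at h6
    simp only at h6
    rw [hd, H_succ hn] at h4
    rw [hd, h1] at h5
    have := desc_topword_fst_eq_one (hf.fst (n + 1) (by omega) x) h4 (by rw [← h5])
    rw [← h6, h2] at this
    omega

/-- The address of level `n + 1` determines the addresses of level `n` of the following points. -/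
theorem iterate_eq_of_eq (hn : 1 ≤ n) {x y : X} (h : f (n + 1) x = f (n + 1) y) {i : ℕ} (hi : i ≤ n) :
    f n (T^[i] x) = f n (T^[i] y) := by
  rcases hx : f (n + 1) x with ⟨k, j⟩
  rw [hx] at h
  by_cases hij : i ≤ j
  · refine hf.eq_of_le hn (Nat.le_succ n) ?_
    rw [hf.iterate (k := k) (j := j - i) (by omega) i (by rw [hx, Nat.sub_add_cancel hij]),
      hf.iterate (k := k) (j := j - i) (by omega) i (by rw [← h, Nat.sub_add_cancel hij])]
  · obtain ⟨e, rfl⟩ : ∃ e, i = e + (j + 1) := ⟨i - (j + 1), by omega⟩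
    have hH := le_H hn (Or.inr rfl : (2 : ℕ) = 1 ∨ (2 : ℕ) = 2)
    have key : ∀ z, f (n + 1) z = (k, j) → f n (T^[e + (j + 1)] z) = (2, H n 2 - 1 - e) := by
      intro z hz
      have h1 : f (n + 1) (T^[j] z) = (k, 0) := hf.iterate (by omega) j (by simpa using hz)
      have h2 := hf.map_eq_bottom hn (x := T^[j] z) (by rw [h1])
      rw [← Function.iterate_succ_apply' T] at h2
      rw [Function.iterate_add_apply]
      exact hf.iterate hn e (by rw [h2]; congr 1; omega)
    rw [key x hx, key y h.symm]

/-- The address of level `n + 1` determines the addresses of level `n` of the preceding points. -/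
theorem eq_of_iterate_eq (hn : 1 ≤ n) {i : ℕ} {x y : X}
    (h : f (n + 1) (T^[i] x) = f (n + 1) (T^[i] y)) (hi : i ≤ n) : f n x = f n y := by
  rcases hx : f (n + 1) (T^[i] x) with ⟨k, j⟩
  rw [hx] at h
  have hj := hf.lt (n + 1) (by omega) (T^[i] x)
  rw [hx] at hj
  simp only at hj
  by_cases hij : j + i < H (n + 1) k
  · refine hf.eq_of_le hn (Nat.le_succ n) ?_
    rw [hf.of_iterate (by omega) i hx hij, hf.of_iterate (by omega) i h.symm hij]
  · have hH := le_H hn (Or.inl rfl : (1 : ℕ) = 1 ∨ (1 : ℕ) = 2)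
    obtain ⟨b, hb⟩ : ∃ b, j + b + 1 = H (n + 1) k := ⟨H (n + 1) k - 1 - j, by omega⟩
    obtain ⟨e, rfl⟩ : ∃ e, i = b + 1 + e := ⟨i - (b + 1), by omega⟩
    have key : ∀ z, f (n + 1) (T^[b + 1 + e] z) = (k, j) → f n z = (1, e) := by
      intro z hz
      rw [Function.iterate_add_apply, Function.iterate_succ_apply] at hz
      have h1 := hf.of_iterate (by omega) b hz (by omega)
      have h2 : (f (n + 1) (T^[e] z)).2 = 0 := by
        by_contra h0
        obtain ⟨d, hd⟩ := Nat.exists_eq_add_one_of_ne_zero h0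
        have h3 := hf.succ (n + 1) (by omega) (T^[e] z) (f (n + 1) (T^[e] z)).1 d
          (Prod.ext rfl hd)
        have h4 := hf.lt (n + 1) (by omega) (T^[e] z)
        rw [h1, Prod.mk.injEq] at h3
        rw [← h3.1, hd] at h4
        omega
      exact (hf.iterate_eq_iff hn (by omega)).1 (hf.eq_top hn h2)
    rw [key x hx, key y h.symm]

/-- At a suitable depth, a multiple of the height of tower `1`, the two towers of level `n + 1` have
different letters. -/
theorem exists_letter (hn : 1 ≤ n) : ∃ e, e < H (n + 1) 1 ∧ e < H (n + 1) 2 ∧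
    ∀ x, f (n + 1) (T^[e] x) = (1, 0) ∨ f (n + 1) (T^[e] x) = (2, 0) →
      (f n x).1 = (f (n + 1) (T^[e] x)).1 := by
  have h1 := H_pos hn (Or.inl rfl : (1 : ℕ) = 1 ∨ (1 : ℕ) = 2)
  have h2 := H_pos hn (Or.inr rfl : (2 : ℕ) = 1 ∨ (2 : ℕ) = 2)
  have key : ∀ e < H (n + 1) 1, e < H (n + 1) 2 →
      (KRSystem.desc (H n) (topword n 1) e).1 = 1 → (KRSystem.desc (H n) (topword n 2) e).1 = 2 →
      ∀ x, f (n + 1) (T^[e] x) = (1, 0) ∨ f (n + 1) (T^[e] x) = (2, 0) →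
      (f n x).1 = (f (n + 1) (T^[e] x)).1 := by
    intro e he1 he2 hd1 hd2 x hx
    rw [hf.desc n hn x]
    rcases hx with hx | hx
    · rw [hx, (hf.iterate_eq_iff (by omega) he1).1 hx]
      exact hd1
    · rw [hx, (hf.iterate_eq_iff (by omega) he2).1 hx]
      exact hd2
  by_cases hA : IsA n
  · have hH := H_succ_A hn hA
    refine ⟨2 * H n 1, by omega, by omega, key _ (by omega) (by omega) ?_ ?_⟩
    · have := desc_cell (h := H n) (w := [1, 1]) (w' := [1, 1, 2, 2]) h1
      rw [topword_one_A hA, show 2 * H n 1 = hsum (H n) [1, 1] + 0 by simp; omega]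
      simpa using congrArg Prod.fst this
    · have := desc_cell (h := H n) (w := [1, 1]) (w' := [2, 2]) h2
      rw [topword_two_A hA, show 2 * H n 1 = hsum (H n) [1, 1] + 0 by simp; omega]
      simpa using congrArg Prod.fst this
  · have hH := H_succ_B hn hA
    refine ⟨H n 1, by omega, by omega, key _ (by omega) (by omega) ?_ ?_⟩
    · have := desc_cell (h := H n) (w := [1]) (w' := [2]) h1
      rw [topword_one_B hA, show H n 1 = hsum (H n) [1] + 0 by simp]
      simpa using congrArg Prod.fst this
    · have := desc_cell (h := H n) (w := [1]) (w' := []) h2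
      rw [topword_two_B hA, show H n 1 = hsum (H n) [1] + 0 by simp]
      simpa using congrArg Prod.fst this

end IsAddress

/-! ### The fixed point and the addresses of its coordinates -/

/-- The address of the coordinate `i` when tower `1` of level `N` ends immediately to the left of
the coordinate `0` and tower `2` of level `N` starts there. -/
noncomputable def centralAddr (N : ℕ) (i : ℤ) : ℕ × ℕ :=
  if 0 ≤ i then (2, H N 2 - 1 - i.toNat) else (1, (-1 - i).toNat)

/-- The coordinate `i` belongs to one of the two central towers of level `N`. -/
def Central (N : ℕ) (i : ℤ) : Prop := -(H N 1 : ℤ) ≤ i ∧ i < H N 2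

theorem centralAddr_fst (N : ℕ) (i : ℤ) : (centralAddr N i).1 = 1 ∨ (centralAddr N i).1 = 2 := by
  unfold centralAddr
  split_ifs <;> simp

theorem Central.lt {N : ℕ} {i : ℤ} (h : Central N i) :
    (centralAddr N i).2 < H N (centralAddr N i).1 := by
  obtain ⟨h1, h2⟩ := h
  unfold centralAddr
  split_ifs with h0
  · simp only; omega
  · simp only; omega

theorem central_of_natAbs_lt {N : ℕ} {i : ℤ} (h : i.natAbs < N) : Central N i := by
  have h1 := le_H (n := N) (by omega) (Or.inl rfl : (1 : ℕ) = 1 ∨ (1 : ℕ) = 2)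
  have h2 := le_H (n := N) (by omega) (Or.inr rfl : (2 : ℕ) = 1 ∨ (2 : ℕ) = 2)
  constructor <;> omega

theorem Central.succ {N : ℕ} (hN : 1 ≤ N) {i : ℤ} (h : Central N i) : Central (N + 1) i := by
  obtain ⟨h1, h2⟩ := h
  by_cases hA : IsA N
  · have := H_succ_A hN hA
    constructor <;> omega
  · have := H_succ_B hN hA
    constructor <;> omega

theorem Central.desc_eq {N : ℕ} (hN : 1 ≤ N) {i : ℤ} (h : Central N i) :
    desc (H N) (topword N (centralAddr (N + 1) i).1) (centralAddr (N + 1) i).2 =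
      centralAddr N i := by
  obtain ⟨h1, h2⟩ := h
  unfold centralAddr
  split_ifs with h0
  · obtain ⟨w, hw⟩ := topword_eq_append (n := N) (Or.inr rfl : (2 : ℕ) = 1 ∨ (2 : ℕ) = 2)
    have hH := H_succ hN 2
    rw [hw, hsum_append, hsum_cons, hsum_nil] at hH
    have := desc_cell (h := H N) (w := w) (w' := []) (c := 2) (i := H N 2 - 1 - i.toNat) (by omega)
    simp only
    rw [hw, ← this]
    congr 1
    omega
  · obtain ⟨w, hw⟩ := topword_eq_cons (n := N) (Or.inl rfl : (1 : ℕ) = 1 ∨ (1 : ℕ) = 2)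
    have := desc_cell (h := H N) (w := []) (w' := w) (c := 1) (i := (-1 - i).toNat) (by omega)
    simp only
    rw [hw]
    simpa using this

/-- The address of level `n` of the coordinate `i` of the fixed point, computed in a central tower of
level `n + |i|`, which is large enough to contain the coordinate. -/
noncomputable def pos (n : ℕ) (i : ℤ) : ℕ × ℕ :=
  desc (H n) (Wd n i.natAbs (centralAddr (n + i.natAbs) i).1) (centralAddr (n + i.natAbs) i).2

/-- The address may be computed in any central tower that contains the coordinate. -/
theorem pos_eq {n : ℕ} (hn : 1 ≤ n) {k : ℕ} {i : ℤ} (h : Central (n + k) i) :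
    pos n i = desc (H n) (Wd n k (centralAddr (n + k) i).1) (centralAddr (n + k) i).2 := by
  have hstep : ∀ k, Central (n + k) i →
      desc (H n) (Wd n (k + 1) (centralAddr (n + (k + 1)) i).1) (centralAddr (n + (k + 1)) i).2 =
      desc (H n) (Wd n k (centralAddr (n + k) i).1) (centralAddr (n + k) i).2 := by
    intro k hk
    rw [← add_assoc, desc_Wd_succ hn (centralAddr_fst _ _) (hk.succ (by omega)).lt,
      hk.desc_eq (by omega)]
  have hiter : ∀ k, Central (n + k) i → ∀ d, Central (n + (k + d)) i ∧
      desc (H n) (Wd n (k + d) (centralAddr (n + (k + d)) i).1) (centralAddr (n + (k + d)) i).2 =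
      desc (H n) (Wd n k (centralAddr (n + k) i).1) (centralAddr (n + k) i).2 := by
    intro k hk d
    induction d with
    | zero => exact ⟨hk, rfl⟩
    | succ d ih => exact ⟨ih.1.succ (by omega), (hstep (k + d) ih.1).trans ih.2⟩
  have h0 : Central (n + i.natAbs) i := central_of_natAbs_lt (by omega)
  rw [pos]
  rcases le_total k i.natAbs with hk | hk
  · have := (hiter k h (i.natAbs - k)).2
    rwa [Nat.add_sub_cancel' hk] at this
  · have := (hiter i.natAbs h0 (k - i.natAbs)).2
    rw [Nat.add_sub_cancel' hk] at this
    exact this.symm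

theorem pos_eq_centralAddr {n : ℕ} (hn : 1 ≤ n) {i : ℤ} (h : Central n i) :
    pos n i = centralAddr n i := by
  have := pos_eq hn (k := 0) h
  rw [this]
  simp [Wd, desc, h.lt]

theorem Wd_succ_eq_flatMap (n k l : ℕ) : Wd n (k + 1) l = (Wd (n + 1) k l).flatMap (topword n) := by
  induction k generalizing l with
  | zero => simp [Wd]
  | succ k ih =>
    rw [Wd, Wd, List.flatMap_assoc, show n + (k + 1) = n + 1 + k by ring]
    congr 1
    funext c
    exact ih c

/-- The coordinates of the fixed point, with the translation, form a system of addresses. -/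
theorem isAddress_pos : IsAddress (fun i : ℤ => i + 1) pos := by
  have hfst : ∀ n ≥ 1, ∀ i, (pos n i).1 = 1 ∨ (pos n i).1 = 2 := by
    intro n hn i
    have hc : Central (n + i.natAbs) i := central_of_natAbs_lt (by omega)
    refine mem_Wd (centralAddr_fst (n + i.natAbs) i) (desc_fst_mem ?_)
    rw [hsum_Wd hn _ (centralAddr_fst _ _)]
    exact hc.lt
  -- Two successive coordinates in the same central tower.
  have hstep : ∀ n ≥ 1, ∀ i, i ≠ -1 → pos n i = ((pos n (i + 1)).1, (pos n (i + 1)).2 + 1) ∨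
      ((pos n (i + 1)).2 + 1 = H n (pos n (i + 1)).1 ∧ (pos n i).2 = 0) := by
    intro n hn i hi
    have hc : Central (n + (i.natAbs + 1)) i := central_of_natAbs_lt (by omega)
    have hc' : Central (n + (i.natAbs + 1)) (i + 1) := central_of_natAbs_lt (by omega)
    have h1 : centralAddr (n + (i.natAbs + 1)) i =
        ((centralAddr (n + (i.natAbs + 1)) (i + 1)).1,
          (centralAddr (n + (i.natAbs + 1)) (i + 1)).2 + 1) := by
      obtain ⟨h1, h2⟩ := hc'
      unfold centralAddr
      by_cases h0 : 0 ≤ i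
      · rw [if_pos h0, if_pos (by omega)]
        simp only [Prod.mk.injEq, true_and]
        omega
      · rw [if_neg h0, if_neg (by omega)]
        simp only [Prod.mk.injEq, true_and]
        omega
    have hlt := hc.lt
    rw [pos_eq hn hc, pos_eq hn hc', h1]
    rw [h1] at hlt
    refine desc_step (fun c hc => H_pos hn (mem_Wd (centralAddr_fst _ _) hc)) ?_
    rw [hsum_Wd hn _ (centralAddr_fst _ _)]
    exact hlt
  have hneg : ∀ n ≥ 1, pos n (-1) = (1, 0) := fun n hn => by
    have := H_pos hn (Or.inl rfl : (1 : ℕ) = 1 ∨ (1 : ℕ) = 2)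
    rw [pos_eq_centralAddr hn ⟨by omega, by omega⟩]
    simp [centralAddr]
  have hzero : ∀ n ≥ 1, pos n 0 = (2, H n 2 - 1) := fun n hn => by
    have := H_pos hn (Or.inr rfl : (2 : ℕ) = 1 ∨ (2 : ℕ) = 2)
    rw [pos_eq_centralAddr hn ⟨by omega, by omega⟩]
    simp [centralAddr]
  refine ⟨hfst, ?_, ?_, ?_, ?_⟩
  · intro n hn i
    have hc : Central (n + i.natAbs) i := central_of_natAbs_lt (by omega)
    refine desc_snd_lt ?_
    rw [hsum_Wd hn _ (centralAddr_fst _ _)]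
    exact hc.lt
  · intro n hn i
    have hc : Central (n + 1 + i.natAbs) i := central_of_natAbs_lt (by omega)
    have hc' : Central (n + (i.natAbs + 1)) i := central_of_natAbs_lt (by omega)
    have hl := centralAddr_fst (n + 1 + i.natAbs) i
    rw [pos_eq hn hc', pos_eq (by omega) hc, show n + (i.natAbs + 1) = n + 1 + i.natAbs by ring,
      Wd_succ_eq_flatMap]
    refine desc_flatMap (fun c _ => (H_succ hn c).symm) ?_
    rw [hsum_Wd (by omega) _ hl]
    exact hc.lt
  · intro n hn i k d h
    by_cases hi : i = -1
    · rw [hi, hneg n hn] at h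
      simp at h
    · rcases hstep n hn i hi with h1 | h1
      · rw [h, Prod.mk.injEq] at h1
        exact Prod.ext h1.1.symm (by simp only; omega)
      · rw [h] at h1
        exact absurd h1.2 (by simp)
  · intro n hn i h
    by_cases hi : i = -1
    · have := H_pos hn (Or.inr rfl : (2 : ℕ) = 1 ∨ (2 : ℕ) = 2)
      simp only [hi, neg_add_cancel, hzero n hn]
      omega
    · rcases hstep n hn i hi with h1 | h1
      · rw [h1] at h
        exact absurd h (by simp)
      · exact h1.1

/-- The sequence to which the approximations converge. -/
noncomputable def fixedPoint (i : ℤ) : ℕ := (pos 1 i).1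

theorem pos_one (i : ℤ) : pos 1 i = (fixedPoint i, 0) := by
  have := isAddress_pos.lt 1 le_rfl i
  rw [H_one] at this
  exact Prod.ext rfl (by simp only; omega)

/-- The words `σ` list the towers of level `1` from bottom to top, the words `Wd` from top to bottom. -/
theorem sigma_eq_reverse_Wd (n l : ℕ) : σ (n + 1) l = (Wd 1 n l).reverse := by
  induction n generalizing l with
  | zero => rfl
  | succ n ih =>
    have hrev : ∀ w : List ℕ, w.flatMap (σ (n + 1)) = (w.reverse.flatMap (Wd 1 n)).reverse := by
      intro w
      induction w with
      | nil => rfl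
      | cons c w ihw => simp [ihw, ih]
    rw [σ, hrev, Wd, topword, add_comm 1 n]

theorem desc_one (w : List ℕ) (j : ℕ) (hj : j < w.length) (d : ℕ) :
    (desc (H 1) w j).1 = w.getD j d := by
  induction w generalizing j with
  | nil => simp at hj
  | cons c w ih =>
    rcases j with _ | j
    · simp [desc, H_one]
    · rw [desc, if_neg (by rw [H_one]; omega), H_one, Nat.add_sub_cancel, ih j (by simpa using hj)]
      simp

theorem length_Wd_one (n : ℕ) {l : ℕ} (hl : l = 1 ∨ l = 2) : (Wd 1 n l).length = H (1 + n) l := by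
  rw [← hsum_Wd le_rfl n hl, hsum]
  have : H 1 = fun _ => 1 := rfl
  simp [this]

theorem approx_eq_fixedPoint {n : ℕ} {i : ℤ} (h : Central (1 + n) i) :
    approx (n + 1) i = fixedPoint i := by
  have h2 := length_Wd_one n (Or.inr rfl : (2 : ℕ) = 1 ∨ (2 : ℕ) = 2)
  have h1 := length_Wd_one n (Or.inl rfl : (1 : ℕ) = 1 ∨ (1 : ℕ) = 2)
  rw [fixedPoint, pos_eq le_rfl h, approx, sigma_eq_reverse_Wd, sigma_eq_reverse_Wd,
    List.reverse_reverse]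
  obtain ⟨ha, hb⟩ := h
  unfold centralAddr
  split_ifs with h0
  · simp only
    rw [desc_one _ _ (by omega) 2, List.getD_eq_getElem?_getD, List.getD_eq_getElem?_getD,
      List.getElem?_reverse (by omega), h2]
  · simp only
    rw [desc_one _ _ (by omega) 1, show -i - 1 = -1 - i by ring]

theorem tendsto_approx : Tendsto approx atTop (𝓝 fixedPoint) := by
  rw [tendsto_pi_nhds]
  intro i
  refine tendsto_const_nhds.congr' ?_
  filter_upwards [eventually_gt_atTop (i.natAbs + 1)] with n hn
  obtain ⟨m, rfl⟩ : ∃ m, n = m + 1 := ⟨n - 1, by omega⟩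
  exact (approx_eq_fixedPoint (central_of_natAbs_lt (by omega))).symm

theorem iterate_add_one (i : ℤ) (j : ℕ) : (fun i : ℤ => i + 1)^[j] i = i + j := by
  induction j generalizing i with
  | zero => simp
  | succ j ih => rw [Function.iterate_succ_apply, ih]; push_cast; ring

/-- The distance to the next top of a tower of level `n + 1` is visible in a window, because tops are
recognized from the addresses of level `n`. -/
theorem snd_pos_le_of_window {n : ℕ} (hn : 1 ≤ n) {i i' : ℤ}
    (h : ∀ s : ℤ, |s| ≤ 2 * H (n + 1) 1 → pos n (i + s) = pos n (i' + s)) :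
    (pos (n + 1) i').2 ≤ (pos (n + 1) i).2 := by
  have ha := isAddress_pos
  have hlt := ha.lt (n + 1) (by omega) i
  have hH := H_bounds (n := n + 1) (by omega)
  have hle : H (n + 1) (pos (n + 1) i).1 ≤ H (n + 1) 1 := by
    rcases ha.fst (n + 1) (by omega) i with h | h <;> rw [h]; omega
  set d := (pos (n + 1) i).2 with hd
  have h1 : (pos (n + 1) (i + d)).2 = 0 := by
    have := ha.iterate (n := n + 1) (by omega) (x := i) (k := (pos (n + 1) i).1) (j := 0) d
      (Prod.ext rfl (by simp [hd]))
    rw [iterate_add_one] at this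
    rw [this]
  rw [ha.snd_eq_zero_iff hn, add_assoc, h d (by rw [abs_le]; omega),
    h (d + 1) (by rw [abs_le]; omega), ← add_assoc, ← ha.snd_eq_zero_iff hn] at h1
  by_contra hlt'
  obtain ⟨e, he⟩ : ∃ e, (pos (n + 1) i').2 = e + 1 + d := ⟨(pos (n + 1) i').2 - d - 1, by omega⟩
  have := ha.iterate (n := n + 1) (by omega) (x := i') (k := (pos (n + 1) i').1) (j := e + 1) d
    (Prod.ext rfl he)
  rw [iterate_add_one] at this
  rw [this] at h1
  simp at h1

/-- The address of level `n + 1` of a coordinate is determined by the addresses of level `n` in a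
window around it. -/
theorem pos_succ_eq_of_window {n : ℕ} (hn : 1 ≤ n) {i i' : ℤ}
    (h : ∀ s : ℤ, |s| ≤ 2 * H (n + 1) 1 → pos n (i + s) = pos n (i' + s)) :
    pos (n + 1) i = pos (n + 1) i' := by
  have ha := isAddress_pos
  have hd := le_antisymm (snd_pos_le_of_window hn fun s hs => (h s hs).symm)
    (snd_pos_le_of_window hn h)
  refine Prod.ext ?_ hd
  obtain ⟨e, he1, he2, he⟩ := ha.exists_letter hn
  have key : ∀ i, (pos n (i + (((pos (n + 1) i).2 : ℤ) - e))).1 = (pos (n + 1) i).1 := by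
    intro i
    have h1 := ha.iterate (n := n + 1) (by omega) (x := i) (k := (pos (n + 1) i).1) (j := 0)
      (pos (n + 1) i).2 (Prod.ext rfl (by simp))
    rw [iterate_add_one] at h1
    have h2 := he (i + (((pos (n + 1) i).2 : ℤ) - e))
    rw [iterate_add_one, show i + (((pos (n + 1) i).2 : ℤ) - e) + e = i + (pos (n + 1) i).2 by ring,
      h1] at h2
    exact h2 (by rcases ha.fst (n + 1) (by omega) i with h | h <;> simp [h])
  have hlt := ha.lt (n + 1) (by omega) i
  have hle : H (n + 1) (pos (n + 1) i).1 ≤ H (n + 1) 1 := by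
    have hH := H_bounds (n := n + 1) (by omega)
    rcases ha.fst (n + 1) (by omega) i with h | h <;> rw [h]; omega
  rw [← key i, ← key i', ← hd, h _ (by rw [abs_le]; omega)]

/-- The address of level `n` of a coordinate is determined by a window of the sequence. -/
theorem exists_window (n : ℕ) : ∃ R : ℕ, ∀ i i' : ℤ,
    (∀ s : ℤ, |s| ≤ R → fixedPoint (i + s) = fixedPoint (i' + s)) →
      pos (n + 1) i = pos (n + 1) i' := by
  induction n with
  | zero =>
    refine ⟨0, fun i i' h => ?_⟩
    have := h 0 (by simp)
    rw [zero_add, pos_one, pos_one, ← add_zero i, ← add_zero i', this]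
  | succ n ih =>
    obtain ⟨R, hR⟩ := ih
    refine ⟨R + 2 * H (n + 1 + 1) 1, fun i i' h => pos_succ_eq_of_window (by omega) fun s hs =>
      hR _ _ fun t ht => ?_⟩
    rw [add_assoc, add_assoc]
    refine h _ ((abs_add_le _ _).trans ?_)
    push_cast
    linarith

/-! ### Kakutani-Rokhlin partitions from addresses -/

section

variable {X : Type u} [TopologicalSpace X] {T : X ≃ₜ X}

/-- A system of addresses whose maps are locally constant, take all values and separate points from
closed sets. -/
structure IsTopologicalAddress (T : X ≃ₜ X) (f : ℕ → X → ℕ × ℕ) : Prop where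
  address : IsAddress T f
  isOpen : ∀ n ≥ 1, ∀ s : Set (ℕ × ℕ), IsOpen (f n ⁻¹' s)
  exists_top : ∀ n ≥ 1, ∀ k, k = 1 ∨ k = 2 → ∃ x, f n x = (k, 0)
  separates : ∀ x (U : Set X), IsOpen U → x ∈ U → ∃ n ≥ 1, ∀ y, f n y = f n x → y ∈ U

/-- The trivial partition, with one tower of height `1`. -/
def trivialPartition (T : X ≃ₜ X) [Nonempty X] : CKRPartition T where
  C := 1
  B _ := univ
  h _ := 1
  C_pos := one_pos
  clopen _ _ := isClopen_univ
  nonempty _ _ := univ_nonempty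
  h_pos _ _ := one_pos
  disjoint k hk k' hk' j hj j' hj' hne := by
    simp only [Finset.mem_Icc] at hk hk'
    exact absurd (by rw [Prod.mk.injEq]; omega) hne
  cover x := ⟨1, by simp, 0, one_pos, mem_univ _⟩

namespace IsTopologicalAddress

variable {f : ℕ → X → ℕ × ℕ} (hf : IsTopologicalAddress T f) {n : ℕ}

include hf

theorem isClopen (hn : 1 ≤ n) (s : Set (ℕ × ℕ)) : IsClopen (f n ⁻¹' s) :=
  ⟨⟨by rw [← preimage_compl]; exact hf.isOpen n hn _⟩, hf.isOpen n hn s⟩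

theorem preimage_eq (hn : 1 ≤ n) {k j : ℕ} (hj : j < H n k) :
    T^[j] ⁻¹' (f n ⁻¹' {(k, 0)}) = f n ⁻¹' {(k, j)} := by
  ext x
  exact hf.address.iterate_eq_iff hn hj

theorem exists_eq (hn : 1 ≤ n) {k j : ℕ} (hk : k = 1 ∨ k = 2) (hj : j < H n k) :
    ∃ x, f n x = (k, j) := by
  obtain ⟨y, hy⟩ := hf.exists_top n hn k hk
  obtain ⟨x, rfl⟩ := T.surjective.iterate j y
  exact ⟨x, (hf.address.iterate_eq_iff hn hj).1 hy⟩

omit hf in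
theorem mem_Icc_iff {k : ℕ} : k ∈ Finset.Icc 1 2 ↔ k = 1 ∨ k = 2 := by
  rw [Finset.mem_Icc]; omega

/-- The Kakutani-Rokhlin partition given by the addresses of level `n`. -/
noncomputable def partition (hn : 1 ≤ n) : CKRPartition T where
  C := 2
  B k := f n ⁻¹' {(k, 0)}
  h := H n
  C_pos := two_pos
  clopen k _ := hf.isClopen hn _
  nonempty k hk := hf.exists_top n hn k (mem_Icc_iff.1 hk)
  h_pos k hk := H_pos hn (mem_Icc_iff.1 hk)
  disjoint k hk k' hk' j hj j' hj' hne := by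
    rw [hf.preimage_eq hn hj, hf.preimage_eq hn hj']
    exact Disjoint.preimage _ (by simpa using hne)
  cover x := ⟨_, mem_Icc_iff.2 (hf.address.fst n hn x), _, hf.address.lt n hn x, by
    rw [hf.preimage_eq hn (hf.address.lt n hn x)]; rfl⟩

/-- The sequence of partitions given by the addresses. -/
noncomputable def partitions [Nonempty X] : ℕ → CKRPartition T
  | 0 => trivialPartition T
  | n + 1 => hf.partition (Nat.le_add_left 1 n)

theorem mem_roof [Nonempty X] {x : X} : x ∈ (hf.partitions (n + 1)).roof ↔ (f (n + 1) x).2 = 0 := by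
  rw [CKRPartition.mem_roof]
  constructor
  · rintro ⟨k, -, hx⟩
    have hx : f (n + 1) x = (k, 0) := hx
    rw [hx]
  · intro h
    exact ⟨(f (n + 1) x).1, mem_Icc_iff.2 (hf.address.fst _ (by omega) x), Prod.ext rfl h⟩

theorem preimage_subset_iff (hn : 1 ≤ n) {l j k : ℕ} (hl : l = 1 ∨ l = 2) (hj : j < H (n + 1) l) :
    T^[j] ⁻¹' (f (n + 1) ⁻¹' {(l, 0)}) ⊆ f n ⁻¹' {(k, 0)} ↔
      desc (H n) (topword n l) j = (k, 0) := by
  rw [hf.preimage_eq (by omega) hj]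
  constructor
  · intro h
    obtain ⟨x, hx⟩ := hf.exists_eq (n := n + 1) (by omega) hl hj
    have h1 : f n x = (k, 0) := h hx
    rw [hf.address.desc n hn x, hx] at h1
    exact h1
  · intro h x hx
    have hx : f (n + 1) x = (l, j) := hx
    change f n x = (k, 0)
    rw [hf.address.desc n hn x, hx]
    exact h

/-- The common point of the roofs is unique, because points of all roofs have the same addresses. -/
theorem nested [Nonempty X] [T2Space X] (hroof : ∃ x, ∀ n ≥ 1, (f n x).2 = 0) :
    IsNestedSequence hf.partitions where
  zero_C := rfl
  zero_B := rfl
  zero_h := rfl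
  roof_anti n := by
    rcases n with _ | n
    · intro x _
      exact (CKRPartition.mem_roof _).2 ⟨1, by simp [partitions, trivialPartition], mem_univ x⟩
    · intro x hx
      rw [hf.mem_roof] at hx ⊢
      rw [hf.address.eq_top (by omega) hx]
  refines n := by
    rintro _ ⟨l, hl, j, hj, rfl⟩
    rcases n with _ | n
    · exact ⟨univ, ⟨1, by simp [partitions, trivialPartition], 0, one_pos, rfl⟩, subset_univ _⟩
    · have hl' := mem_Icc_iff.1 hl
      have hj' : j < H (n + 1 + 1) l := hj
      obtain ⟨x, hx⟩ := hf.exists_eq (n := n + 1 + 1) (by omega) hl' hj'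
      have hlt := hf.address.lt (n + 1) (by omega) x
      refine ⟨f (n + 1) ⁻¹' {f (n + 1) x}, ⟨_, mem_Icc_iff.2 (hf.address.fst (n + 1) (by omega) x),
        _, hlt, (hf.preimage_eq (by omega) hlt).symm⟩, ?_⟩
      change T^[j] ⁻¹' (f (n + 1 + 1) ⁻¹' {(l, 0)}) ⊆ _
      rw [hf.preimage_eq (by omega) hj']
      intro y hy
      exact hf.address.eq_of_le (by omega) (Nat.le_succ _) (Eq.trans hy hx.symm)
  roof_inter := by
    obtain ⟨x, hx⟩ := hroof
    have hmem : ∀ y, y ∈ ⋂ n, (hf.partitions n).roof ↔ ∀ n ≥ 1, (f n y).2 = 0 := by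
      intro y
      rw [mem_iInter]
      constructor
      · intro h n hn
        obtain ⟨m, rfl⟩ : ∃ m, n = m + 1 := ⟨n - 1, by omega⟩
        exact hf.mem_roof.1 (h (m + 1))
      · intro h n
        rcases n with _ | n
        · exact (CKRPartition.mem_roof _).2 ⟨1, by simp [partitions, trivialPartition], mem_univ y⟩
        · exact hf.mem_roof.2 (h (n + 1) (by omega))
    refine ⟨x, Subset.antisymm ?_ (singleton_subset_iff.2 ((hmem x).2 hx))⟩
    intro y hy
    rw [hmem] at hy
    by_contra hne
    obtain ⟨n, hn, h⟩ := hf.separates x {y}ᶜ isOpen_compl_singleton (fun h => hne (Eq.symm h))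
    refine h y ?_ rfl
    rw [hf.address.eq_top hn (hy (n + 1) (by omega)), hf.address.eq_top hn (hx (n + 1) (by omega))]
  spans := by
    refine le_antisymm ?_ ?_
    · refine le_generateFrom ?_
      intro a ha
      obtain ⟨n, k, hk, j, hj, rfl⟩ := mem_iUnion.1 ha
      exact (((hf.partitions n).clopen k hk).isOpen).preimage (T.continuous.iterate j)
    · intro U hU
      have : U = ⋃₀ {a | a ∈ (⋃ n, (hf.partitions n).atoms) ∧ a ⊆ U} := by
        refine Subset.antisymm (fun x hx => ?_) (sUnion_subset fun a ha => ha.2)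
        obtain ⟨n, hn, h⟩ := hf.separates x U hU hx
        obtain ⟨m, rfl⟩ : ∃ m, n = m + 1 := ⟨n - 1, by omega⟩
        have hlt := hf.address.lt (m + 1) hn x
        refine ⟨f (m + 1) ⁻¹' {f (m + 1) x}, ⟨mem_iUnion.2 ⟨m + 1, _,
          mem_Icc_iff.2 (hf.address.fst (m + 1) hn x), _, hlt, (hf.preimage_eq hn hlt).symm⟩,
          fun y hy => h y hy⟩, rfl⟩
      rw [this]
      exact TopologicalSpace.GenerateOpen.sUnion _ fun a ha => .basic a ha.1
  crosses n k hk l hl := by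
    have hl' := mem_Icc_iff.1 hl
    rcases n with _ | n
    · exact ⟨0, H_pos (by omega) hl', subset_univ _⟩
    · have hk' := mem_Icc_iff.1 hk
      obtain ⟨u, u', hu⟩ := exists_topword_eq (n := n + 1) hl' hk'
      have hHk := H_pos (n := n + 1) (by omega) hk'
      have hlt : hsum (H (n + 1)) u < H (n + 1 + 1) l := by
        rw [H_succ (by omega), hu, hsum_append, hsum_cons]
        omega
      refine ⟨hsum (H (n + 1)) u, hlt, (hf.preimage_subset_iff (by omega) hl' hlt).2 ?_⟩
      have := desc_cell (w := u) (w' := u') hHk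
      rwa [← hu, add_zero] at this
  roof_subset_first n := by
    rcases n with _ | n
    · exact subset_univ _
    · intro x hx
      rw [hf.mem_roof] at hx
      exact hf.address.eq_top (by omega) hx

theorem incidence_eq [Nonempty X] (hn : 1 ≤ n) {l : ℕ} (hl : l = 1 ∨ l = 2) (k : ℕ) :
    (hf.partitions (n + 1)).incidence (hf.partitions n) l k = (topword n l).count k := by
  obtain ⟨m, rfl⟩ : ∃ m, n = m + 1 := ⟨n - 1, by omega⟩
  rw [← card_filter_desc (h := H (m + 1)) (fun c hc => H_pos (by omega) (mem_topword hl hc)) k,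
    ← H_succ (by omega), CKRPartition.incidence]
  classical
  refine congrArg Finset.card (Finset.ext fun j => ?_)
  rw [Finset.mem_filter, Finset.mem_filter]
  exact and_congr_right fun hj => hf.preimage_subset_iff (by omega) hl (Finset.mem_range.1 hj)

theorem towerWord_eq [Nonempty X] (hn : 1 ≤ n) {l : ℕ} (hl : l = 1 ∨ l = 2) :
    (hf.partitions (n + 1)).towerWord (hf.partitions n) l = nextWord n l := by
  obtain ⟨m, rfl⟩ : ∃ m, n = m + 1 := ⟨n - 1, by omega⟩
  have hw : nextWord (m + 1) l = (topword (m + 1) l).reverse := by rw [topword, List.reverse_reverse]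
  rw [hw, ← filterMap_desc (h := H (m + 1)) (w := topword (m + 1) l)
    (fun c hc => H_pos (by omega) (mem_topword hl hc)), ← H_succ (by omega), CKRPartition.towerWord,
    ← List.filterMap_reverse]
  refine List.filterMap_congr fun j hj => ?_
  have hj : j < H (m + 1 + 1) l := by simpa [partitions, partition] using hj
  have hsub : ∀ k, T^[j] ⁻¹' (hf.partitions (m + 1 + 1)).B l ⊆ (hf.partitions (m + 1)).B k ↔
      desc (H (m + 1)) (topword (m + 1) l) j = (k, 0) :=
    fun k => hf.preimage_subset_iff (by omega) hl hj
  split_ifs with hH h0 h0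
  · have := (hsub _).1 hH.choose_spec.2
    rw [this]
  · have := (hsub _).1 hH.choose_spec.2
    rw [this] at h0
    exact absurd rfl h0
  · refine absurd ⟨(desc (H (m + 1)) (topword (m + 1) l) j).1, mem_Icc_iff.2 ?_,
      (hsub _).2 (Prod.ext rfl h0)⟩ hH
    exact mem_topword hl (desc_fst_mem (by rwa [← H_succ (by omega)]))
  · rfl

theorem exists_zpow_eq (hn : 1 ≤ n) (x : X) {j : ℕ} (hj : j < H n (f n x).1) :
    ∃ i : ℤ, f n ((T ^ i) x) = ((f n x).1, j) := by
  have hzpow : ∀ (i : ℕ) (y : X), (T ^ (i : ℤ)) y = T^[i] y := by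
    intro i
    induction i with
    | zero => simp
    | succ i ih =>
      intro y
      rw [Function.iterate_succ_apply, ← ih, Nat.cast_succ, zpow_add_one, Homeomorph.mul_apply]
  rcases le_total j (f n x).2 with h | h
  · refine ⟨((f n x).2 - j : ℕ), ?_⟩
    rw [hzpow]
    exact hf.address.iterate hn _ (Prod.ext rfl (by simp only; omega))
  · obtain ⟨e, rfl⟩ := Nat.exists_eq_add_of_le h
    obtain ⟨y, hy⟩ := T.surjective.iterate e x
    refine ⟨-(e : ℤ), ?_⟩
    have : (T ^ (-(e : ℤ))) x = y := by
      rw [← hy, ← hzpow, ← Homeomorph.mul_apply, ← zpow_add, neg_add_cancel, zpow_zero]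
      rfl
    rw [this]
    exact hf.address.of_iterate hn e (by rw [hy]) hj

/-- Each tower of level `n + 1` passes through all atoms of level `n`, so orbits are dense. -/
theorem isMinimalCantorSystem [CompactSpace X] [TopologicalSpace.MetrizableSpace X] :
    IsMinimalCantorSystem T where
  nonempty := ⟨(hf.exists_top 1 le_rfl 1 (Or.inl rfl)).choose⟩
  compact := inferInstance
  metrizable := inferInstance
  clopen_basis := by
    refine ⟨range fun p : ℕ × (ℕ × ℕ) => f (p.1 + 1) ⁻¹' {p.2}, countable_range _, ?_, ?_⟩
    · refine TopologicalSpace.isTopologicalBasis_of_isOpen_of_nhds ?_ ?_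
      · rintro _ ⟨p, rfl⟩
        exact hf.isOpen _ (by omega) _
      · intro x U hx hU
        obtain ⟨n, hn, h⟩ := hf.separates x U hU hx
        obtain ⟨m, rfl⟩ : ∃ m, n = m + 1 := ⟨n - 1, by omega⟩
        exact ⟨_, ⟨(m, f (m + 1) x), rfl⟩, rfl, fun y hy => h y hy⟩
    · rintro _ ⟨p, rfl⟩
      exact hf.isClopen (by omega) _
  no_isolated x hx := by
    obtain ⟨n, hn, h⟩ := hf.separates x {x} hx rfl
    have hlt := hf.address.lt n hn x
    have hk := hf.address.fst n hn x
    -- Both towers of level `n + 1` pass through the atom of `x`.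
    have key : ∀ l, l = 1 ∨ l = 2 → (f (n + 1) x).1 = l := by
      intro l hl
      obtain ⟨u, u', hu⟩ := exists_topword_eq (n := n) hl hk
      obtain ⟨y, hy⟩ := hf.exists_eq (n := n + 1) (k := l) (j := hsum (H n) u + (f n x).2) (by omega) hl
        (by rw [H_succ hn, hu, hsum_append, hsum_cons]; omega)
      have h1 := hf.address.desc n hn y
      rw [hy, hu, desc_cell hlt] at h1
      have : y = x := h y h1
      rw [← this, hy]
    have h1 := key 1 (Or.inl rfl)
    have h2 := key 2 (Or.inr rfl)
    omega
  minimal x := by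
    intro y
    rw [mem_closure_iff]
    intro U hU hy
    obtain ⟨n, hn, h⟩ := hf.separates y U hU hy
    have hlt := hf.address.lt n hn y
    have hl := hf.address.fst (n + 1) (by omega) x
    obtain ⟨u, u', hu⟩ := exists_topword_eq (n := n) hl (hf.address.fst n hn y)
    obtain ⟨i, hi⟩ := hf.exists_zpow_eq (n := n + 1) (by omega) x (j := hsum (H n) u + (f n y).2)
      (by rw [H_succ hn, hu, hsum_append, hsum_cons]; omega)
    refine ⟨_, h _ ?_, i, rfl⟩
    have h1 := hf.address.desc n hn ((T ^ i) x)
    rwa [hi, hu, desc_cell hlt] at h1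

/-- A compact system of topological addresses whose roofs have a common point is a realization. -/
theorem isExampleSystem [CompactSpace X] [TopologicalSpace.MetrizableSpace X]
    (hroof : ∃ x, ∀ n ≥ 1, (f n x).2 = 0) : IsExampleSystem T := by
  have hmin := hf.isMinimalCantorSystem
  have := hmin.nonempty
  refine ⟨hmin, hf.partitions, hf.nested hroof, ?_, ?_, ?_, ?_⟩
  · intro n hn
    obtain ⟨m, rfl⟩ : ∃ m, n = m + 1 := ⟨n - 1, by omega⟩
    rfl
  · intro l _
    simp [CKRPartition.incidence, partitions, partition, trivialPartition, H_one]
  · intro n hn i j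
    rw [hf.incidence_eq hn (by omega), nextMat]
    by_cases hA : IsA n
    · have hA' : (n : ℝ) * v n ≤ 1 := hA
      rw [if_pos hA']
      fin_cases i <;> fin_cases j <;> simp [topword_one_A hA, topword_two_A hA, matA]
    · have hA' : ¬ (n : ℝ) * v n ≤ 1 := hA
      rw [if_neg hA']
      fin_cases i <;> fin_cases j <;> simp [topword_one_B hA, topword_two_B hA, matB]
  · intro n hn t ht
    exact hf.towerWord_eq hn (mem_Icc_iff.1 ht)

end IsTopologicalAddress

end

/-! ### The symbolic realization -/

/-- The sequence `fixedPoint`, shifted by `n`. -/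
noncomputable def orbitPoint (n : ℤ) : ℤ → ℕ := fun i => fixedPoint (i + n)

theorem fullShift_orbitPoint (n : ℤ) : fullShift (orbitPoint n) = orbitPoint (n + 1) := by
  funext i
  change fixedPoint (i + 1 + n) = fixedPoint (i + (n + 1))
  congr 1
  ring

/-- The addresses are given by sliding block codes, which make sense for all sequences. -/
theorem exists_code (n : ℕ) (hn : 1 ≤ n) : ∃ F : (ℤ → ℕ) → ℕ × ℕ,
    (∀ s, IsOpen (F ⁻¹' s)) ∧ ∀ i, F (orbitPoint i) = pos n i := by
  classical
  obtain ⟨m, rfl⟩ : ∃ m, n = m + 1 := ⟨n - 1, by omega⟩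
  obtain ⟨R, hR⟩ := exists_window m
  let F : (ℤ → ℕ) → ℕ × ℕ := fun x =>
    if h : ∃ i : ℤ, ∀ s : ℤ, |s| ≤ R → x s = fixedPoint (i + s) then pos (m + 1) h.choose else (0, 0)
  have hF : ∀ x y : ℤ → ℕ, (∀ s : ℤ, |s| ≤ R → x s = y s) → F x = F y := by
    intro x y h
    have : (fun i : ℤ => ∀ s : ℤ, |s| ≤ R → x s = fixedPoint (i + s)) =
        fun i : ℤ => ∀ s : ℤ, |s| ≤ R → y s = fixedPoint (i + s) := by
      funext i
      refine propext (forall_congr' fun s => forall_congr' fun hs => ?_)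
      rw [h s hs]
    simp only [F, this]
  refine ⟨F, fun s => ?_, fun i => ?_⟩
  · rw [isOpen_iff_forall_mem_open]
    intro x hx
    refine ⟨⋂ j ∈ Finset.Icc (-R : ℤ) R, {y | y j = x j}, fun y hy => ?_,
      isOpen_biInter_finset fun j _ => ?_, by simp⟩
    · have : F y = F x := hF y x fun j hj =>
        mem_iInter₂.1 hy j (Finset.mem_Icc.2 (abs_le.1 hj))
      rw [mem_preimage, this]
      exact hx
    · have hj : Continuous fun y : ℤ → ℕ => y j := continuous_apply j
      exact (isOpen_discrete ({x j} : Set ℕ)).preimage hj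
  · have h : ∃ i' : ℤ, ∀ s : ℤ, |s| ≤ R → orbitPoint i s = fixedPoint (i' + s) :=
      ⟨i, fun s _ => by rw [orbitPoint, add_comm]⟩
    have h1 := h.choose_spec
    simp only [F]
    rw [dif_pos h]
    refine hR _ _ fun s hs => ?_
    rw [← h1 s hs, orbitPoint, add_comm]

/-- A sliding block code for the addresses of level `n ≥ 1`; constant for `n = 0`. -/
noncomputable def code (n : ℕ) : (ℤ → ℕ) → ℕ × ℕ :=
  if hn : 1 ≤ n then (exists_code n hn).choose else fun _ => (0, 0)

theorem isOpen_code {n : ℕ} (hn : 1 ≤ n) (s : Set (ℕ × ℕ)) : IsOpen (code n ⁻¹' s) := by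
  rw [code, dif_pos hn]
  exact (exists_code n hn).choose_spec.1 s

theorem code_orbitPoint {n : ℕ} (hn : 1 ≤ n) (i : ℤ) : code n (orbitPoint i) = pos n i := by
  rw [code, dif_pos hn]
  exact (exists_code n hn).choose_spec.2 i

/-- Relations between finitely many coordinates or addresses pass from the orbit to its closure. -/
theorem mem_of_orbitPoint {x : ℤ → ℕ} (hx : x ∈ orbitClosure fixedPoint) {α β : Type*}
    {F : (ℤ → ℕ) → α} {G : (ℤ → ℕ) → β} (hF : ∀ s, IsOpen (F ⁻¹' s)) (hG : ∀ s, IsOpen (G ⁻¹' s))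
    {r : α → β → Prop} (h : ∀ i, r (F (orbitPoint i)) (G (orbitPoint i))) : r (F x) (G x) := by
  have hU : IsOpen (F ⁻¹' {F x} ∩ G ⁻¹' {G x}) := (hF _).inter (hG _)
  obtain ⟨_, ⟨h1, h2⟩, i, rfl⟩ := mem_closure_iff.1 hx _ hU ⟨rfl, rfl⟩
  have h1 : F (orbitPoint i) = F x := h1
  have h2 : G (orbitPoint i) = G x := h2
  rw [← h1, ← h2]
  exact h i

theorem isOpen_code_shift {n : ℕ} (hn : 1 ≤ n) (s : Set (ℕ × ℕ)) :
    IsOpen ((fun x => code n (fullShift x)) ⁻¹' s) :=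
  (isOpen_code hn s).preimage fullShift.continuous

theorem isAddress_code : IsAddress (subshift fixedPoint)
    (fun n (x : orbitClosure fixedPoint) => code n x.1) where
  fst n hn x := mem_of_orbitPoint (r := fun a _ => a.1 = 1 ∨ a.1 = 2) x.2 (isOpen_code hn)
    (isOpen_code hn) fun i => by
      rw [code_orbitPoint hn]
      exact isAddress_pos.fst n hn i
  lt n hn x := mem_of_orbitPoint (r := fun a _ => a.2 < H n a.1) x.2 (isOpen_code hn)
    (isOpen_code hn) fun i => by
      rw [code_orbitPoint hn]
      exact isAddress_pos.lt n hn i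
  desc n hn x := mem_of_orbitPoint (r := fun a b => a = desc (H n) (topword n b.1) b.2) x.2
    (isOpen_code hn) (isOpen_code (n := n + 1) (by omega)) fun i => by
      rw [code_orbitPoint hn, code_orbitPoint (by omega)]
      exact isAddress_pos.desc n hn i
  succ n hn x k d := mem_of_orbitPoint (r := fun a b => a = (k, d + 1) → b = (k, d)) x.2
    (isOpen_code hn) (isOpen_code_shift hn) fun i => by
      rw [fullShift_orbitPoint, code_orbitPoint hn, code_orbitPoint hn]
      exact isAddress_pos.succ n hn i k d
  top n hn x := mem_of_orbitPoint (r := fun a b => a.2 = 0 → b.2 + 1 = H n b.1) x.2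
    (isOpen_code hn) (isOpen_code_shift hn) fun i => by
      rw [fullShift_orbitPoint, code_orbitPoint hn, code_orbitPoint hn]
      exact isAddress_pos.top n hn i

theorem code_one {x : ℤ → ℕ} (hx : x ∈ orbitClosure fixedPoint) : code 1 x = (x 0, 0) :=
  mem_of_orbitPoint (r := fun a (b : ℕ) => a = (b, 0)) (G := fun x => x 0) hx (isOpen_code le_rfl)
    (fun s => (isOpen_discrete s).preimage (continuous_apply 0)) fun i => by
      rw [code_orbitPoint le_rfl, pos_one, orbitPoint, zero_add]

theorem subshift_iterate (x : orbitClosure fixedPoint) (j : ℕ) (i : ℤ) :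
    ((subshift fixedPoint)^[j] x).1 i = x.1 (i + j) := by
  induction j generalizing x with
  | zero => simp
  | succ j ih =>
    rw [Function.iterate_succ_apply, ih]
    rw [Nat.cast_succ, ← add_assoc]
    rfl

/-- The address of level `n + 1` of a sequence determines its central coordinates. -/
theorem coord_eq_of_code_eq {n : ℕ} (hn : 1 ≤ n) {x y : orbitClosure fixedPoint}
    (h : code (n + 1) x.1 = code (n + 1) y.1) {i : ℤ} (hi : i.natAbs ≤ n) : x.1 i = y.1 i := by
  have ha := isAddress_code
  have h1 : ∀ z : orbitClosure fixedPoint, code 1 z.1 = (z.1 0, 0) := fun z => code_one z.2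
  rcases le_total 0 i with h0 | h0
  · have h2 := ha.eq_of_le le_rfl hn (ha.iterate_eq_of_eq hn h hi)
    simp only [h1, subshift_iterate, Prod.mk.injEq, and_true] at h2
    rwa [show (0 : ℤ) + i.natAbs = i by omega] at h2
  · obtain ⟨x', rfl⟩ := (subshift fixedPoint).surjective.iterate i.natAbs x
    obtain ⟨y', rfl⟩ := (subshift fixedPoint).surjective.iterate i.natAbs y
    have h2 := ha.eq_of_le le_rfl hn (ha.eq_of_iterate_eq hn h hi)
    simp only [h1, Prod.mk.injEq, and_true] at h2
    rwa [subshift_iterate, subshift_iterate, show i + (i.natAbs : ℤ) = 0 by omega]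

theorem orbitPoint_mem (i : ℤ) : orbitPoint i ∈ orbitClosure fixedPoint :=
  subset_closure ⟨i, rfl⟩

theorem isTopologicalAddress_code : IsTopologicalAddress (subshift fixedPoint)
    (fun n (x : orbitClosure fixedPoint) => code n x.1) where
  address := isAddress_code
  isOpen n hn s := (isOpen_code hn s).preimage continuous_subtype_val
  exists_top n hn k hk := by
    have h1 := H_pos hn (Or.inl rfl : (1 : ℕ) = 1 ∨ (1 : ℕ) = 2)
    have h2 := H_pos hn (Or.inr rfl : (2 : ℕ) = 1 ∨ (2 : ℕ) = 2)
    rcases hk with rfl | rfl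
    · refine ⟨⟨_, orbitPoint_mem (-1)⟩, ?_⟩
      rw [code_orbitPoint hn, pos_eq_centralAddr hn ⟨by omega, by omega⟩]
      simp [centralAddr]
    · refine ⟨⟨_, orbitPoint_mem (H n 2 - 1)⟩, ?_⟩
      rw [code_orbitPoint hn, pos_eq_centralAddr hn ⟨by omega, by omega⟩, centralAddr,
        if_pos (by omega)]
      exact Prod.ext rfl (by simp only; omega)
  separates x U hU hx := by
    obtain ⟨V, hV, rfl⟩ := isOpen_induced_iff.1 hU
    obtain ⟨I, u, hu, hIV⟩ := isOpen_pi_iff.1 hV x.1 hx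
    refine ⟨I.sup Int.natAbs + 1 + 1, by omega, fun y hy => hIV fun i hi => ?_⟩
    have : i.natAbs ≤ I.sup Int.natAbs := Finset.le_sup (f := Int.natAbs) hi
    rw [coord_eq_of_code_eq (by omega) hy (i := i) (by omega)]
    exact (hu i hi).2

theorem isExampleSystem_subshift : IsExampleSystem (subshift fixedPoint) := by
  have hle : ∀ i, orbitClosure fixedPoint ⊆ {x | x i = 1 ∨ x i = 2} := by
    intro i
    refine closure_minimal ?_ ((isClosed_discrete {k | k = 1 ∨ k = 2}).preimage (continuous_apply i))
    rintro _ ⟨n, rfl⟩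
    exact isAddress_pos.fst 1 le_rfl (i + n)
  have hcomp : IsCompact (orbitClosure fixedPoint) := by
    refine (isCompact_univ_pi (s := fun _ : ℤ => ({1, 2} : Set ℕ)) fun i =>
      (Set.toFinite _).isCompact).of_isClosed_subset isClosed_closure fun x hx i _ => ?_
    exact hle i hx
  have : CompactSpace (orbitClosure fixedPoint) := isCompact_iff_compactSpace.1 hcomp
  refine isTopologicalAddress_code.isExampleSystem ⟨⟨_, orbitPoint_mem (-1)⟩, fun n hn => ?_⟩
  have h1 := H_pos hn (Or.inl rfl : (1 : ℕ) = 1 ∨ (1 : ℕ) = 2)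
  rw [code_orbitPoint hn, pos_eq_centralAddr hn ⟨by omega, by omega⟩]
  simp [centralAddr]

end KRSystem

theorem mainTheorem6 :
    -- the symbolic realization exists
    (∃ ω : ℤ → ℕ, Tendsto KRSystem.approx atTop (𝓝 ω) ∧
      KRSystem.IsExampleSystem (KRSystem.subshift ω)) ∧
    -- every realization has the claimed properties
    ∀ (X : Type u) [TopologicalSpace X] [MeasurableSpace X] [BorelSpace X] (T : X ≃ₜ X),
      KRSystem.IsExampleSystem T →
      KRSystem.IsLinearlyRecurrent T ∧
      ∃ μ : Measure X,
        IsProbabilityMeasure μ ∧ Ergodic T μ ∧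
        (∀ ν : Measure X, IsProbabilityMeasure ν → MeasurePreserving T ν ν → ν = μ) ∧
        {lam : ℂ | KRSystem.IsEigenvalue T μ lam} = KRSystem.explicitEigenvalues ∧
        (∀ lam : ℂ, KRSystem.IsContinuousEigenvalue T lam ↔ lam = 1) ∧
        (∃ K : MeasurableSpace X, KRSystem.IsKroneckerAlgebra K T μ ∧
          ∃ s : Set X, MeasurableSet[K] s ∧ μ s ≠ 0 ∧ μ s ≠ 1) ∧
        KRSystem.IsMaximalEquicontinuousFactor T (Homeomorph.refl PUnit.{u + 1})
          (fun _ => PUnit.unit) := by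
  refine ⟨⟨KRSystem.fixedPoint, KRSystem.tendsto_approx, KRSystem.isExampleSystem_subshift⟩, ?_⟩
  intro X _ _ _ T hT
  exact hT.properties
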